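/- Let $q\ge 2$ be an integer and let $\mathrm{BS}(1,q)=\langle a,t\mid tat^{-1}=a^q\rangle$, identified with $\mathbb{Z}[\tfrac1q]\rtimes\mathbb{Z}$, i.e. with the set of pairs $(r,m)$, $r\in\mathbb{Z}[\tfrac1q]$, $m\in\mathbb{Z}$, with multiplication $(r,m)(r',m')=(r+q^m r',m+m')$, via $a\mapsto(1,0)$, $t\mapsto(0,1)$. The pointed expansion $\mathsf{pe}(r,m)$ is the finite word that consists of the sign of $r$ ($+$ if $r=0$) followed by the base-$q$ digits $a_{k_1}\cdots a_1a_0a_{-1}\cdots a_{-k_2}$ of $|r|=\sum_{i=-k_2}^{k_1}a_iq^i$, where $k_1,k_2\ge 0$ are as small as possible subject to $-k_2\le m\le k_1$, and where the digit $a_0$ carries a mark $\bullet$ (radix point) and the digit $a_m$ carries a mark $\triangleleft$ (cursor). A subset $R\subseteq\mathrm{BS}(1,q)$ is PE-regular if the language $\mathsf{pe}(R)=\{\mathsf{pe}(g)\mid g\in R\}$ is regular; it is given by a nondeterministic finite automaton $\mathcal{A}$ over the alphabet of signs and marked digits, which represents $\{g\in\mathrm{BS}(1,q)\mid\mathsf{pe}(g)\in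 L(\mathcal{A})\}$ (this set is $R$ if $L(\mathcal{A})=\mathsf{pe}(R)$). A rational subset of $\mathrm{BS}(1,q)$ is the set of all elements represented by the words in $L(\mathcal{A})$, for a given nondeterministic finite automaton $\mathcal{A}$ with labels in $\{a,a^{-1},t,t^{-1}\}$. A subset $S$ of a monoid $M$ is recognizable if $S=\varphi^{-1}(\varphi(S))$ for some morphism $\varphi$ from $M$ to a finite monoid. Then each of the following problems is decidable: 1. given a PE-regular subset of $\mathrm{BS}(1,q)$ (by an automaton), is it recognizable? 2. given a rational subset of $\mathrm{BS}(1,q)$ (by an automaton), is it recognizable? 3. given finitely many words over $\{a,a^{-1},t,t^{-1}\}$, does the subgroup of $\mathrm{BS}(1,q)$ that they generate have finite index? -/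

import Mathlib

/-- A subset `S` of a monoid `M` is recognizable if `S = φ⁻¹(φ(S))` for some morphism `φ` from `M`
to a finite monoid. -/
def IsRecognizable {M : Type*} [Monoid M] (S : Set M) : Prop :=
  ∃ (F : Type) (_ : Monoid F) (_ : Finite F) (φ : M →* F), S = φ ⁻¹' (φ '' S)

/-- A nondeterministic finite automaton with edge labels in `α`, as finite data: the states are
(named by) natural numbers, and only the finitely many states that occur in the data matter. -/
structure FinAutomaton (α : Type) where
  /-- the initial state -/
  init : ℕ
  /-- the final states -/
  final : List ℕ
  /-- the edges (source, label, target) -/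
  edges : List (ℕ × α × ℕ)

namespace FinAutomaton

variable {α : Type}

/-- An automaton is the same as the tuple of its components. -/
def equivTuple (α : Type) : FinAutomaton α ≃ ℕ × List ℕ × List (ℕ × α × ℕ) where
  toFun A := (A.init, A.final, A.edges)
  invFun x := ⟨x.1, x.2.1, x.2.2⟩
  left_inv _ := rfl
  right_inv _ := rfl

instance [Primcodable α] : Primcodable (FinAutomaton α) :=
  Primcodable.ofEquiv _ (equivTuple α)

/-- `A.Run p w p'`: there is a run of `A` from `p` to `p'` whose sequence of labels is `w`. -/
inductive Run (A : FinAutomaton α) : ℕ → List α → ℕ → Prop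
  | nil (p : ℕ) : Run A p [] p
  | cons {p p' p'' : ℕ} {x : α} {w : List α} :
      (p, x, p') ∈ A.edges → Run A p' w p'' → Run A p (x :: w) p''

/-- The words that label an accepting run. -/
def language (A : FinAutomaton α) : Language α :=
  {w | ∃ f ∈ A.final, A.Run A.init w f}

end FinAutomaton

/-- The two generators of a Baumslag-Solitar group. -/
inductive BSGen : Type
  | a
  | t

namespace BSGen

/-- The two generators, coded as Booleans. -/
def equivBool : BSGen ≃ Bool where
  toFun | a => false | t => true
  invFun | false => a | true => t
  left_inv x := by cases x <;> rfl
  right_inv x := by cases x <;> rfl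

instance : Primcodable BSGen := Primcodable.ofEquiv _ equivBool

end BSGen

/-- The relator `t a^p t⁻¹ a^(-q)`. -/
def bsRels (p q : ℕ) : Set (FreeGroup BSGen) :=
  {FreeGroup.of BSGen.t * FreeGroup.of BSGen.a ^ p * (FreeGroup.of BSGen.t)⁻¹ *
    (FreeGroup.of BSGen.a ^ q)⁻¹}

/-- The Baumslag-Solitar group `BS(p,q) = ⟨a, t ∣ t a^p t⁻¹ = a^q⟩`. -/
abbrev BaumslagSolitar (p q : ℕ) : Type := PresentedGroup (bsRels p q)

/-- The letters `a, a⁻¹, t, t⁻¹` (`true` marks a generator, `false` its inverse). -/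
abbrev BSLetter : Type := BSGen × Bool

/-- The element of `BS(p,q)` that a word over `{a, a⁻¹, t, t⁻¹}` represents. -/
def BaumslagSolitar.ofWord (p q : ℕ) (w : List BSLetter) : BaumslagSolitar p q :=
  PresentedGroup.mk _ (FreeGroup.mk w)

/-- The ring `ℤ[1/q]`, a subring of `ℚ`. -/
def ZInv (q : ℕ) : Subring ℚ := Subring.closure {(q : ℚ)⁻¹}

/-- The group `ℤ[1/q] ⋊ ℤ`: pairs `(r, m)`, `r ∈ ℤ[1/q]`, `m ∈ ℤ`, with the multiplication
`(r, m) (r', m') = (r + q ^ m r', m + m')`. -/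
@[ext]
structure PointedNum (q : ℕ) : Type where
  /-- the number -/
  num : ℚ
  /-- the cursor -/
  pos : ℤ
  num_mem : num ∈ ZInv q

namespace PointedNum

variable {q : ℕ}

theorem zpow_mem (q : ℕ) (m : ℤ) : (q : ℚ) ^ m ∈ ZInv q := by
  have h : (q : ℚ)⁻¹ ∈ ZInv q := Subring.subset_closure rfl
  cases m with
  | ofNat n =>
    rw [Int.ofNat_eq_natCast, zpow_natCast]
    exact pow_mem (natCast_mem _ _) n
  | negSucc n =>
    rw [zpow_negSucc, ← inv_pow]
    exact pow_mem h _

instance : Mul (PointedNum q) :=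
  ⟨fun x y => ⟨x.num + (q : ℚ) ^ x.pos * y.num, x.pos + y.pos,
    add_mem x.num_mem (mul_mem (zpow_mem q _) y.num_mem)⟩⟩

instance : One (PointedNum q) := ⟨⟨0, 0, zero_mem _⟩⟩

instance : Inv (PointedNum q) :=
  ⟨fun x => ⟨-((q : ℚ) ^ (-x.pos) * x.num), -x.pos,
    neg_mem (mul_mem (zpow_mem q _) x.num_mem)⟩⟩

@[simp] theorem mul_num (x y : PointedNum q) : (x * y).num = x.num + (q : ℚ) ^ x.pos * y.num := rfl
@[simp] theorem mul_pos (x y : PointedNum q) : (x * y).pos = x.pos + y.pos := rfl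
@[simp] theorem one_num : (1 : PointedNum q).num = 0 := rfl
@[simp] theorem one_pos : (1 : PointedNum q).pos = 0 := rfl
@[simp] theorem inv_num (x : PointedNum q) : (x⁻¹).num = -((q : ℚ) ^ (-x.pos) * x.num) := rfl
@[simp] theorem inv_pos (x : PointedNum q) : (x⁻¹).pos = -x.pos := rfl

instance [NeZero q] : Group (PointedNum q) :=
  Group.ofLeftAxioms
    (by
      intro x y z
      have hq : (q : ℚ) ≠ 0 := NeZero.ne _
      ext <;> simp [zpow_add₀ hq] <;> ring)
    (by intro x; ext <;> simp)
    (by intro x; ext <;> simp)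

/-- `(1, 0)`, the image of `a`. -/
def add1 (q : ℕ) : PointedNum q := ⟨1, 0, one_mem _⟩

/-- `(0, 1)`, the image of `t`. -/
def move1 (q : ℕ) : PointedNum q := ⟨0, 1, zero_mem _⟩

theorem add1_pow [NeZero q] (n : ℕ) : add1 q ^ n = ⟨n, 0, natCast_mem _ _⟩ := by
  induction n with
  | zero => ext <;> simp
  | succ n ih => rw [pow_succ, ih]; ext <;> simp [add1]

end PointedNum

theorem ZInv.exists_mul_pow {q : ℕ} [NeZero q] {r : ℚ} (hr : r ∈ ZInv q) :
    ∃ (i : ℕ) (n : ℤ), r * (q : ℚ) ^ i = n := by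
  have hq : (q : ℚ) ≠ 0 := NeZero.ne _
  induction hr using Subring.closure_induction with
  | mem x hx => exact ⟨1, 1, by rw [Set.mem_singleton_iff.1 hx]; simp [hq]⟩
  | zero => exact ⟨0, 0, by simp⟩
  | one => exact ⟨0, 1, by simp⟩
  | neg x _ ih =>
    obtain ⟨i, n, h⟩ := ih
    exact ⟨i, -n, by push_cast; rw [← h]; ring⟩
  | add x y _ _ hx hy =>
    obtain ⟨i, n, h⟩ := hx
    obtain ⟨j, k, h'⟩ := hy
    exact ⟨i + j, n * q ^ j + k * q ^ i, by push_cast; rw [← h, ← h']; ring⟩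
  | mul x y _ _ hx hy =>
    obtain ⟨i, n, h⟩ := hx
    obtain ⟨j, k, h'⟩ := hy
    exact ⟨i + j, n * k, by push_cast; rw [← h, ← h']; ring⟩

namespace BaumslagSolitar

variable (q : ℕ)

/-- The homomorphism `BS(1,q) → ℤ[1/q] ⋊ ℤ` with `a ↦ (1, 0)` and `t ↦ (0, 1)`. -/
def toPointed [NeZero q] : BaumslagSolitar 1 q →* PointedNum q :=
  PresentedGroup.toGroup
    (f := fun x => match x with | BSGen.a => PointedNum.add1 q | BSGen.t => PointedNum.move1 q)
    (by
      rintro _ rfl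
      simp only [map_mul, map_inv, map_pow, FreeGroup.lift_apply_of, PointedNum.add1_pow]
      ext <;> simp [PointedNum.move1])

/-- The generator `a`. -/
def a : BaumslagSolitar 1 q := PresentedGroup.of BSGen.a

/-- The generator `t`. -/
def t : BaumslagSolitar 1 q := PresentedGroup.of BSGen.t

theorem t_mul_a : t q * a q = a q ^ q * t q := by
  have h := PresentedGroup.one_of_mem (rels := bsRels 1 q) (x := _) rfl
  simp only [map_mul, map_inv, map_pow, pow_one] at h
  have h' : t q * a q * (t q)⁻¹ * (a q ^ q)⁻¹ = 1 := h
  rw [mul_inv_eq_one, mul_inv_eq_iff_eq_mul] at h'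
  exact h'

theorem t_pow_mul_a_zpow (k : ℕ) (n : ℤ) :
    t q ^ k * a q ^ n = a q ^ (n * (q : ℤ) ^ k) * t q ^ k := by
  induction k with
  | zero => simp
  | succ k ih =>
    have h1 : SemiconjBy (t q) (a q) (a q ^ q) := t_mul_a q
    have h2 := h1.zpow_right (n * (q : ℤ) ^ k)
    rw [pow_succ' (t q), mul_assoc, ih, ← mul_assoc, h2.eq, ← zpow_natCast (a q), ← zpow_mul,
      mul_assoc]
    congr 2
    ring

theorem exists_normal_form (g : BaumslagSolitar 1 q) :
    ∃ (i : ℕ) (n k : ℤ), g = (t q ^ i)⁻¹ * a q ^ n * t q ^ k := by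
  have key : ∀ g : BaumslagSolitar 1 q,
      (∃ (i : ℕ) (n k : ℤ), g = (t q ^ i)⁻¹ * a q ^ n * t q ^ k) → ∀ e : ℤ,
      (∃ (i : ℕ) (n k : ℤ), g * a q ^ e = (t q ^ i)⁻¹ * a q ^ n * t q ^ k) := by
    rintro _ ⟨i, n, k, rfl⟩ e
    obtain ⟨j, rfl | rfl⟩ := Int.eq_nat_or_neg k
    · refine ⟨i, n + e * (q : ℤ) ^ j, j, ?_⟩
      rw [zpow_natCast, mul_assoc, t_pow_mul_a_zpow, zpow_add]
      group
    · refine ⟨j + i, n * (q : ℤ) ^ j + e, 0, ?_⟩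
      have h := t_pow_mul_a_zpow q j n
      have h' : a q ^ n * (t q ^ j)⁻¹ = (t q ^ j)⁻¹ * a q ^ (n * (q : ℤ) ^ j) := by
        rw [mul_inv_eq_iff_eq_mul, mul_assoc, ← h]; group
      rw [zpow_neg, zpow_natCast, mul_assoc _ (a q ^ n), h', zpow_add, pow_add, mul_inv_rev]
      group
  have step : ∀ (x : BSGen) (e : ℤ) (g : BaumslagSolitar 1 q),
      (∃ (i : ℕ) (n k : ℤ), g = (t q ^ i)⁻¹ * a q ^ n * t q ^ k) →
      (∃ (i : ℕ) (n k : ℤ), g * PresentedGroup.of x ^ e = (t q ^ i)⁻¹ * a q ^ n * t q ^ k) := by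
    rintro (_ | _) e g hg
    · exact key g hg e
    · obtain ⟨i, n, k, rfl⟩ := hg
      exact ⟨i, n, k + e, by rw [zpow_add, ← mul_assoc]; rfl⟩
  have hg : g ∈ Subgroup.closure (Set.range (PresentedGroup.of (rels := bsRels 1 q))) := by
    rw [PresentedGroup.closure_range_of]
    trivial
  induction hg using Subgroup.closure_induction_right with
  | one => exact ⟨0, 0, 0, by simp⟩
  | mul_right y hy z hz ih =>
    obtain ⟨x, rfl⟩ := hz
    simpa using step x 1 _ ih
  | mul_inv_cancel y hy z hz ih =>
    obtain ⟨x, rfl⟩ := hz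
    simpa using step x (-1) _ ih

theorem toPointed_normal_form [NeZero q] (i : ℕ) (n k : ℤ) :
    (toPointed q ((t q ^ i)⁻¹ * a q ^ n * t q ^ k)).num = n * ((q : ℚ) ^ i)⁻¹ ∧
    (toPointed q ((t q ^ i)⁻¹ * a q ^ n * t q ^ k)).pos = k - i := by
  have ha : ∀ n : ℤ, toPointed q (a q ^ n) = ⟨n, 0, intCast_mem _ _⟩ := by
    intro n
    have h1 : toPointed q (a q) = PointedNum.add1 q := PresentedGroup.toGroup.of _
    rw [map_zpow, h1]
    obtain ⟨j, rfl | rfl⟩ := Int.eq_nat_or_neg n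
    · rw [zpow_natCast, PointedNum.add1_pow]; rfl
    · rw [zpow_neg, zpow_natCast, PointedNum.add1_pow]; ext <;> simp
  have ht : ∀ n : ℤ, toPointed q (t q ^ n) = ⟨0, n, zero_mem _⟩ := by
    have h1 : toPointed q (t q) = PointedNum.move1 q := PresentedGroup.toGroup.of _
    have h2 : ∀ n : ℕ, PointedNum.move1 q ^ n = ⟨0, n, zero_mem _⟩ := by
      intro n
      induction n with
      | zero => ext <;> simp
      | succ n ih => rw [pow_succ, ih]; ext <;> simp [PointedNum.move1]
    intro n
    rw [map_zpow, h1]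
    obtain ⟨j, rfl | rfl⟩ := Int.eq_nat_or_neg n
    · rw [zpow_natCast, h2]
    · rw [zpow_neg, zpow_natCast, h2]; ext <;> simp
  have ht' := ht i
  rw [zpow_natCast] at ht'
  rw [map_mul, map_mul, map_inv, ha, ht, ht']
  constructor
  · simp [mul_comm]
  · simp; ring

/-- The identification of `BS(1,q)` with `ℤ[1/q] ⋊ ℤ`, for `q ≥ 1`. -/
theorem toPointed_bijective [NeZero q] : Function.Bijective (toPointed q) := by
  have hq : (q : ℚ) ≠ 0 := NeZero.ne _
  constructor
  · rw [injective_iff_map_eq_one]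
    intro g hg
    obtain ⟨i, n, k, rfl⟩ := exists_normal_form q g
    obtain ⟨h1, h2⟩ := toPointed_normal_form q i n k
    rw [hg] at h1 h2
    simp only [PointedNum.one_num, PointedNum.one_pos] at h1 h2
    have hn : n = 0 := by
      have := (mul_eq_zero.1 h1.symm).resolve_right (inv_ne_zero (pow_ne_zero _ hq))
      exact_mod_cast this
    have hk : k = i := by omega
    subst hn hk
    simp
  · intro x
    obtain ⟨i, n, h⟩ := ZInv.exists_mul_pow x.num_mem
    obtain ⟨h1, h2⟩ := toPointed_normal_form q i n (x.pos + i)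
    refine ⟨_, PointedNum.ext (h1.trans ?_) (h2.trans (by ring))⟩
    rw [← h]
    field_simp

end BaumslagSolitar

/-- The letters of pointed expansions: a sign (`true` is `-`), or a digit in `{0, …, q - 1}` with
two marks that tell whether it carries the radix point `•` and whether it carries the cursor `◁`. -/
abbrev PELetter (q : ℕ) : Type := Bool ⊕ (Fin q × Bool × Bool)

namespace PointedNum

variable {q : ℕ} [NeZero q]

/-- The digit of `|r|` at position `i` in base `q`, that is `⌊|r| / q ^ i⌋ mod q`. -/
def digit (x : PointedNum q) (i : ℤ) : Fin q := Fin.ofNat q ⌊|x.num| / (q : ℚ) ^ i⌋₊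

/-- The least `k ≥ 0` such that no nonzero digit and no cursor is at a position above `k`. -/
noncomputable def top (x : PointedNum q) : ℕ :=
  sInf {k : ℕ | x.pos ≤ k ∧ ∀ i : ℤ, k < i → x.digit i = 0}

/-- The least `k ≥ 0` such that no nonzero digit and no cursor is at a position below `-k`. -/
noncomputable def bot (x : PointedNum q) : ℕ :=
  sInf {k : ℕ | -(k : ℤ) ≤ x.pos ∧ ∀ i : ℤ, i < -(k : ℤ) → x.digit i = 0}

/-- The pointed expansion of `(r, m)`: the sign of `r` (`+` if `r = 0`), followed by the digits of
`|r|`, from the most to the least significant one, in the shortest range of positions that contains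
the positions `0` and `m` and all nonzero digits. The digit at position `0` is marked with the radix
point, the digit at position `m` with the cursor. -/
noncomputable def pe (x : PointedNum q) : List (PELetter q) :=
  Sum.inl (decide (x.num < 0)) ::
    (List.range (x.top + x.bot + 1)).map fun j : ℕ =>
      Sum.inr (x.digit (x.top - j), decide ((x.top : ℤ) - j = 0), decide ((x.top : ℤ) - j = x.pos))

end PointedNum

namespace BaumslagSolitar

/-- The pointed expansion of an element of `BS(1,q)`. -/
noncomputable def pe (q : ℕ) [NeZero q] (g : BaumslagSolitar 1 q) : List (PELetter q) :=
  (toPointed q g).pe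

/-- The PE-regular subset of `BS(1,q)` that an automaton over the alphabet of pointed expansions
represents: the set of all elements whose pointed expansions are accepted. -/
def peSubset (q : ℕ) [NeZero q] (A : FinAutomaton (PELetter q)) : Set (BaumslagSolitar 1 q) :=
  {g | pe q g ∈ A.language}

/-- The rational subset of `BS(1,q)` that an automaton with labels `a, a⁻¹, t, t⁻¹` accepts. -/
def rationalSubset (q : ℕ) (A : FinAutomaton BSLetter) : Set (BaumslagSolitar 1 q) :=
  ofWord 1 q '' A.language

/-- The subgroup of `BS(1,q)` that is generated by the elements that the words in a finite list
represent. -/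
def subgroupOfWords (q : ℕ) (L : List (List BSLetter)) : Subgroup (BaumslagSolitar 1 q) :=
  Subgroup.closure (ofWord 1 q '' {w | w ∈ L})

end BaumslagSolitar

namespace PointedNum
variable {q : ℕ} [q.AtLeastTwo]

theorem two_le (q : ℕ) [q.AtLeastTwo] : 2 ≤ q := Nat.AtLeastTwo.prop

theorem exists_scale (x : PointedNum q) : ∃ L N : ℕ, |x.num| = N / (q:ℚ) ^ L := by
  have hq : (0:ℚ) < q := by have := two_le q; positivity
  obtain ⟨i, n, h⟩ := ZInv.exists_mul_pow x.num_mem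
  refine ⟨i, n.natAbs, ?_⟩
  rw [eq_div_iff (by positivity), Nat.cast_natAbs, ← abs_of_pos (pow_pos hq i), ← abs_mul, h]
  simp

theorem digit_scale (x : PointedNum q) {L N : ℕ} (h : |x.num| = N / (q:ℚ) ^ L) (j : ℕ) :
    x.digit ((j:ℤ) - L) = Fin.ofNat q (N / q ^ j) := by
  have hq : (0:ℚ) < q := by have := two_le q; positivity
  unfold digit
  rw [h, zpow_sub₀ hq.ne', zpow_natCast, zpow_natCast]
  congr 1
  rw [← Nat.floor_div_eq_div (K := ℚ)]
  congr 1
  push_cast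
  field_simp

theorem digit_low (x : PointedNum q) {L N : ℕ} (h : |x.num| = N / (q:ℚ) ^ L) (i : ℤ) (hi : i < -L) :
    x.digit i = 0 := by
  have hq : (0:ℚ) < q := by have := two_le q; positivity
  obtain ⟨k, hk⟩ : ∃ k : ℕ, i = -(L:ℤ) - (k+1:ℕ) := ⟨(-(L:ℤ) - i - 1).toNat, by omega⟩
  have : |x.num| / (q:ℚ)^i = ((N * q^k * q : ℕ) : ℚ) := by
    rw [h, hk, zpow_sub₀ hq.ne', zpow_neg, zpow_natCast, zpow_natCast]
    push_cast
    field_simp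
    ring
  unfold digit
  rw [this, Nat.floor_natCast]
  ext
  simp

theorem digit_high (x : PointedNum q) {L N : ℕ} (h : |x.num| = N / (q:ℚ) ^ L) (i : ℤ) (hi : N < i) :
    x.digit i = 0 := by
  have hq : 2 ≤ q := two_le q
  obtain ⟨j, hj⟩ : ∃ j : ℕ, i = (j:ℤ) - L := ⟨(i + L).toNat, by omega⟩
  rw [hj, x.digit_scale h, Nat.div_eq_of_lt]
  · ext; simp
  · have := Nat.lt_pow_self (show 1 < q by omega) (n := j)
    omega

theorem top_spec (x : PointedNum q) : x.pos ≤ x.top ∧ ∀ i : ℤ, x.top < i → x.digit i = 0 := by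
  obtain ⟨L, N, h⟩ := x.exists_scale
  have : {k : ℕ | x.pos ≤ k ∧ ∀ i : ℤ, k < i → x.digit i = 0}.Nonempty :=
    ⟨N + x.pos.toNat, by
      constructor
      · push_cast; omega
      · intro i hi
        exact x.digit_high h i (by push_cast at hi; omega)⟩
  exact Nat.sInf_mem this

theorem bot_spec (x : PointedNum q) :
    -(x.bot:ℤ) ≤ x.pos ∧ ∀ i : ℤ, i < -(x.bot : ℤ) → x.digit i = 0 := by
  obtain ⟨L, N, h⟩ := x.exists_scale
  have : {k : ℕ | -(k:ℤ) ≤ x.pos ∧ ∀ i : ℤ, i < -(k:ℤ) → x.digit i = 0}.Nonempty :=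
    ⟨L + (-x.pos).toNat, by
      constructor
      · push_cast; omega
      · intro i hi
        exact x.digit_low h i (by push_cast at hi; omega)⟩
  exact Nat.sInf_mem this

theorem nat_eq_of_digits (b : ℕ) (hb : 2 ≤ b) : ∀ (N N' : ℕ), (∀ j, N / b^j % b = N' / b^j % b) → N = N' := by
  intro N
  induction N using Nat.strong_induction_on with
  | _ N ih =>
    intro N' h
    have h0 := h 0
    simp only [pow_zero, Nat.div_one] at h0
    have hs : ∀ j, N / b / b^j % b = N' / b / b^j % b := fun j => by
      have := h (j+1)
      rwa [pow_succ', ← Nat.div_div_eq_div_mul, ← Nat.div_div_eq_div_mul] at this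
    rcases Nat.eq_zero_or_pos N with rfl | hN
    · by_contra hne
      have : ∀ N' : ℕ, (∀ j, 0 / b^j % b = N' / b^j % b) → N' = 0 := by
        intro N'
        induction N' using Nat.strong_induction_on with
        | _ N' ih' =>
          intro h
          by_contra hne
          have h0 := h 0
          simp only [pow_zero, Nat.div_one] at h0
          have := ih' (N'/b) (Nat.div_lt_self (by omega) hb) (fun j => by
            have := h (j+1)
            rwa [pow_succ', ← Nat.div_div_eq_div_mul, ← Nat.div_div_eq_div_mul, Nat.zero_div] at this)
          have e := Nat.div_add_mod N' b
          rw [this, ← h0] at e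
          simp at e
          omega
      exact hne (this N' h).symm
    · have := ih (N/b) (Nat.div_lt_self hN hb) _ hs
      rw [← Nat.div_add_mod N b, ← Nat.div_add_mod N' b, this, h0]

theorem pe_injective : Function.Injective (pe (q := q)) := by
  intro x y hxy
  have hq : (0:ℚ) < q := by have := two_le q; positivity
  unfold pe at hxy
  rw [List.cons.injEq] at hxy
  obtain ⟨hs, hl⟩ := hxy
  have hlen := congrArg List.length hl
  simp only [List.length_map, List.length_range] at hlen
  have hj : ∀ j : ℕ, j < x.top + x.bot + 1 →
      x.digit (x.top - j) = y.digit (y.top - j) ∧ (((x.top : ℤ) - j = 0) ↔ ((y.top : ℤ) - j = 0)) ∧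
      (((x.top : ℤ) - j = x.pos) ↔ ((y.top : ℤ) - j = y.pos)) := by
    intro j hj
    have := congrArg (fun l => l[j]?) hl
    have hj' : j < y.top + y.bot + 1 := by omega
    simp [hj, hj'] at this
    exact ⟨this.1, this.2.1, this.2.2⟩
  have htop : x.top = y.top := by
    have := (hj x.top (by omega)).2.1
    omega
  obtain ⟨t1, t2⟩ := x.top_spec
  obtain ⟨b1, b2⟩ := x.bot_spec
  obtain ⟨t3, t4⟩ := y.top_spec
  obtain ⟨b3, b4⟩ := y.bot_spec
  have hpos : x.pos = y.pos := by
    have := (hj ((x.top:ℤ) - x.pos).toNat (by omega)).2.2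
    omega
  have hd : ∀ i, x.digit i = y.digit i := by
    intro i
    by_cases h1 : x.top < i
    · rw [t2 i h1, t4 i (by omega)]
    by_cases h2 : i < -x.bot
    · rw [b2 i h2, b4 i (by omega)]
    have := (hj ((x.top:ℤ) - i).toNat (by omega)).1
    rw [Int.toNat_of_nonneg (by omega), ← htop] at this
    simpa using this
  obtain ⟨L, N, hN⟩ := x.exists_scale
  obtain ⟨L', N', hN'⟩ := y.exists_scale
  have e1 : |x.num| = ((N * q^L' : ℕ):ℚ) / (q:ℚ)^(L+L') := by
    rw [hN]; push_cast; rw [pow_add]; field_simp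
  have e2 : |y.num| = ((N' * q^L : ℕ):ℚ) / (q:ℚ)^(L+L') := by
    rw [hN']; push_cast; rw [pow_add]; field_simp
  have : N * q^L' = N' * q^L := by
    apply nat_eq_of_digits q (two_le q)
    intro j
    have h := hd ((j:ℤ) - (L+L' : ℕ))
    rw [x.digit_scale e1, y.digit_scale e2] at h
    simpa using congrArg Fin.val h
  have habs : |x.num| = |y.num| := by rw [e1, e2, this]
  have hsg : x.num < 0 ↔ y.num < 0 := by simpa using hs
  refine PointedNum.ext ?_ hpos
  rcases lt_or_ge x.num 0 with h | h
  · rw [abs_of_neg h, abs_of_neg (hsg.1 h)] at habs; linarith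
  · rw [abs_of_nonneg h, abs_of_nonneg (not_lt.1 (fun h' => absurd (hsg.2 h') (not_lt.2 h)))] at habs
    exact habs
end PointedNum

/-- Pointed expansions represent the elements of `BS(1,q)` uniquely. -/
theorem BaumslagSolitar.pe_injective (q : ℕ) [q.AtLeastTwo] : Function.Injective (pe q) :=
  PointedNum.pe_injective.comp (toPointed_bijective q).1

/-- An automaton that accepts exactly the pointed expansions of the elements of `R` represents `R`.
So every PE-regular subset, given by an automaton for its language of pointed expansions, is of the
form `peSubset q A`. -/
theorem BaumslagSolitar.peSubset_eq (q : ℕ) [q.AtLeastTwo] (A : FinAutomaton (PELetter q))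
    (R : Set (BaumslagSolitar 1 q)) (h : A.language = pe q '' R) : peSubset q A = R := by
  unfold peSubset
  rw [h]
  exact (pe_injective q).preimage_image R

/-! A homomorphism from `BS(1,q)` to a finite monoid lands in the units. If `k` and `n` are the
orders of the images of `t` and `a`, then `t ^ k a = a ^ (q ^ k) t ^ k` forces `n ∣ q ^ k - 1`. So a
set is recognizable iff, for some such `n, k > 0`, it is a union of classes of `x ≡ x'` modulo `n
ℤ[1/q]`, `m ≡ m'` modulo `k` (`isRecognizable_iff`). Both the search for `n, k` and the test of a
given pair have to be made finite.

This rests on a finiteness property that mentions no automaton. A number with its two marks is cut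
at one level into an integer and a fractional half; `FiniteHalves q P N` says that, with respect to
`P`, upper halves distinguish at most `N` types of lower halves. Up to the bound this is the
finiteness of the Myhill-Nerode index for suffixes of digit words (`FiniteSuffixes`). If `P` has any
periods, pigeonhole on lower halves yields periods `n ≤ N`, `k ≤ N * N`
(`FiniteHalves.exists_small_periods`). Congruence classes are finite-state too, so the two elements
that witness a failure of given periods can be pumped down separately inside their classes
(`FiniteHalves.saturated_iff`). For a PE-regular set `N` is bounded in terms of the number of edges
(`finiteSuffixes_peSubset`); the first problem is even primitive recursive.

For rational sets the difficulty is that a run may visit a level arbitrarily often. A run is a walk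
on pairs (level, state) in which a letter `a` or `a⁻¹` read at level `i` contributes `q ^ i` or `-q
^ i`. If a configuration is visited more than `D` times, some block of loops there contributes a
multiple of `D q ^ i` and can be deleted; the deleted amount is restored by closed runs contributing
`± D q ^ i` at slack states (`IsSlack`). Every walk is thus a thin walk with slack inserted at no
more than two configurations, and cutting a thin walk at level `0` leaves boundedly many crossings
and a bounded carry (`IsSlack.finiteHalves`).

Hence rational sets are PE-regular, but no automaton is constructed. Instead, the equality of a
rational and a PE-regular set has finite certificates (`RatCert`): PE automata for the states,
compatible with the edges, give one inclusion, and certified slack states bound the test of the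
other one. Certificates exist and are checked primitive recursively, so the second problem and its
complement are both recursively enumerable.

A subgroup has finite index iff some generator moves the cursor and two generators do not commute: a
nontrivial commutator is some `(x, 0)`, and conjugation by cursor-moving elements spreads it to all
multiples of some `n > 0` in `ℤ[1/q]` (`finiteIndex_closure_iff`). -/

/-! ### Congruences of `ℤ[1/q]` and of `BS(1,q)` -/

namespace ZInv

variable {q : ℕ}

/-- Congruence modulo `n ℤ[1/q]`. -/
def ModEq (q n : ℕ) (x y : ℚ) : Prop := ∃ z ∈ ZInv q, x - y = n * z

namespace ModEq

variable {n : ℕ} {x y z w : ℚ}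

theorem refl (x : ℚ) : ModEq q n x x := ⟨0, zero_mem _, by simp⟩

theorem symm (h : ModEq q n x y) : ModEq q n y x := by
  obtain ⟨a, ha, e⟩ := h
  exact ⟨-a, neg_mem ha, by linear_combination -e⟩

theorem trans (h : ModEq q n x y) (h' : ModEq q n y z) : ModEq q n x z := by
  obtain ⟨a, ha, e⟩ := h
  obtain ⟨b, hb, e'⟩ := h'
  exact ⟨a + b, add_mem ha hb, by linear_combination e + e'⟩

theorem add (h : ModEq q n x y) (h' : ModEq q n z w) : ModEq q n (x + z) (y + w) := by
  obtain ⟨a, ha, e⟩ := h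
  obtain ⟨b, hb, e'⟩ := h'
  exact ⟨a + b, add_mem ha hb, by linear_combination e + e'⟩

theorem mul (h : ModEq q n x y) (h' : ModEq q n z w) (hy : y ∈ ZInv q) (hz : z ∈ ZInv q) :
    ModEq q n (x * z) (y * w) := by
  obtain ⟨a, ha, e⟩ := h
  obtain ⟨b, hb, e'⟩ := h'
  exact ⟨a * z + y * b, add_mem (mul_mem ha hz) (mul_mem hy hb), by
    linear_combination z * e + y * e'⟩

end ModEq

variable [NeZero q] {n k : ℕ}

/-- The relation `q ^ k ≡ 1` passes to powers; negative exponents are covered because `q` is a unit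
of `ℤ[1/q]`. -/
theorem modEq_zpow_one (h : n ∣ q ^ k - 1) (j : ℤ) :
    ModEq q n ((q : ℚ) ^ ((k : ℤ) * j)) 1 := by
  have hq : (q : ℚ) ≠ 0 := NeZero.ne _
  have h1 : ModEq q n ((q : ℚ) ^ k) 1 := by
    obtain ⟨c, hc⟩ := h
    have : 1 ≤ q ^ k := Nat.one_le_pow _ _ (NeZero.pos q)
    refine ⟨c, natCast_mem _ _, ?_⟩
    have h2 : q ^ k = n * c + 1 := by omega
    have h3 : ((q ^ k : ℕ) : ℚ) = ((n * c + 1 : ℕ) : ℚ) := by rw [h2]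
    push_cast at h3
    linear_combination h3
  have hn : ∀ i : ℕ, ModEq q n ((q : ℚ) ^ (k * i)) 1 := by
    intro i
    induction i with
    | zero => simpa using ModEq.refl _
    | succ i ih =>
      rw [Nat.mul_succ, pow_add]
      simpa using ih.mul h1 (one_mem _) (pow_mem (natCast_mem _ _) _)
  obtain ⟨i, rfl | rfl⟩ := Int.eq_nat_or_neg j
  · exact_mod_cast hn i
  · obtain ⟨z, hz, e⟩ := hn i
    refine ⟨-(z * (q : ℚ) ^ ((k : ℤ) * -i)), neg_mem (mul_mem hz (PointedNum.zpow_mem _ _)), ?_⟩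
    have e2 : (q : ℚ) ^ ((k : ℤ) * -i) * (q : ℚ) ^ (k * i) = 1 := by
      rw [← zpow_natCast, ← zpow_add₀ hq]
      push_cast
      rw [show (k : ℤ) * -i + k * i = 0 by ring, zpow_zero]
    linear_combination (-(q : ℚ) ^ ((k : ℤ) * -i)) * e + e2

theorem modEq_zpow (h : n ∣ q ^ k - 1) {i j : ℤ} (hij : (k : ℤ) ∣ i - j) :
    ModEq q n ((q : ℚ) ^ i) ((q : ℚ) ^ j) := by
  have hq : (q : ℚ) ≠ 0 := NeZero.ne _
  obtain ⟨c, hc⟩ := hij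
  have := (modEq_zpow_one h c).mul (ModEq.refl ((q : ℚ) ^ j)) (one_mem _) (PointedNum.zpow_mem _ _)
  rw [← zpow_add₀ hq, one_mul] at this
  rwa [show i = k * c + j by omega]

/-- Modulo `n`, every element of `ℤ[1/q]` is an integer. -/
theorem exists_int_modEq (h : n ∣ q ^ k - 1) (hk : 0 < k) {x : ℚ} (hx : x ∈ ZInv q) :
    ∃ U : ℤ, ModEq q n x U := by
  have hq : (q : ℚ) ≠ 0 := NeZero.ne _
  obtain ⟨i, N, e⟩ := exists_mul_pow hx
  -- With `x = N / q ^ i`, multiplication by `q ^ (k * i) ≡ 1` clears the denominator.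
  refine ⟨N * (q : ℤ) ^ ((k - 1) * i), ?_⟩
  have h1 := (ModEq.refl (q := q) (n := n) x).mul (modEq_zpow_one h (i : ℤ)).symm hx (one_mem _)
  rw [mul_one] at h1
  convert h1 using 1
  push_cast
  rw [← e, mul_assoc, ← pow_add, ← Nat.cast_mul, zpow_natCast]
  congr 2
  obtain ⟨k, rfl⟩ := Nat.exists_eq_succ_of_ne_zero hk.ne'
  simp [Nat.succ_mul, add_comm]

theorem exists_fin_modEq (h : n ∣ q ^ k - 1) (hk : 0 < k) (hn : 0 < n) {x : ℚ} (hx : x ∈ ZInv q) :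
    ∃ j : Fin n, ModEq q n x (j : ℕ) := by
  obtain ⟨U, hU⟩ := exists_int_modEq h hk hx
  have h0 : 0 ≤ U % n := Int.emod_nonneg _ (by omega)
  refine ⟨⟨(U % n).toNat, by have := Int.emod_lt_of_pos U (b := n) (by omega); omega⟩,
    hU.trans ⟨((U / n : ℤ) : ℚ), intCast_mem _ _, ?_⟩⟩
  have h1 : (((U % n).toNat : ℤ) : ℚ) = ((U % n : ℤ) : ℚ) := by rw [Int.toNat_of_nonneg h0]
  have h2 : ((U % n + n * (U / n) : ℤ) : ℚ) = U := by rw [Int.emod_add_mul_ediv]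
  push_cast at h1 h2 ⊢
  rw [h1]
  linear_combination -h2

end ZInv

open ZInv

/-- `P` is a union of classes of the congruence `x ≡ x'` modulo `n`, `m ≡ m'` modulo `k`. -/
def Saturated (q : ℕ) (P : ℚ → ℤ → Prop) (n k : ℕ) : Prop :=
  ∀ ⦃x x' : ℚ⦄ ⦃m m' : ℤ⦄, x ∈ ZInv q → x' ∈ ZInv q → ModEq q n x x' → (k : ℤ) ∣ m - m' →
    (P x m ↔ P x' m')

/-! ### Finite quotients of `BS(1,q)` -/

namespace BaumslagSolitar

variable (q : ℕ) [NeZero q]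

/-- A subset of `BS(1,q)`, as a predicate on pairs in `ℤ[1/q] ⋊ ℤ`. -/
def memPred (R : Set (BaumslagSolitar 1 q)) (x : ℚ) (m : ℤ) : Prop :=
  ∃ g ∈ R, (toPointed q g).num = x ∧ (toPointed q g).pos = m

variable {q}

theorem memPred_iff (R : Set (BaumslagSolitar 1 q)) (g : BaumslagSolitar 1 q) :
    memPred q R (toPointed q g).num (toPointed q g).pos ↔ g ∈ R := by
  constructor
  · rintro ⟨g', hg', h1, h2⟩
    rwa [← (toPointed_bijective q).1 (PointedNum.ext h1 h2)]
  · exact fun h => ⟨g, h, rfl, rfl⟩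

theorem exists_toPointed {x : ℚ} (hx : x ∈ ZInv q) (m : ℤ) :
    ∃ g : BaumslagSolitar 1 q, (toPointed q g).num = x ∧ (toPointed q g).pos = m := by
  obtain ⟨g, hg⟩ := (toPointed_bijective q).2 ⟨x, m, hx⟩
  exact ⟨g, by rw [hg], by rw [hg]⟩

theorem toPointed_a_zpow (n : ℤ) :
    (toPointed q (a q ^ n)).num = n ∧ (toPointed q (a q ^ n)).pos = 0 := by
  simpa using toPointed_normal_form q 0 n 0

theorem toPointed_t_zpow (n : ℤ) :
    (toPointed q (t q ^ n)).num = 0 ∧ (toPointed q (t q ^ n)).pos = n := by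
  simpa using toPointed_normal_form q 0 0 n

/-- The congruence on `BS(1,q)` given by `n` and `k`, if `q ^ k ≡ 1` modulo `n`. -/
def periodCon (n k : ℕ) (h : n ∣ q ^ k - 1) : Con (BaumslagSolitar 1 q) where
  r g g' := ModEq q n (toPointed q g).num (toPointed q g').num ∧
    (k : ℤ) ∣ (toPointed q g).pos - (toPointed q g').pos
  iseqv :=
    { refl := fun g => ⟨ModEq.refl _, by simp⟩
      symm := fun h => ⟨h.1.symm, by rw [← neg_sub]; exact h.2.neg_right⟩
      trans := fun h h' => ⟨h.1.trans h'.1, by simpa using dvd_add h.2 h'.2⟩ }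
  mul' := by
    intro w x y z h1 h2
    simp only [map_mul, PointedNum.mul_num, PointedNum.mul_pos]
    -- The factor `q ^ pos` in the product depends, modulo `n`, only on the cursor modulo `k`.
    refine ⟨h1.1.add ((modEq_zpow h h1.2).mul h2.1 (PointedNum.zpow_mem _ _)
      (toPointed q y).num_mem), ?_⟩
    have h3 := dvd_add h1.2 h2.2
    rw [sub_add_sub_comm] at h3
    exact h3

theorem finite_periodCon (n k : ℕ) (h : n ∣ q ^ k - 1) (hn : 0 < n) (hk : 0 < k) :
    Finite (periodCon n k h).Quotient := by
  refine Finite.of_surjective (α := Fin n × Fin k)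
    (fun x => ((a q ^ (x.1 : ℤ) * t q ^ (x.2 : ℤ) : BaumslagSolitar 1 q) :
      (periodCon n k h).Quotient)) ?_
  intro x
  induction x using Con.induction_on with
  | H g =>
    obtain ⟨j, hj⟩ := exists_fin_modEq h hk hn (toPointed q g).num_mem
    have h0 := Int.emod_nonneg (toPointed q g).pos (b := k) (by omega)
    refine ⟨⟨j, ⟨((toPointed q g).pos % k).toNat, ?_⟩⟩, ?_⟩
    · have := Int.emod_lt_of_pos (toPointed q g).pos (b := k) (by omega)
      omega
    · refine (Con.eq _).2 ⟨?_, ?_⟩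
      · simp only [map_mul, PointedNum.mul_num, toPointed_a_zpow, toPointed_t_zpow]
        simpa using hj.symm
      · simp only [map_mul, PointedNum.mul_pos, toPointed_a_zpow, toPointed_t_zpow]
        rw [Int.toNat_of_nonneg h0]
        rw [zero_add, ← neg_sub]
        exact (Int.dvd_self_sub_emod).neg_right

/-- The finite quotients of `BS(1,q)` are given by periods `n` and `k` with `q ^ k ≡ 1` modulo
`n`. -/
theorem isRecognizable_iff (R : Set (BaumslagSolitar 1 q)) :
    IsRecognizable R ↔ ∃ n k : ℕ, 0 < n ∧ 0 < k ∧ n ∣ q ^ k - 1 ∧ Saturated q (memPred q R) n k := by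
  constructor
  · rintro ⟨F, _, _, φ, hφ⟩
    -- The image of a group consists of units, so the images of `a` and `t` have finite orders,
    -- which serve as `n` and `k`.
    let ψ := φ.toHomUnits
    have hψ : ∀ g, (ψ g : F) = φ g := fun g => rfl
    have : Finite Fˣ := inferInstance
    have hn : 0 < orderOf (ψ (a q)) := orderOf_pos _
    have hk : 0 < orderOf (ψ (t q)) := orderOf_pos _
    refine ⟨orderOf (ψ (a q)), orderOf (ψ (t q)), hn, hk, ?_, ?_⟩
    -- With `k` the order of the image of `t`, the relation `t ^ k a = a ^ (q ^ k) t ^ k` becomes `a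
    -- = a ^ (q ^ k)` in the image.
    · have h1 := congrArg ψ (t_pow_mul_a_zpow q (orderOf (ψ (t q))) 1)
      simp only [map_mul, map_pow, pow_orderOf_eq_one, one_mul, mul_one, zpow_one, map_zpow] at h1
      rw [orderOf_dvd_iff_pow_eq_one]
      have h2 : ψ (a q) ^ (q ^ orderOf (ψ (t q))) = ψ (a q) := by
        rw [← zpow_natCast]; push_cast; exact h1.symm
      have h3 : 1 ≤ q ^ orderOf (ψ (t q)) := Nat.one_le_pow _ _ (NeZero.pos q)
      obtain ⟨c, hc⟩ := Nat.exists_eq_add_of_le h3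
      rw [hc, pow_add, pow_one] at h2
      rw [hc, Nat.add_sub_cancel_left]
      exact mul_eq_left.1 h2
    · intro x x' m m' hx hx' hxx hm
      obtain ⟨g, hg1, hg2⟩ := exists_toPointed hx m
      obtain ⟨g', hg1', hg2'⟩ := exists_toPointed hx' m'
      obtain ⟨z, hz, e⟩ := hxx
      obtain ⟨c, hc⟩ := hm
      obtain ⟨i, N, hN⟩ := exists_mul_pow hz
      have hq : (q : ℚ) ≠ 0 := NeZero.ne _
      -- Congruent elements differ by a conjugate of a power of `a ^ n` on the left and a power of
      -- `t ^ k` on the right, and both have trivial image.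
      have key : g = ((t q ^ i)⁻¹ * a q ^ ((orderOf (ψ (a q)) : ℤ) * N) * t q ^ (i : ℤ)) *
          (g' * t q ^ ((orderOf (ψ (t q)) : ℤ) * c)) := by
        apply (toPointed_bijective q).1
        rw [map_mul]
        have := toPointed_normal_form q i ((orderOf (ψ (a q)) : ℤ) * N) i
        apply PointedNum.ext
        · rw [PointedNum.mul_num, this.1, this.2, map_mul, PointedNum.mul_num,
            (toPointed_t_zpow _).1, hg1, hg1']
          push_cast
          rw [← hN]
          simp only [sub_self, zpow_zero, mul_zero, add_zero, one_mul]
          field_simp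
          linear_combination e
        · rw [PointedNum.mul_pos, this.2, map_mul, PointedNum.mul_pos, (toPointed_t_zpow _).2,
            hg2, hg2']
          linarith
      have hψg : ψ g = ψ g' := by
        rw [key]
        simp only [map_mul, map_inv, map_pow, map_zpow, zpow_mul, zpow_natCast, pow_orderOf_eq_one,
          one_zpow, mul_one, inv_mul_cancel, one_mul]
      have hφg : φ g = φ g' := by rw [← hψ, ← hψ, hψg]
      rw [← hg1, ← hg2, ← hg1', ← hg2', memPred_iff, memPred_iff, hφ]
      simp [hφg]
  · rintro ⟨n, k, hn, hk, h, hs⟩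
    refine ⟨(periodCon n k h).Quotient, inferInstance, finite_periodCon n k h hn hk,
      (periodCon n k h).mk', ?_⟩
    refine Set.Subset.antisymm (Set.subset_preimage_image _ _) ?_
    rintro g ⟨g', hg', e⟩
    have h' := (Con.eq _).1 e
    rw [← memPred_iff] at hg' ⊢
    exact (hs (toPointed q g').num_mem (toPointed q g).num_mem h'.1 h'.2).1 hg'

end BaumslagSolitar

/-! ### Sets that are finite-state with respect to cutting numbers into two halves -/

/-- The fractional parts of the elements of `ℤ[1/q]`. -/
def IsFrac (q : ℕ) (y : ℚ) : Prop := y ∈ ZInv q ∧ 0 ≤ y ∧ y < 1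

/-- The level of a mark: `-lo` if the lower half has the mark, otherwise `uo`. -/
def markLevel (lo uo : ℕ) : ℤ := if lo = 0 then uo else -lo

/-- The predicate `P` for a number `x` whose levels are shifted such that the radix point is at
level `o` and the cursor at level `c`. -/
def Shifted (q : ℕ) (P : ℚ → ℤ → Prop) (x : ℚ) (o c : ℤ) : Prop := P (x * (q : ℚ) ^ (-o)) (c - o)

/-- The sign that a Boolean codes. -/
def sgn (b : Bool) : ℤ := if b then -1 else 1

/-- Two lower halves that no upper half can tell apart. -/
def HalfEquiv (q : ℕ) (P : ℚ → ℤ → Prop) (y : ℚ) (lo lc : ℕ) (y' : ℚ) (lo' lc' : ℕ) : Prop :=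
  (lo = 0 ↔ lo' = 0) ∧ (lc = 0 ↔ lc' = 0) ∧ ∀ (u : ℤ) (s : Bool) (uo uc : ℕ),
    Shifted q P (u + sgn s * y) (markLevel lo uo) (markLevel lc uc) ↔
    Shifted q P (u + sgn s * y') (markLevel lo' uo) (markLevel lc' uc)

/-- There are at most `N` classes of lower halves. -/
def FiniteHalves (q : ℕ) (P : ℚ → ℤ → Prop) (N : ℕ) : Prop :=
  ∃ (T : Type) (_ : Fintype T) (τ : ℚ → ℕ → ℕ → T), Fintype.card T ≤ N ∧
    ∀ y lo lc y' lo' lc', IsFrac q y → IsFrac q y' → τ y lo lc = τ y' lo' lc' →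
      HalfEquiv q P y lo lc y' lo' lc'

theorem FiniteHalves.mono {q N N' : ℕ} {P : ℚ → ℤ → Prop} (h : FiniteHalves q P N) (hN : N ≤ N') :
    FiniteHalves q P N' := by
  obtain ⟨T, i, τ, hc, hτ⟩ := h
  exact ⟨T, i, τ, hc.trans hN, hτ⟩

/-! ### Small periods of finite-state sets -/

section

variable {q : ℕ} [q.AtLeastTwo] {P : ℚ → ℤ → Prop} {n k N : ℕ}

/-- Every set has only small additive periods, if it is finite-state. -/
theorem FiniteHalves.exists_small_shift (h : FiniteHalves q P N) (hs : Saturated q P n k)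
    (hk : 0 < k) (hnk : n ∣ q ^ k - 1) (hn : N < n) :
    ∃ d : ℕ, 0 < d ∧ d < n ∧ ∀ x ∈ ZInv q, ∀ m, P x m ↔ P (x + d) m := by
  have hq2 := PointedNum.two_le q
  have hq : (q : ℚ) ≠ 0 := NeZero.ne _
  have hq0 : (0 : ℚ) < q := by positivity
  obtain ⟨T, _, τ, hc, hτ⟩ := h
  have hlt : n < q ^ (k * n) := by
    calc n < q ^ n := Nat.lt_pow_self (by omega)
      _ ≤ q ^ (k * n) := Nat.pow_le_pow_right (by omega) (Nat.le_mul_of_pos_left _ hk)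
  -- The pigeons are the fractions `j q ^ (-k n)` with `j ≤ N < n`: they are less than `1`, and
  -- congruent to `j` modulo `n` as `q ^ (k n) ≡ 1`.
  have hfrac : ∀ j : Fin (N + 1), IsFrac q ((j : ℕ) * (q : ℚ) ^ ((k : ℤ) * (-n : ℤ))) := by
    intro j
    refine ⟨mul_mem (natCast_mem _ _) (PointedNum.zpow_mem _ _), by positivity, ?_⟩
    have h1 : (q : ℚ) ^ ((k : ℤ) * (-n : ℤ)) = ((q : ℚ) ^ (k * n))⁻¹ := by
      rw [mul_neg, zpow_neg, ← Nat.cast_mul, zpow_natCast]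
    rw [h1, ← div_eq_mul_inv, div_lt_one (by positivity)]
    have : (j : ℕ) < q ^ (k * n) := by omega
    exact_mod_cast this
  obtain ⟨j, j', hne, he⟩ := Fintype.exists_ne_map_eq_of_card_lt
    (fun j : Fin (N + 1) => τ ((j : ℕ) * (q : ℚ) ^ ((k : ℤ) * (-n : ℤ))) 0 0) (by simpa using by omega)
  wlog hjj : j < j' generalizing j j'
  · exact this j' j hne.symm he.symm (lt_of_le_of_ne (not_lt.1 hjj) hne.symm)
  refine ⟨j' - j, by omega, by omega, fun x hx m => ?_⟩
  obtain ⟨U, hU⟩ := exists_int_modEq hnk hk hx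
  -- The upper half `U - j`, where `x ≡ U`, turns the two equivalent fractions into numbers
  -- congruent to `x` and `x + (j' - j)`. The level `k * |m|` of the radix point is a multiple of
  -- `k`, so rescaling does not change residues, and it is large enough for the cursor to have a
  -- level `≥ 0`.
  have h3 := (hτ _ _ _ _ _ _ (hfrac j) (hfrac j') he).2.2 (U - j) false (k * m.natAbs)
    (m + (k * m.natAbs : ℕ)).toNat
  have hm : 0 ≤ m + (k * m.natAbs : ℕ) := by
    have : m.natAbs ≤ k * m.natAbs := Nat.le_mul_of_pos_left _ hk
    omega
  have hm' : ((m + (k * m.natAbs : ℕ)).toNat : ℤ) - (k * m.natAbs : ℕ) = m := by omega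
  simp only [Shifted, markLevel, if_true, sgn, Bool.false_eq_true, if_false, hm'] at h3
  have hz1 := modEq_zpow_one hnk (-n : ℤ)
  have hz2 : ModEq q n ((q : ℚ) ^ (-((k * m.natAbs : ℕ) : ℤ))) 1 := by
    have := modEq_zpow_one hnk (-(m.natAbs : ℤ))
    convert this using 2
    push_cast
    ring
  have hcong : ∀ i : ℕ, ModEq q n
      (((U - (j : ℕ) : ℤ) + ((1 : ℤ) : ℚ) * (i * (q : ℚ) ^ ((k : ℤ) * (-n : ℤ)))) *
        (q : ℚ) ^ (-((k * m.natAbs : ℕ) : ℤ))) (U - (j : ℕ) + i) := by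
    intro i
    have h1 := (ModEq.refl ((U : ℚ) - (j : ℕ))).add ((ModEq.refl (i : ℚ)).mul hz1
      (natCast_mem _ _) (PointedNum.zpow_mem _ _))
    have h2 := h1.mul hz2 (add_mem (sub_mem (intCast_mem _ _) (natCast_mem _ _))
      (mul_mem (natCast_mem _ _) (one_mem _))) (PointedNum.zpow_mem _ _)
    simpa using h2
  have hmem : ∀ i : ℕ,
      (((U - (j : ℕ) : ℤ) + ((1 : ℤ) : ℚ) * (i * (q : ℚ) ^ ((k : ℤ) * (-n : ℤ)))) *
        (q : ℚ) ^ (-((k * m.natAbs : ℕ) : ℤ))) ∈ ZInv q := fun i =>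
    mul_mem (add_mem (intCast_mem _ _) (mul_mem (intCast_mem _ _)
      (mul_mem (natCast_mem _ _) (PointedNum.zpow_mem _ _)))) (PointedNum.zpow_mem _ _)
  have e1 : P x m ↔ _ := hs hx (hmem j) (hU.trans (by simpa using (hcong j).symm)) (m' := m) (by simp)
  have hd : ((↑(j' - j) : ℕ) : ℚ) = ((j' : ℕ) : ℚ) - (j : ℕ) := by
    rw [Fin.sub_val_of_le hjj.le, Nat.cast_sub hjj.le]
  have e2 : P (x + (↑(j' - j) : ℕ)) m ↔ _ :=
    hs (add_mem hx (natCast_mem _ _)) (hmem j') (by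
      have := (hU.add (ModEq.refl ((↑(j' - j) : ℕ) : ℚ))).trans
        (by rw [hd, show (U : ℚ) + ((j' : ℕ) - (j : ℕ)) = U - (j : ℕ) + (j' : ℕ) by ring]
            exact (hcong j').symm)
      exact this) (m' := m) (by simp)
  rw [e1, h3]
  convert e2.symm using 3
  rw [Fin.sub_val_of_le hjj.le]

/-- Every element of `ℤ[1/q]` is an integer modulo `n`, so Bézout's identity combines the period `n
ℤ[1/q]` with the integer shifts by `d` into `gcd(n, d) ℤ[1/q]`. -/
theorem Saturated.gcd_of_shift (hs : Saturated q P n k) (hk : 0 < k) (hnk : n ∣ q ^ k - 1) {d : ℕ}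
    (hd : ∀ x ∈ ZInv q, ∀ m, P x m ↔ P (x + d) m) : Saturated q P (Nat.gcd n d) k := by
  have hd' : ∀ (i : ℤ), ∀ x ∈ ZInv q, ∀ m, P x m ↔ P (x + d * i) m := by
    have hN : ∀ (i : ℕ), ∀ x ∈ ZInv q, ∀ m, P x m ↔ P (x + d * i) m := by
      intro i x hx m
      induction i with
      | zero => simp
      | succ i ih =>
        rw [ih, hd _ (add_mem hx (mul_mem (natCast_mem _ _) (natCast_mem _ _)))]
        push_cast
        rw [mul_add, mul_one, add_assoc]
    intro i x hx m
    obtain ⟨i, rfl | rfl⟩ := Int.eq_nat_or_neg i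
    · exact_mod_cast hN i x hx m
    · rw [hN i (x + d * (-i : ℤ)) (add_mem hx (mul_mem (natCast_mem _ _) (intCast_mem _ _)))]
      push_cast
      rw [add_assoc, ← mul_add, neg_add_cancel, mul_zero, add_zero]
  rintro x x' m m' hx hx' ⟨z, hz, e⟩ hm
  obtain ⟨Z, z', hz', e'⟩ := exists_int_modEq hnk hk hz
  have hg : ((Nat.gcd n d : ℕ) : ℚ) = n * (n.gcdA d : ℤ) + d * (n.gcdB d : ℤ) := by
    have := Nat.gcd_eq_gcd_ab n d
    exact_mod_cast this
  rw [hd' (n.gcdB d * Z) x' hx' m']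
  refine hs hx (add_mem hx' (mul_mem (natCast_mem _ _) (intCast_mem _ _)))
    ⟨(n.gcdA d : ℤ) * Z + (Nat.gcd n d : ℕ) * z', add_mem (mul_mem (intCast_mem _ _)
      (intCast_mem _ _)) (mul_mem (natCast_mem _ _) hz'), ?_⟩ hm
  push_cast
  rw [hg] at e ⊢
  linear_combination e + ((n : ℚ) * (n.gcdA d : ℤ) + d * (n.gcdB d : ℤ)) * e'

/-- Pigeonhole on the depth of the cursor below the fraction `0`: two equivalent depths give a
cursor shift that preserves `P`. Only depths that differ by multiples of `e` compete, so that the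
new period inherits `n ∣ q ^ k' - 1` from `e`. -/
theorem FiniteHalves.exists_small_turn (h : FiniteHalves q P N) (hs : Saturated q P n k)
    (hk : 0 < k) {e : ℕ} (he : 0 < e) (hne : n ∣ q ^ e - 1) :
    ∃ k', 0 < k' ∧ k' ≤ e * N ∧ n ∣ q ^ k' - 1 ∧ Saturated q P n k' := by
  have hq : (q : ℚ) ≠ 0 := NeZero.ne _
  obtain ⟨T, _, τ, hc, hτ⟩ := h
  have hfrac : IsFrac q 0 := ⟨zero_mem _, le_rfl, by norm_num⟩
  -- The `+ 1` puts the cursor into the lower half even for `j = 0`.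
  obtain ⟨j, j', hjne, hj⟩ := Fintype.exists_ne_map_eq_of_card_lt
    (fun j : Fin (N + 1) => τ 0 0 (e * j + 1)) (by simpa using by omega)
  wlog hjj : j < j' generalizing j j'
  · exact this j' j hjne.symm hj.symm (lt_of_le_of_ne (not_lt.1 hjj) hjne.symm)
  obtain ⟨i, hi⟩ := Nat.exists_eq_add_of_lt (show (j : ℕ) < j' from hjj)
  have hrel := (hτ _ _ _ _ _ _ hfrac hfrac hj).2.2
  have hshift : ∀ x ∈ ZInv q, ∀ m : ℤ, P x m ↔ P x (m - (e * (i + 1) : ℕ)) := by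
    intro x hx m
    obtain ⟨l, U, hU⟩ := exists_mul_pow hx
    -- The radix point is raised by `r` further levels, until the cursor position `-(e * j + 1) - (l
    -- + r)` is congruent to `m` modulo the old period `k`.
    obtain ⟨r, hr⟩ : ∃ r : ℕ, (k : ℤ) ∣ m + (e * j + 1 : ℕ) + (l + r : ℕ) := by
      refine ⟨((-(m + (e * j + 1 : ℕ) + l)) % k).toNat, ?_⟩
      push_cast
      rw [Int.toNat_of_nonneg (Int.emod_nonneg _ (by omega)), Int.emod_def]
      exact ⟨-(-(m + (e * j + 1) + l) / k), by ring⟩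
    have h3 := hrel (U * (q : ℤ) ^ r) false (l + r) 0
    have hx' : ((U * (q : ℤ) ^ r : ℤ) + ((1 : ℤ) : ℚ) * 0) * (q : ℚ) ^ (-((l + r : ℕ) : ℤ)) = x := by
      push_cast
      rw [← hU, zpow_neg, ← Nat.cast_add, zpow_natCast, pow_add]
      field_simp
      simp
    simp only [Shifted, markLevel, if_true, sgn, Bool.false_eq_true, if_false, hx',
      Nat.add_eq_zero_iff, one_ne_zero, and_false] at h3
    have e1 : P x m ↔ P x (-((e * j + 1 : ℕ) : ℤ) - (l + r : ℕ)) := hs hx hx (ModEq.refl _)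
      (by convert hr using 1; ring)
    have e2 : P x (m - (e * (i + 1) : ℕ)) ↔ P x (-((e * j' + 1 : ℕ) : ℤ) - (l + r : ℕ)) :=
      hs hx hx (ModEq.refl _) (by convert hr using 1; rw [hi]; push_cast; ring)
    rw [e1, e2]
    exact h3
  have hturn : ∀ (c : ℤ), ∀ x ∈ ZInv q, ∀ m : ℤ, P x m ↔ P x (m + (e * (i + 1) : ℕ) * c) := by
    have hN : ∀ (c : ℕ), ∀ x ∈ ZInv q, ∀ m : ℤ, P x m ↔ P x (m - (e * (i + 1) : ℕ) * c) := by
      intro c x hx m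
      induction c with
      | zero => simp
      | succ c ih =>
        rw [ih, hshift x hx]
        push_cast
        rw [show ∀ a b : ℤ, m - a * b - a = m - a * (b + 1) by intros; ring]
    intro c x hx m
    obtain ⟨c, rfl | rfl⟩ := Int.eq_nat_or_neg c
    · rw [hN c x hx (m + _ * _)]
      simp
    · rw [hN c x hx m]
      simp [sub_eq_add_neg]
  refine ⟨e * (i + 1), by positivity, Nat.mul_le_mul_left _ (by omega), ?_, ?_⟩
  · refine hne.trans ?_
    rw [pow_mul]
    simpa using Nat.sub_dvd_pow_sub_pow (q ^ e) 1 (i + 1)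
  · rintro x x' m m' hx hx' hxx ⟨c, hc'⟩
    rw [hturn c x' hx' m', ← hc']
    exact hs hx hx' hxx (by simp)

/-- The periods of a finite-state set can be chosen small. -/
theorem FiniteHalves.exists_small_periods (h : FiniteHalves q P N)
    (hs : ∃ n k : ℕ, 0 < n ∧ 0 < k ∧ n ∣ q ^ k - 1 ∧ Saturated q P n k) :
    ∃ n ≤ N, ∃ k ≤ N * N, 0 < n ∧ 0 < k ∧ n ∣ q ^ k - 1 ∧ Saturated q P n k := by
  classical
  have hn0 := Nat.find_spec hs
  -- For the least possible `n`, a shift `d < n` would give the smaller period `gcd(n, d)`; hence `n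
  -- ≤ N`.
  set n := Nat.find hs
  obtain ⟨k, hn, hk, hnk, hsat⟩ := hn0
  have hnN : n ≤ N := by
    by_contra! hlt
    obtain ⟨d, hd0, hdn, hd⟩ := h.exists_small_shift hsat hk hnk hlt
    have h1 : Nat.gcd n d ≤ d := Nat.gcd_le_right _ hd0
    exact Nat.find_min hs (show Nat.gcd n d < n by omega)
      ⟨k, Nat.gcd_pos_of_pos_left _ hn, hk, (Nat.gcd_dvd_left n d).trans hnk,
        hsat.gcd_of_shift hk hnk hd⟩
  have hcop : Nat.Coprime q n := by
    have hk1 : 1 ≤ q ^ k := Nat.one_le_pow _ _ (NeZero.pos q)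
    have h1 : Nat.Coprime (q ^ k - 1) (q ^ k) := by
      rw [Nat.coprime_self_sub_left hk1]
      exact Nat.coprime_one_left _
    exact (Nat.Coprime.coprime_dvd_right hnk
      (h1.symm.coprime_dvd_left (dvd_pow_self q hk.ne')))
  -- Euler's exponent is at most `n ≤ N` and does not depend on the old cursor period, whence the
  -- bound `N * N`.
  have htot : n ∣ q ^ n.totient - 1 :=
    (Nat.modEq_iff_dvd' (Nat.one_le_pow _ _ (NeZero.pos q))).1 (Nat.ModEq.pow_totient hcop).symm
  obtain ⟨k', hk0, hkN, h1, h2⟩ := h.exists_small_turn hsat hk (Nat.totient_pos.2 hn) htot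
  refine ⟨n, hnN, k', hkN.trans (Nat.mul_le_mul_right _ ((Nat.totient_le n).trans hnN)), hn, hk0,
    h1, h2⟩

/-- The congruence classes are finite-state. -/
theorem finiteHalves_class (hn : 0 < n) (hk : 0 < k) (hnk : n ∣ q ^ k - 1) {x₀ : ℚ}
    (m₀ : ℤ) : FiniteHalves q (fun x m => ModEq q n x x₀ ∧ (k : ℤ) ∣ m - m₀) (4 * n * k * k) := by
  classical
  have : NeZero n := ⟨hn.ne'⟩
  have : NeZero k := ⟨hk.ne'⟩
  have hρ : ∀ y : ℚ, ∃ j : Fin n, y ∈ ZInv q → ModEq q n y (j : ℕ) := by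
    intro y
    by_cases hy : y ∈ ZInv q
    · obtain ⟨j, hj⟩ := exists_fin_modEq hnk hk hn hy
      exact ⟨j, fun _ => hj⟩
    · exact ⟨0, fun h => absurd h hy⟩
  choose ρ hρ using hρ
  -- The residue of the fraction, the residues of both depths, and which marks are in the lower half
  -- determine the class of any completion.
  refine ⟨Fin n × ZMod k × ZMod k × Bool × Bool, inferInstance,
    fun y lo lc => (ρ y, lo, lc, decide (lo = 0), decide (lc = 0)), ?_, ?_⟩
  · simp [Fintype.card_prod, ZMod.card]
    apply le_of_eq; ring
  · intro y lo lc y' lo' lc' hy hy' h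
    simp only [Prod.mk.injEq, decide_eq_decide] at h
    obtain ⟨h1, h2, h3, h4, h5⟩ := h
    refine ⟨h4, h5, fun u s uo uc => ?_⟩
    have hlev : ∀ (a a' b : ℕ), (a : ZMod k) = a' → (a = 0 ↔ a' = 0) →
        (k : ℤ) ∣ markLevel a b - markLevel a' b := by
      intro a a' b e1 e2
      unfold markLevel
      by_cases h0 : a = 0
      · simp [h0, e2.1 h0]
      · rw [if_neg h0, if_neg (fun h => h0 (e2.2 h)), show -(a : ℤ) - -a' = a' - a by ring]
        rw [← ZMod.intCast_eq_intCast_iff_dvd_sub]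
        exact_mod_cast e1
    have ho := hlev lo lo' uo h2 h4
    have hc := hlev lc lc' uc h3 h5
    have hyy : ModEq q n y y' := (hρ y hy.1).trans (by rw [h1]; exact (hρ y' hy'.1).symm)
    have hx : ModEq q n ((u + sgn s * y) * (q : ℚ) ^ (-markLevel lo uo))
        ((u + sgn s * y') * (q : ℚ) ^ (-markLevel lo' uo)) :=
      ((ModEq.refl (u : ℚ)).add ((ModEq.refl (sgn s : ℚ)).mul hyy (intCast_mem _ _) hy.1)).mul
        (modEq_zpow hnk (by rw [neg_sub_neg, ← neg_sub]; exact ho.neg_right))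
        (add_mem (intCast_mem _ _) (mul_mem (intCast_mem _ _) hy'.1)) (PointedNum.zpow_mem _ _)
    have hm := dvd_sub hc ho
    unfold Shifted
    constructor
    · rintro ⟨a1, a2⟩
      refine ⟨hx.symm.trans a1, ?_⟩
      have := dvd_sub a2 hm
      rwa [show ∀ c o c' o' : ℤ, c - o - m₀ - (c - c' - (o - o')) = c' - o' - m₀ by intros; ring]
        at this
    · rintro ⟨a1, a2⟩
      refine ⟨hx.trans a1, ?_⟩
      have := dvd_add a2 hm
      rwa [show ∀ c o c' o' : ℤ, c' - o' - m₀ + (c - c' - (o - o')) = c - o - m₀ by intros; ring]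
        at this

end

open ZInv

/-! ### Words of marked digits -/

/-- A digit with two marks: the radix point and the cursor. -/
abbrev PEDigit (q : ℕ) : Type := Fin q × Bool × Bool

namespace PEWord

variable {q : ℕ}

/-- The natural number whose base-`q` digits are the letters of a word. -/
def toNat : List (PEDigit q) → ℕ
  | [] => 0
  | d :: w => d.1 * q ^ w.length + toNat w

/-- The depth of the last letter with a mark, counted from `1`, and `0` if there is none. -/
def depth (f : PEDigit q → Bool) : List (PEDigit q) → ℕ
  | [] => 0
  | d :: w => if depth f w ≠ 0 then depth f w + 1 else if f d then 1 else 0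

/-- Whether a digit carries the radix point. -/
def radix (d : PEDigit q) : Bool := d.2.1

/-- Whether a digit carries the cursor. -/
def cursor (d : PEDigit q) : Bool := d.2.2

/-- The number `0.d₁d₂…` in base `q`. -/
def frac (w : List (PEDigit q)) : ℚ := toNat w / (q : ℚ) ^ w.length

/-- There is one radix point and one cursor. -/
def Marked (w : List (PEDigit q)) : Prop := w.countP radix = 1 ∧ w.countP cursor = 1

/-- The number of a word with a sign. -/
def num (s : Bool) (w : List (PEDigit q)) : ℚ := sgn s * frac w * (q : ℚ) ^ depth radix w

/-- The cursor position of a word. -/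
def pos (w : List (PEDigit q)) : ℤ := depth radix w - depth cursor w

theorem toNat_append (u v : List (PEDigit q)) :
    toNat (u ++ v) = toNat u * q ^ v.length + toNat v := by
  induction u with
  | nil => simp [toNat]
  | cons d u ih => simp [toNat, ih, pow_add]; ring

theorem depth_append (f : PEDigit q → Bool) (u v : List (PEDigit q)) :
    depth f (u ++ v) = if depth f v ≠ 0 then depth f v + u.length else depth f u := by
  induction u with
  | nil => simp [depth]
  | cons d u ih =>
    rw [List.cons_append, depth, ih, depth, List.length_cons]
    split_ifs <;> omega

theorem depth_le (f : PEDigit q → Bool) (w : List (PEDigit q)) : depth f w ≤ w.length := by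
  induction w with
  | nil => simp [depth]
  | cons d w ih => rw [depth, List.length_cons]; split_ifs <;> omega

theorem depth_eq_zero_iff (f : PEDigit q → Bool) (w : List (PEDigit q)) :
    depth f w = 0 ↔ w.countP f = 0 := by
  induction w with
  | nil => simp [depth]
  | cons d w ih =>
    rw [depth, List.countP_cons]
    split_ifs <;> simp_all

theorem toNat_lt [NeZero q] (w : List (PEDigit q)) : toNat w < q ^ w.length := by
  induction w with
  | nil => simp [toNat]
  | cons d w ih =>
    rw [toNat, List.length_cons, pow_succ]
    have := d.1.2
    calc (d.1 : ℕ) * q ^ w.length + toNat w < d.1 * q ^ w.length + q ^ w.length := by omega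
      _ = (d.1 + 1) * q ^ w.length := by ring
      _ ≤ q * q ^ w.length := Nat.mul_le_mul_right _ (by omega)
      _ = q ^ w.length * q := by ring

theorem isFrac_frac [NeZero q] (w : List (PEDigit q)) : IsFrac q (frac w) := by
  have hq : (0 : ℚ) < q := by have := NeZero.pos q; positivity
  refine ⟨?_, by unfold frac; positivity, ?_⟩
  · have h : ((q : ℚ) ^ w.length)⁻¹ ∈ ZInv q := by
      simpa using PointedNum.zpow_mem q (-(w.length : ℤ))
    unfold frac
    rw [div_eq_mul_inv]
    exact mul_mem (natCast_mem _ _) h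
  · unfold frac
    rw [div_lt_one (by positivity)]
    exact_mod_cast toNat_lt w

theorem frac_append [NeZero q] (u v : List (PEDigit q)) :
    frac (u ++ v) = (toNat u + frac v) / (q : ℚ) ^ u.length := by
  have hq : (q : ℚ) ≠ 0 := NeZero.ne _
  unfold frac
  rw [toNat_append, List.length_append, pow_add]
  push_cast
  field_simp

theorem Shifted.scale [NeZero q] (P : ℚ → ℤ → Prop) (x : ℚ) (o c : ℤ) (l : ℕ) :
    Shifted q P (x / (q : ℚ) ^ l) (o - l) (c - l) ↔ Shifted q P x o c := by
  have hq : (q : ℚ) ≠ 0 := NeZero.ne _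
  unfold Shifted
  have h1 : x / (q : ℚ) ^ l * (q : ℚ) ^ (-(o - l)) = x * (q : ℚ) ^ (-o) := by
    rw [neg_sub, sub_eq_add_neg, zpow_add₀ hq, zpow_natCast]
    field_simp
  rw [h1, sub_sub_sub_cancel_right]

theorem num_pos_iff_shifted [NeZero q] (P : ℚ → ℤ → Prop) (s : Bool) (w : List (PEDigit q)) :
    P (num s w) (pos w) ↔
      Shifted q P (sgn s * frac w) (-(depth radix w : ℤ)) (-(depth cursor w : ℤ)) := by
  unfold num pos Shifted
  rw [neg_neg, zpow_natCast, show -(depth cursor w : ℤ) - -(depth radix w : ℤ) =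
    depth radix w - depth cursor w by ring]

/-- Membership of the number of a word, in terms of a prefix and a suffix. -/
theorem append_iff [NeZero q] (P : ℚ → ℤ → Prop) (s : Bool) (u v : List (PEDigit q)) :
    P (num s (u ++ v)) (pos (u ++ v)) ↔
      Shifted q P (sgn s * (toNat u + frac v))
        (markLevel (depth radix v) (u.length - depth radix u))
        (markLevel (depth cursor v) (u.length - depth cursor u)) := by
  have hlev : ∀ f : PEDigit q → Bool,
      -(depth f (u ++ v) : ℤ) = markLevel (depth f v) (u.length - depth f u) - u.length := by
    intro f
    have := depth_le f u
    rw [depth_append, markLevel]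
    split_ifs <;> push_cast <;> omega
  rw [num_pos_iff_shifted P s, hlev, hlev, frac_append, ← mul_div_assoc, Shifted.scale]

/-- The word of length `l` with the digits of `N`, with the marks at the places `L` and `c`, counted
from the end of the word. -/
def ofNat (q : ℕ) [NeZero q] (N L c l : ℕ) : List (PEDigit q) :=
  (List.range l).map fun j =>
    (Fin.ofNat q (N / q ^ (l - 1 - j)), decide (l - 1 - j = L), decide (l - 1 - j = c))

section ofNat

variable [NeZero q] (N L c l : ℕ)

theorem ofNat_zero : ofNat q N L c 0 = [] := rfl

theorem ofNat_succ : ofNat q N L c (l + 1) =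
    (Fin.ofNat q (N / q ^ l), decide (l = L), decide (l = c)) :: ofNat q N L c l := by
  unfold ofNat
  rw [List.range_succ_eq_map, List.map_cons, List.map_map]
  congr 1
  apply List.map_congr_left
  intro j _
  simp only [Function.comp, Nat.succ_eq_add_one, show l + 1 - 1 - (j + 1) = l - 1 - j by omega]

@[simp] theorem length_ofNat : (ofNat q N L c l).length = l := by simp [ofNat]

theorem toNat_ofNat : toNat (ofNat q N L c l) = N % q ^ l := by
  induction l with
  | zero => simp [ofNat_zero, toNat, Nat.mod_one]
  | succ l ih =>
    rw [ofNat_succ, toNat, ih, length_ofNat, Fin.val_ofNat, pow_succ, Nat.mod_mul]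
    ring

theorem depth_ofNat (f : PEDigit q → Bool) (M : ℕ)
    (hf : ∀ d l', f (d, decide (l' = L), decide (l' = c)) = decide (l' = M)) :
    depth f (ofNat q N L c l) = l - M ∧
      (ofNat q N L c l).countP f = if M < l then 1 else 0 := by
  induction l with
  | zero => simp [ofNat_zero, depth]
  | succ l ih =>
    obtain ⟨h1, h2⟩ := ih
    rw [ofNat_succ, depth, List.countP_cons, h1, h2, hf]
    constructor
    · split_ifs <;> simp_all <;> omega
    · by_cases h : l = M
      · simp [h]
      · simp only [h, decide_false, Bool.false_eq_true, if_false, add_zero]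
        congr 1
        simp only [eq_iff_iff]
        omega

theorem depth_radix_ofNat : depth radix (ofNat q N L c l) = l - L :=
  (depth_ofNat N L c l radix L fun _ _ => rfl).1

theorem depth_cursor_ofNat : depth cursor (ofNat q N L c l) = l - c :=
  (depth_ofNat N L c l cursor c fun _ _ => rfl).1

theorem countP_radix_ofNat : (ofNat q N L c l).countP radix = if L < l then 1 else 0 :=
  (depth_ofNat N L c l radix L fun _ _ => rfl).2

theorem countP_cursor_ofNat : (ofNat q N L c l).countP cursor = if c < l then 1 else 0 :=
  (depth_ofNat N L c l cursor c fun _ _ => rfl).2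

theorem marked_ofNat (hL : L < l) (hc : c < l) : Marked (ofNat q N L c l) := by
  unfold Marked
  rw [countP_radix_ofNat, countP_cursor_ofNat, if_pos hL, if_pos hc]
  simp

theorem num_ofNat (s : Bool) (hL : L < l) (hN : N < q ^ l) :
    num s (ofNat q N L c l) = sgn s * (N / (q : ℚ) ^ L) := by
  have hq : (q : ℚ) ≠ 0 := NeZero.ne _
  unfold num frac
  rw [toNat_ofNat, depth_radix_ofNat, length_ofNat, Nat.mod_eq_of_lt hN]
  obtain ⟨i, rfl⟩ := Nat.exists_eq_add_of_lt hL
  rw [show L + i + 1 - L = i + 1 by omega, show L + i + 1 = L + (i + 1) by ring, pow_add]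
  field_simp

theorem pos_ofNat (hL : L < l) (hc : c < l) : pos (ofNat q N L c l) = c - L := by
  unfold pos
  rw [depth_radix_ofNat, depth_cursor_ofNat]
  omega

end ofNat

/-- Every lower half is the value of a word. -/
theorem exists_lower [NeZero q] (hq2 : 2 ≤ q) {y : ℚ} (hy : IsFrac q y) (lo lc : ℕ) :
    ∃ v : List (PEDigit q), frac v = y ∧ depth radix v = lo ∧ depth cursor v = lc ∧
      v.countP radix = (if lo = 0 then 0 else 1) ∧ v.countP cursor = if lc = 0 then 0 else 1 := by
  have hq : (0 : ℚ) < q := by have := NeZero.pos q; positivity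
  obtain ⟨i, n, h⟩ := ZInv.exists_mul_pow hy.1
  have hn : 0 ≤ n := by
    have : (0 : ℚ) ≤ n := by rw [← h]; have := hy.2.1; positivity
    exact_mod_cast this
  obtain ⟨N, rfl⟩ := Int.eq_ofNat_of_zero_le hn
  have hN : N < q ^ i := by
    have : (N : ℚ) < (q : ℚ) ^ i := by
      have h' : (N : ℚ) = y * (q : ℚ) ^ i := by rw [h]; rfl
      rw [h']
      have := hy.2.2
      have hp : (0 : ℚ) < (q : ℚ) ^ i := by positivity
      nlinarith
    exact_mod_cast this
  -- Trailing zeros make the depths `lo` and `lc` available. Depth `lo` is place `l - lo`; for `lo =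
  -- 0` this is place `l`, outside the word, so that there is no mark. The same holds for `lc`.
  set l := i + lo + lc with hl
  have hN' : N * q ^ (lo + lc) < q ^ l := by
    rw [hl, add_assoc i lo lc, pow_add q i (lo + lc)]
    exact Nat.mul_lt_mul_of_pos_right hN (by positivity)
  refine ⟨ofNat q (N * q ^ (lo + lc)) (l - lo) (l - lc) l, ?_, ?_, ?_, ?_, ?_⟩
  · unfold frac
    rw [toNat_ofNat, length_ofNat, Nat.mod_eq_of_lt hN', hl, add_assoc i lo lc,
      pow_add (q : ℚ) i (lo + lc)]
    push_cast at h ⊢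
    rw [← h]
    field_simp
  · rw [depth_radix_ofNat]; omega
  · rw [depth_cursor_ofNat]; omega
  · rw [countP_radix_ofNat]; split_ifs <;> omega
  · rw [countP_cursor_ofNat]; split_ifs <;> omega

theorem exists_upper [NeZero q] (hq2 : 2 ≤ q) (U uo uc : ℕ) (fo fc : Bool) :
    ∃ u : List (PEDigit q), toNat u = U ∧ (fo → u.length - depth radix u = uo) ∧
      (fc → u.length - depth cursor u = uc) ∧ u.countP radix = (if fo then 1 else 0) ∧
      u.countP cursor = if fc then 1 else 0 := by
  set l := U + uo + uc + 1 with hl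
  have hU : U < q ^ l := lt_of_lt_of_le (Nat.lt_pow_self (by omega))
    (Nat.pow_le_pow_right (by omega) (show U ≤ l by omega))
  -- A mark that must be absent is sent to place `l`, which is outside the word.
  refine ⟨ofNat q U (if fo then uo else l) (if fc then uc else l) l, ?_, ?_, ?_, ?_, ?_⟩
  · rw [toNat_ofNat, Nat.mod_eq_of_lt hU]
  · intro h; rw [depth_radix_ofNat, length_ofNat, if_pos h]; omega
  · intro h; rw [depth_cursor_ofNat, length_ofNat, if_pos h]; omega
  · rw [countP_radix_ofNat]; split_ifs <;> omega
  · rw [countP_cursor_ofNat]; split_ifs <;> omega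

end PEWord

/-! ### Classes of suffixes and classes of lower halves -/

open PEWord

/-- Two suffixes that no prefix can tell apart. -/
def WordEquiv (q : ℕ) (P : ℚ → ℤ → Prop) (v w : List (PEDigit q)) : Prop :=
  ∀ u s, (Marked (u ++ v) ↔ Marked (u ++ w)) ∧ (Marked (u ++ v) →
    (P (num s (u ++ v)) (pos (u ++ v)) ↔ P (num s (u ++ w)) (pos (u ++ w))))

/-- There are at most `N` classes of suffixes. -/
def FiniteSuffixes (q : ℕ) (P : ℚ → ℤ → Prop) (N : ℕ) : Prop :=
  ∃ (T : Type) (_ : Fintype T) (τ : List (PEDigit q) → T), Fintype.card T ≤ N ∧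
    ∀ v w, τ v = τ w → WordEquiv q P v w

/-- Cut off at `2`. -/
def capTwo (n : ℕ) : Fin 3 := if n = 0 then 0 else if n = 1 then 1 else 2

theorem capTwo_add {m n n' : ℕ} (h : capTwo n = capTwo n') : m + n = 1 ↔ m + n' = 1 := by
  unfold capTwo at h
  split_ifs at h <;> omega

theorem marked_append_iff {q : ℕ} {u v v' : List (PEDigit q)}
    (h1 : capTwo (v.countP radix) = capTwo (v'.countP radix))
    (h2 : capTwo (v.countP cursor) = capTwo (v'.countP cursor)) :
    Marked (u ++ v) ↔ Marked (u ++ v') := by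
  unfold Marked
  rw [List.countP_append, List.countP_append, List.countP_append, List.countP_append,
    capTwo_add h1, capTwo_add h2]

/-- The type of the half determines the values of completions; the numbers of both marks, cut off at
`2`, determine which completions are well marked and account for the factor `9`. -/
theorem FiniteHalves.finiteSuffixes {q : ℕ} [NeZero q] {P : ℚ → ℤ → Prop} {N : ℕ}
    (h : FiniteHalves q P N) : FiniteSuffixes q P (9 * N) := by
  obtain ⟨T, _, τ, hc, hτ⟩ := h
  refine ⟨T × Fin 3 × Fin 3, inferInstance, fun v => (τ (frac v) (depth radix v) (depth cursor v),
    capTwo (v.countP radix), capTwo (v.countP cursor)), ?_, ?_⟩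
  · simp only [Fintype.card_prod, Fintype.card_fin]; omega
  · intro v v' h u s
    simp only [Prod.mk.injEq] at h
    have hm := marked_append_iff (u := u) h.2.1 h.2.2
    refine ⟨hm, fun _ => ?_⟩
    rw [append_iff P s u v, append_iff P s u v']
    have := (hτ _ _ _ _ _ _ (isFrac_frac v) (isFrac_frac v') h.1).2.2 (sgn s * toNat u) s
      (u.length - depth radix u) (u.length - depth cursor u)
    push_cast at this
    rwa [← mul_add, ← mul_add] at this

/-- In a half the signs of the integer and of the fraction are independent, whereas a word has one
sign for all its digits. If they disagree, borrowing `1` from the integer replaces `y` by `1 - y`.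
The sign, the integer and the decision to borrow depend only on `u` and `s`, so they are the same
for two fractions under comparison. -/
theorem exists_sign_form (u : ℤ) (s : Bool) : ∃ (s' : Bool) (U : ℕ) (b : Bool), ∀ y : ℚ,
    y ≠ 0 → (u : ℚ) + sgn s * y = sgn s' * (U + if b then 1 - y else y) := by
  cases s <;> rcases lt_or_ge u 0 with h | h
  · refine ⟨true, (-u - 1).toNat, true, fun y _ => ?_⟩
    have : (((-u - 1).toNat : ℤ) : ℚ) = ((-u - 1 : ℤ) : ℚ) := by rw [Int.toNat_of_nonneg (by omega)]
    push_cast at this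
    simp only [sgn, Bool.false_eq_true, if_true, if_false, this]
    push_cast
    ring
  · refine ⟨false, u.toNat, false, fun y _ => ?_⟩
    have : ((u.toNat : ℤ) : ℚ) = (u : ℚ) := by rw [Int.toNat_of_nonneg h]
    push_cast at this
    simp only [sgn, Bool.false_eq_true, if_false, this]
    push_cast
    ring
  · refine ⟨true, (-u).toNat, false, fun y _ => ?_⟩
    have : (((-u).toNat : ℤ) : ℚ) = ((-u : ℤ) : ℚ) := by rw [Int.toNat_of_nonneg (by omega)]
    push_cast at this
    simp only [sgn, Bool.false_eq_true, if_true, if_false, this]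
    push_cast
    ring
  · rcases h.eq_or_lt with rfl | h
    · exact ⟨true, 0, false, fun y _ => by simp [sgn]⟩
    · refine ⟨false, (u - 1).toNat, true, fun y _ => ?_⟩
      have : (((u - 1).toNat : ℤ) : ℚ) = ((u - 1 : ℤ) : ℚ) := by rw [Int.toNat_of_nonneg (by omega)]
      push_cast at this
      simp only [sgn, Bool.false_eq_true, if_true, if_false, this]
      push_cast
      ring

theorem IsFrac.one_sub {q : ℕ} {y : ℚ} (hy : IsFrac q y) (h : y ≠ 0) : IsFrac q (1 - y) :=
  ⟨sub_mem (one_mem _) hy.1, by linarith [hy.2.2],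
    by have := lt_of_le_of_ne hy.2.1 h.symm; linarith⟩

/-- Because of `exists_sign_form`, the type of a half records the suffix classes of words for both
`y` and `1 - y`. The case `y = 0` is kept apart, since `1 - 0` is not a fractional part. -/
theorem FiniteSuffixes.finiteHalves {q : ℕ} [NeZero q] (hq2 : 2 ≤ q) {P : ℚ → ℤ → Prop} {N : ℕ}
    (h : FiniteSuffixes q P N) : FiniteHalves q P (8 * (N * N)) := by
  classical
  obtain ⟨T, _, τ, hc, hτ⟩ := h
  have hlow : ∀ (y : ℚ) (lo lc : ℕ), ∃ v : List (PEDigit q), IsFrac q y → frac v = y ∧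
      depth radix v = lo ∧ depth cursor v = lc ∧
      v.countP radix = (if lo = 0 then 0 else 1) ∧ v.countP cursor = if lc = 0 then 0 else 1 := by
    intro y lo lc
    by_cases hy : IsFrac q y
    · obtain ⟨v, hv⟩ := exists_lower hq2 hy lo lc
      exact ⟨v, fun _ => hv⟩
    · exact ⟨[], fun h => absurd h hy⟩
  choose wd hwd using hlow
  have key : ∀ (s : Bool) (U uo uc : ℕ) (y : ℚ) (lo lc : ℕ) (y' : ℚ) (lo' lc' : ℕ),
      IsFrac q y → IsFrac q y' → (lo = 0 ↔ lo' = 0) → (lc = 0 ↔ lc' = 0) →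
      τ (wd y lo lc) = τ (wd y' lo' lc') →
      (Shifted q P (sgn s * (U + y)) (markLevel lo uo) (markLevel lc uc) ↔
       Shifted q P (sgn s * (U + y')) (markLevel lo' uo) (markLevel lc' uc)) := by
    intro s U uo uc y lo lc y' lo' lc' hy hy' ho hc' ht
    obtain ⟨u, hu1, hu2, hu3, hu4, hu5⟩ :=
      exists_upper (q := q) hq2 U uo uc (decide (lo = 0)) (decide (lc = 0))
    simp only [decide_eq_true_eq] at hu2 hu3 hu4 hu5
    obtain ⟨a1, a2, a3, a4, a5⟩ := hwd y lo lc hy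
    obtain ⟨b1, b2, b3, b4, b5⟩ := hwd y' lo' lc' hy'
    have hm : Marked (u ++ wd y lo lc) := by
      unfold Marked
      rw [List.countP_append, List.countP_append, hu4, hu5, a4, a5]
      split_ifs <;> simp
    have h3 := (hτ _ _ ht u s).2 hm
    rw [append_iff P s u, append_iff P s u, hu1, a1, a2, a3, b1, b2, b3] at h3
    have hml : ∀ a a' b b' : ℕ, (a = 0 ↔ a' = 0) → (a = 0 → b = b') →
        markLevel a b = markLevel a b' ∧ markLevel a' b = markLevel a' b' := by
      intro a a' b b' h1 h2
      unfold markLevel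
      by_cases h : a = 0
      · simp [h, h1.1 h, h2 h]
      · simp [h, mt h1.2 h]
    obtain ⟨c1, c2⟩ := hml lo lo' _ _ ho hu2
    obtain ⟨c3, c4⟩ := hml lc lc' _ _ hc' hu3
    rwa [c1, c2, c3, c4] at h3
  refine ⟨T × T × Bool × Bool × Bool, inferInstance, fun y lo lc => (τ (wd y lo lc),
    τ (wd (1 - y) lo lc), decide (y = 0), decide (lo = 0), decide (lc = 0)), ?_, ?_⟩
  · simp only [Fintype.card_prod, Fintype.card_bool]
    have := Nat.mul_le_mul hc hc
    linarith
  · intro y lo lc y' lo' lc' hy hy' h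
    simp only [Prod.mk.injEq, decide_eq_decide] at h
    obtain ⟨h1, h2, h3, h4, h5⟩ := h
    refine ⟨h4, h5, fun u s uo uc => ?_⟩
    -- With fraction `0` the sign is free, so that of `u` is used.
    by_cases h0 : y = 0
    · have h0' := h3.1 h0
      have := key (decide (u < 0)) u.natAbs uo uc y lo lc y' lo' lc' hy hy' h4 h5 h1
      have hu : (sgn (decide (u < 0)) : ℚ) * (u.natAbs : ℕ) = u := by
        have : sgn (decide (u < 0)) * (u.natAbs : ℤ) = u := by
          unfold sgn
          split_ifs with h <;> simp at h <;> omega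
        rw [← Int.cast_natCast u.natAbs, ← Int.cast_mul, this]
      rw [h0, h0', mul_zero, add_zero]
      rwa [h0, h0', add_zero, hu] at this
    · have h0' := mt h3.2 h0
      obtain ⟨s', U, b, hb⟩ := exists_sign_form u s
      rw [hb y h0, hb y' h0']
      cases b
      · exact key s' U uo uc y lo lc y' lo' lc' hy hy' h4 h5 h1
      · exact key s' U uo uc (1 - y) lo lc (1 - y') lo' lc' (hy.one_sub h0) (hy'.one_sub h0') h4 h5 h2

/-- The pumping argument, for suffixes. -/
theorem exists_short_of_suffixes {α T : Type} [Fintype T] (Q : List α → Prop) (τ : List α → T)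
    (h : ∀ v v', τ v = τ v' → ∀ u, Q (u ++ v) → Q (u ++ v')) (w : List α) (hw : Q w) :
    ∃ w', w'.length < Fintype.card T ∧ Q w' := by
  induction hl : w.length using Nat.strong_induction_on generalizing w with
  | _ l ih =>
    by_cases hlt : l < Fintype.card T
    · exact ⟨w, hl ▸ hlt, hw⟩
    · obtain ⟨i, j, hne, he⟩ := Fintype.exists_ne_map_eq_of_card_lt
        (fun i : Fin (l + 1) => τ (w.drop i)) (by simpa using by omega)
      wlog hij : i < j generalizing i j
      · exact this j i hne.symm he.symm (lt_of_le_of_ne (not_lt.1 hij) hne.symm)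
      have h1 : Q (w.take i ++ w.drop j) := h _ _ he _ (by rwa [List.take_append_drop])
      refine ih _ ?_ _ h1 rfl
      rw [List.length_append, List.length_take, List.length_drop]
      have : (i : ℕ) < j := hij
      omega

/-! ### Pointed expansions as words of digits -/

/-- The numerical conditions on the word of the digits of `N` with length `l`, with the radix point
at the place `L` and the cursor at the place `c` from the end, and with the sign `s`, to be a pointed
expansion. -/
def IsPE (q : ℕ) (s : Bool) (N L c l : ℕ) : Prop :=
  L < l ∧ c < l ∧ N < q ^ l ∧ (l = L + 1 ∨ l = c + 1 ∨ q ^ (l - 1) ≤ N) ∧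
    (L = 0 ∨ c = 0 ∨ N % q ≠ 0) ∧ (s = true → N ≠ 0)

/-- The number with the given sign and digits. -/
def peNum (q : ℕ) (s : Bool) (N L : ℕ) : ℚ := sgn s * (N / (q : ℚ) ^ L)

/-- The pointed expansion with the given digits and marks. -/
def peWord (q : ℕ) [NeZero q] (s : Bool) (N L c l : ℕ) : List (PELetter q) :=
  Sum.inl s :: (PEWord.ofNat q N L c l).map Sum.inr

section

variable {q : ℕ} [q.AtLeastTwo]

theorem peNum_mem {q : ℕ} (s : Bool) (N L : ℕ) : peNum q s N L ∈ ZInv q := by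
  unfold peNum
  rw [div_eq_mul_inv]
  refine mul_mem (intCast_mem _ _) (mul_mem (natCast_mem _ _) ?_)
  simpa using PointedNum.zpow_mem q (-(L : ℤ))

theorem abs_peNum (s : Bool) (N L : ℕ) : |peNum q s N L| = N / (q : ℚ) ^ L := by
  have hq : (0 : ℚ) < q := by have := PointedNum.two_le q; positivity
  unfold peNum
  rw [abs_mul, abs_of_nonneg (show (0 : ℚ) ≤ N / (q : ℚ) ^ L by positivity)]
  cases s <;> simp [sgn]

theorem peNum_neg_iff (s : Bool) (N L : ℕ) (hs : s = true → N ≠ 0) : peNum q s N L < 0 ↔ s = true := by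
  have hq : (0 : ℚ) < q := by have := PointedNum.two_le q; positivity
  have h0 : (0 : ℚ) ≤ N / (q : ℚ) ^ L := by positivity
  unfold peNum
  cases s
  · simpa [sgn] using h0
  · have : (0 : ℚ) < N / (q : ℚ) ^ L := by
      have := Nat.pos_of_ne_zero (hs rfl)
      positivity
    simpa [sgn] using this

/-- The alternatives in `IsPE` say that the first and the last digit cannot be dropped, each being
marked or nonzero; this pins down `top` and `bot`. -/
theorem PointedNum.pe_eq_peWord (x : PointedNum q) {s : Bool} {N L c l : ℕ} (h : IsPE q s N L c l)
    (hn : x.num = peNum q s N L) (hp : x.pos = c - L) : x.pe = peWord q s N L c l := by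
  have hq2 := PointedNum.two_le q
  obtain ⟨hL, hc, hN, htop, hbot, hs⟩ := h
  have habs : |x.num| = N / (q : ℚ) ^ L := by rw [hn, abs_peNum]
  have hdig := fun j => x.digit_scale habs j
  have hhigh : ∀ i : ℤ, ((l - 1 - L : ℕ) : ℤ) < i → x.digit i = 0 := by
    intro i hi
    obtain ⟨j, rfl⟩ : ∃ j : ℕ, i = (j : ℤ) - L := ⟨(i + L).toNat, by omega⟩
    rw [hdig, Nat.div_eq_of_lt]
    · ext; simp
    · exact lt_of_lt_of_le hN (Nat.pow_le_pow_right (by omega) (by omega))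
  have hlow : ∀ i : ℤ, i < -(L : ℤ) → x.digit i = 0 := fun i hi => x.digit_low habs i hi
  have etop : x.top = l - 1 - L := by
    refine le_antisymm (Nat.sInf_le ⟨by omega, hhigh⟩) ?_
    obtain ⟨t1, t2⟩ := x.top_spec
    by_contra! hlt
    rcases htop with h | h | h
    · omega
    · omega
    · have := t2 (((l - 1 : ℕ) : ℤ) - L) (by omega)
      rw [hdig, Fin.ext_iff, Fin.val_ofNat, Fin.val_zero] at this
      have h1 : N / q ^ (l - 1) < q := by
        rw [Nat.div_lt_iff_lt_mul (by positivity), ← pow_succ']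
        rwa [Nat.sub_add_cancel (by omega)]
      rw [Nat.mod_eq_of_lt h1] at this
      have := Nat.div_pos h (by positivity)
      omega
  have ebot : x.bot = L := by
    refine le_antisymm (Nat.sInf_le ⟨by omega, hlow⟩) ?_
    obtain ⟨t1, t2⟩ := x.bot_spec
    by_contra! hlt
    rcases hbot with h | h | h
    · omega
    · omega
    · have := t2 (((0 : ℕ) : ℤ) - L) (by omega)
      rw [hdig, Fin.ext_iff, Fin.val_ofNat, Fin.val_zero] at this
      simp at this
      omega
  unfold PointedNum.pe peWord PEWord.ofNat
  congr 1
  · congr 1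
    rw [hn, Bool.eq_iff_iff, decide_eq_true_eq]
    exact peNum_neg_iff s N L hs
  · rw [etop, ebot, show l - 1 - L + L + 1 = l by omega, List.map_map]
    apply List.map_congr_left
    intro j hj
    have hj' := List.mem_range.1 hj
    have e1 : ((l - 1 - L : ℕ) : ℤ) - j = ((l - 1 - j : ℕ) : ℤ) - L := by omega
    simp only [Function.comp, e1, hdig]
    congr 2
    refine Prod.ext ?_ ?_
    · simp only [decide_eq_decide]; omega
    · simp only [decide_eq_decide]; omega

/-- Superfluous digits can be cut off. -/
theorem exists_isPE (s : Bool) (N L c l : ℕ) (hL : L < l) (hc : c < l) (hN : N < q ^ l) :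
    ∃ s' N' L' c' l', l' ≤ l ∧ IsPE q s' N' L' c' l' ∧ peNum q s' N' L' = peNum q s N L ∧
      (c' : ℤ) - L' = c - L := by
  have hq2 := PointedNum.two_le q
  have hq : (q : ℚ) ≠ 0 := NeZero.ne _
  induction l generalizing N L c with
  | zero => omega
  | succ l ih =>
    by_cases htop : l + 1 = L + 1 ∨ l + 1 = c + 1 ∨ q ^ l ≤ N
    · by_cases hbot : L = 0 ∨ c = 0 ∨ N % q ≠ 0
      · by_cases h0 : N = 0
        · refine ⟨false, N, L, c, l + 1, le_rfl, ⟨hL, hc, hN, htop, hbot, by simp⟩, ?_, rfl⟩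
          simp [peNum, h0]
        · exact ⟨s, N, L, c, l + 1, le_rfl, ⟨hL, hc, hN, htop, hbot, fun _ => h0⟩, rfl, rfl⟩
      -- The last digit is an unmarked zero, and dropping it lowers the places of both marks by one.
      · push Not at hbot
        obtain ⟨s', N', L', c', l', h1, h2, h3, h4⟩ := ih (N / q) (L - 1) (c - 1) (by omega) (by omega)
          (by rw [Nat.div_lt_iff_lt_mul (by omega), ← pow_succ]; exact hN)
        refine ⟨s', N', L', c', l', by omega, h2, ?_, by omega⟩
        rw [h3]
        obtain ⟨M, rfl⟩ := Nat.dvd_of_mod_eq_zero hbot.2.2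
        obtain ⟨L, rfl⟩ := Nat.exists_eq_succ_of_ne_zero hbot.1
        rw [Nat.mul_div_cancel_left _ (by omega)]
        unfold peNum
        simp only [Nat.succ_eq_add_one, Nat.add_sub_cancel, pow_succ]
        push_cast
        field_simp
    · push Not at htop
      obtain ⟨s', N', L', c', l', h1, h2, h3, h4⟩ := ih N L c (by omega) (by omega) (by omega)
      exact ⟨s', N', L', c', l', by omega, h2, h3, h4⟩

theorem PEWord.Marked.eq_peNum {w : List (PEDigit q)} (hw : Marked w) (s : Bool) :
    ∃ N L c, L < w.length ∧ c < w.length ∧ N < q ^ w.length ∧ num s w = peNum q s N L ∧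
      pos w = c - L := by
  have hq : (q : ℚ) ≠ 0 := NeZero.ne _
  have h1 := depth_le radix w
  have h2 := depth_le cursor w
  have h3 := (depth_eq_zero_iff radix w).1
  have h4 := (depth_eq_zero_iff cursor w).1
  obtain ⟨h5, h6⟩ := hw
  have h7 : depth radix w ≠ 0 := fun h => by have := h3 h; omega
  have h8 : depth cursor w ≠ 0 := fun h => by have := h4 h; omega
  refine ⟨toNat w, w.length - depth radix w, w.length - depth cursor w, by omega, by omega,
    toNat_lt w, ?_, by unfold pos; omega⟩
  unfold num peNum frac
  conv_lhs => rw [← Nat.sub_add_cancel h1, pow_add]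
  field_simp

theorem exists_marked {x : ℚ} (hx : x ∈ ZInv q) (m : ℤ) :
    ∃ (s : Bool) (w : List (PEDigit q)), Marked w ∧ num s w = x ∧ pos w = m := by
  have hq2 := PointedNum.two_le q
  have hq : (q : ℚ) ≠ 0 := NeZero.ne _
  obtain ⟨i, n, h⟩ := ZInv.exists_mul_pow hx
  -- Padding by `|m|` fractional digits makes room for a negative cursor position, and padding the
  -- length by `|m|` for a positive one.
  set L := i + m.natAbs
  set N := n.natAbs * q ^ m.natAbs
  set l := N + L + m.natAbs + 1
  have hl : N < q ^ l := (Nat.lt_pow_self (by omega)).trans_le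
    (Nat.pow_le_pow_right (by omega) (show N ≤ l by omega))
  refine ⟨decide (n < 0), PEWord.ofNat q N L (m + L).toNat l, marked_ofNat _ _ _ _ (by omega) (by omega),
    ?_, ?_⟩
  · rw [num_ofNat _ _ _ _ _ (by omega) hl]
    have hs : (sgn (decide (n < 0)) : ℚ) * (n.natAbs : ℕ) = n := by
      have : sgn (decide (n < 0)) * (n.natAbs : ℤ) = n := by
        unfold sgn
        split_ifs with h <;> simp at h <;> omega
      rw [← Int.cast_natCast n.natAbs, ← Int.cast_mul, this]
    simp only [N, L, Nat.cast_mul, Nat.cast_pow, pow_add]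
    rw [← mul_div_assoc, ← mul_assoc, hs, ← h]
    field_simp
  · rw [pos_ofNat _ _ _ _ (by omega) (by omega)]
    omega

theorem BaumslagSolitar.exists_pe_eq (g : BaumslagSolitar 1 q) :
    ∃ s N L c l, IsPE q s N L c l ∧ (toPointed q g).num = peNum q s N L ∧
      (toPointed q g).pos = c - L ∧ pe q g = peWord q s N L c l := by
  obtain ⟨s, w, hw, h1, h2⟩ := exists_marked (toPointed q g).num_mem (toPointed q g).pos
  obtain ⟨N, L, c, a1, a2, a3, a4, a5⟩ := hw.eq_peNum s
  obtain ⟨s', N', L', c', l', -, b2, b3, b4⟩ := exists_isPE s N L c _ a1 a2 a3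
  refine ⟨s', N', L', c', l', b2, by rw [b3, ← a4, h1], by rw [b4, ← a5, h2],
    PointedNum.pe_eq_peWord _ b2 (by rw [b3, ← a4, h1]) (by rw [b4, ← a5, h2])⟩

/-- Membership in a PE-regular subset can be read off from any pointed expansion. -/
theorem BaumslagSolitar.memPred_peSubset_iff (A : FinAutomaton (PELetter q)) {s : Bool} {N L c l : ℕ}
    (h : IsPE q s N L c l) :
    memPred q (peSubset q A) (peNum q s N L) (c - L) ↔ peWord q s N L c l ∈ A.language := by
  obtain ⟨g, h1, h2⟩ := exists_toPointed (peNum_mem (q := q) s N L) ((c : ℤ) - L)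
  rw [← h1, ← h2, memPred_iff]
  show (toPointed q g).pe ∈ A.language ↔ _
  rw [PointedNum.pe_eq_peWord _ h h1 h2]

/-! ### Small witnesses -/

theorem FiniteSuffixes.not {q : ℕ} {P : ℚ → ℤ → Prop} {N : ℕ} (h : FiniteSuffixes q P N) :
    FiniteSuffixes q (fun x m => ¬ P x m) N := by
  obtain ⟨T, i, τ, hc, hτ⟩ := h
  exact ⟨T, i, τ, hc, fun v v' e u s => ⟨(hτ v v' e u s).1, fun hm =>
    not_congr ((hτ v v' e u s).2 hm)⟩⟩

theorem FiniteSuffixes.and {q : ℕ} {P P' : ℚ → ℤ → Prop} {N N' : ℕ} (h : FiniteSuffixes q P N)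
    (h' : FiniteSuffixes q P' N') : FiniteSuffixes q (fun x m => P x m ∧ P' x m) (N * N') := by
  obtain ⟨T, i, τ, hc, hτ⟩ := h
  obtain ⟨T', i', τ', hc', hτ'⟩ := h'
  refine ⟨T × T', inferInstance, fun v => (τ v, τ' v), ?_, fun v v' e u s => ?_⟩
  · rw [Fintype.card_prod]
    exact Nat.mul_le_mul hc hc'
  · rw [Prod.mk.injEq] at e
    have h1 := hτ v v' e.1 u s
    exact ⟨h1.1, fun hm => and_congr (h1.2 hm) ((hτ' v v' e.2 u s).2 hm)⟩

/-- Pumping shortens a word for `(x, m)` while preserving `P`, and cutting off superfluous digits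
then yields a pointed expansion without making the word longer. -/
theorem FiniteSuffixes.exists_small {P : ℚ → ℤ → Prop} {B : ℕ} (h : FiniteSuffixes q P B) {x : ℚ}
    {m : ℤ} (hx : x ∈ ZInv q) (hP : P x m) :
    ∃ s N L c l, l < B ∧ IsPE q s N L c l ∧ P (peNum q s N L) (c - L) := by
  obtain ⟨T, i, τ, hc, hτ⟩ := h
  obtain ⟨s, w, hw, rfl, rfl⟩ := exists_marked hx m
  obtain ⟨w', hl, hw', hP'⟩ := exists_short_of_suffixes (fun w => Marked w ∧ P (num s w) (pos w)) τ
    (fun v v' e u h => ⟨(hτ v v' e u s).1.1 h.1, ((hτ v v' e u s).2 h.1).1 h.2⟩) w ⟨hw, hP⟩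
  obtain ⟨N, L, c, a1, a2, a3, a4, a5⟩ := hw'.eq_peNum s
  obtain ⟨s', N', L', c', l', b1, b2, b3, b4⟩ := exists_isPE s N L c _ a1 a2 a3
  exact ⟨s', N', L', c', l', by omega, b2, by rwa [b3, b4, ← a4, ← a5]⟩

/-- It suffices to test small numbers in order to see that a finite-state set has periods `n` and
`k`. -/
theorem FiniteHalves.saturated_iff {P : ℚ → ℤ → Prop} {B n k : ℕ} (h : FiniteHalves q P B)
    (hn : 0 < n) (hk : 0 < k) (hnk : n ∣ q ^ k - 1) : Saturated q P n k ↔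
      ∀ s N L c l s' N' L' c' l', l < 9 * B * (9 * (4 * n * k * k)) →
        l' < 9 * B * (9 * (4 * n * k * k)) → IsPE q s N L c l → IsPE q s' N' L' c' l' →
        ModEq q n (peNum q s N L) (peNum q s' N' L') → (k : ℤ) ∣ (c - L) - (c' - L') →
        P (peNum q s N L) (c - L) → P (peNum q s' N' L') (c' - L') := by
  constructor
  · intro hs s N L c l s' N' L' c' l' _ _ _ _ hx hm
    exact (hs (peNum_mem s N L) (peNum_mem s' N' L') hx hm).1
  · intro H
    have key : ∀ ⦃x x' : ℚ⦄ ⦃m m' : ℤ⦄, x ∈ ZInv q → x' ∈ ZInv q → ModEq q n x x' →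
        (k : ℤ) ∣ m - m' → P x m → P x' m' := by
      intro x x' m m' hx hx' hxx hm hP
      by_contra hP'
      -- The two elements of a counterexample are shrunk independently. Staying in the congruence
      -- class of `(x, m)`, or of `(x', m')`, is itself a finite-state condition, so the small
      -- elements are still congruent to each other.
      obtain ⟨s, N, L, c, l, a1, a2, a3, a4, a5⟩ :=
        (h.finiteSuffixes.and (finiteHalves_class hn hk hnk (x₀ := x) m).finiteSuffixes).exists_small
          hx ⟨hP, ModEq.refl x, by simp⟩
      obtain ⟨s', N', L', c', l', b1, b2, b3, b4, b5⟩ :=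
        (h.finiteSuffixes.not.and
          (finiteHalves_class hn hk hnk (x₀ := x') m').finiteSuffixes).exists_small
          hx' ⟨hP', ModEq.refl x', by simp⟩
      refine b3 (H s N L c l s' N' L' c' l' a1 b1 a2 b2 (a4.trans (hxx.trans b4.symm)) ?_ a3)
      rw [show (c : ℤ) - L - (c' - L') = (c - L - m) + (m - m') - (c' - L' - m') by ring]
      exact dvd_sub (dvd_add a5 hm) b5
    intro x x' m m' hx hx' hxx hm
    exact ⟨key hx hx' hxx hm, key hx' hx hxx.symm (by rw [← neg_sub]; exact hm.neg_right)⟩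

/-- A criterion for recognizability that tests only small numbers. -/
theorem BaumslagSolitar.isRecognizable_iff_small {R : Set (BaumslagSolitar 1 q)} {B : ℕ}
    (h : FiniteHalves q (memPred q R) B) : IsRecognizable R ↔
      ∃ n ≤ B, ∃ k ≤ B * B, 0 < n ∧ 0 < k ∧ n ∣ q ^ k - 1 ∧
      ∀ s N L c l s' N' L' c' l', l < 9 * B * (9 * (4 * n * k * k)) →
        l' < 9 * B * (9 * (4 * n * k * k)) → IsPE q s N L c l → IsPE q s' N' L' c' l' →
        ModEq q n (peNum q s N L) (peNum q s' N' L') → (k : ℤ) ∣ (c - L) - (c' - L') →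
        memPred q R (peNum q s N L) (c - L) → memPred q R (peNum q s' N' L') (c' - L') := by
  rw [isRecognizable_iff]
  constructor
  · intro hs
    obtain ⟨n, hn, k, hk, h1, h2, h3, h4⟩ := h.exists_small_periods hs
    exact ⟨n, hn, k, hk, h1, h2, h3, (h.saturated_iff h1 h2 h3).1 h4⟩
  · rintro ⟨n, -, k, -, h1, h2, h3, h4⟩
    exact ⟨n, k, h1, h2, h3, (h.saturated_iff h1 h2 h3).2 h4⟩

end

/-! ### PE-regular subsets are finite-state -/

namespace PEWord

variable {q : ℕ} [NeZero q]

/-- Only the lowest `l` digits count, and marks at places `≥ l` are invisible. -/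
theorem ofNat_congr {N N' L L' c c' l : ℕ} (hN : N % q ^ l = N' % q ^ l)
    (hL : L = L' ∨ (l ≤ L ∧ l ≤ L')) (hc : c = c' ∨ (l ≤ c ∧ l ≤ c')) :
    ofNat q N L c l = ofNat q N' L' c' l := by
  unfold ofNat
  apply List.map_congr_left
  intro j hj
  have hj' := List.mem_range.1 hj
  refine Prod.ext (Fin.ext ?_) (Prod.ext ?_ ?_)
  · have h : ∀ M : ℕ, M / q ^ (l - 1 - j) % q = (M % q ^ l) / q ^ (l - 1 - j) % q := by
      intro M
      have e : q ^ l = q ^ (l - 1 - j) * q * q ^ j := by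
        rw [← pow_succ, ← pow_add]
        congr 1
        omega
      rw [e, mul_assoc, Nat.mod_mul_right_div_self, Nat.mod_mul_right_mod]
    simp only [Fin.val_ofNat]
    rw [h N, h N', hN]
  · simp only [decide_eq_decide]; omega
  · simp only [decide_eq_decide]; omega

/-- With at most one mark of each kind, a word is recovered from its length, its number and its
depths; a missing mark has depth `0`, hence a place outside the word. -/
theorem eq_ofNat (w : List (PEDigit q)) (h1 : w.countP radix ≤ 1) (h2 : w.countP cursor ≤ 1) :
    w = ofNat q (toNat w) (w.length - depth radix w) (w.length - depth cursor w) w.length := by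
  induction w with
  | nil => rfl
  | cons d w ih =>
    rw [List.countP_cons] at h1 h2
    have hmark : ∀ f : PEDigit q → Bool, w.countP f + (if f d = true then 1 else 0) ≤ 1 →
        f d = decide (w.length = w.length + 1 - depth f (d :: w)) ∧
        (w.length + 1 - depth f (d :: w) = w.length - depth f w ∨
          (w.length ≤ w.length + 1 - depth f (d :: w) ∧ w.length ≤ w.length - depth f w)) := by
      intro f hf
      have h3 := depth_eq_zero_iff f w
      have h4 := depth_le f w
      rw [depth]
      by_cases h : depth f w = 0
      · by_cases hd : f d = true
        · simp [h, hd]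
        · simp [h, hd]
      · have hd : f d = false := by
          by_contra hd
          rw [Bool.not_eq_false] at hd
          rw [if_pos hd] at hf
          exact h (h3.2 (by omega))
        have h5 : ¬ (w.length = w.length + 1 - (depth f w + 1)) := by omega
        simp only [ne_eq, h, not_false_eq_true, if_true, hd, h5, decide_false, true_and]
        omega
    obtain ⟨m1, m2⟩ := hmark radix h1
    obtain ⟨m3, m4⟩ := hmark cursor h2
    rw [List.length_cons, ofNat_succ]
    have hlt := toNat_lt w
    congr 1
    · refine Prod.ext (Fin.ext ?_) (Prod.ext m1 m3)
      rw [toNat, Fin.val_ofNat, mul_comm, Nat.mul_add_div (by have := NeZero.pos q; positivity),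
        Nat.div_eq_of_lt hlt, add_zero, Nat.mod_eq_of_lt d.1.2]
    · refine (ih (by omega) (by omega)).trans (ofNat_congr ?_ (by omega) (by omega))
      simp [toNat]

end PEWord

/-! ### Trimming words to pointed expansions -/

namespace PEWord

variable {q : ℕ} [q.AtLeastTwo]

/-- An unmarked zero. -/
def isBlank (d : PEDigit q) : Bool := decide (d = (0, false, false))

theorem isBlank_iff (d : PEDigit q) : isBlank d = true ↔ d = (0, false, false) := by
  simp [isBlank]

/-- The word without the blanks at its beginning and at its end. -/
def trim (w : List (PEDigit q)) : List (PEDigit q) := (w.rdropWhile isBlank).dropWhile isBlank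

/-- The words have the same value. -/
def SameValue (w w' : List (PEDigit q)) : Prop :=
  (Marked w ↔ Marked w') ∧ (Marked w → (∀ s, num s w = num s w') ∧ pos w = pos w') ∧
    (toNat w = 0 ↔ toNat w' = 0)

theorem SameValue.trans {q : ℕ} {w w' w'' : List (PEDigit q)} (h : SameValue w w') (h' : SameValue w' w'') :
    SameValue w w'' :=
  ⟨h.1.trans h'.1, fun hm => ⟨fun s => ((h.2.1 hm).1 s).trans ((h'.2.1 (h.1.1 hm)).1 s),
    (h.2.1 hm).2.trans (h'.2.1 (h.1.1 hm)).2⟩, h.2.2.trans h'.2.2⟩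

theorem SameValue.refl {q : ℕ} (w : List (PEDigit q)) : SameValue w w := ⟨Iff.rfl, by simp, Iff.rfl⟩

theorem sameValue_cons (w : List (PEDigit q)) : SameValue ((0, false, false) :: w) w := by
  have hq : (q : ℚ) ≠ 0 := NeZero.ne _
  have hm : Marked ((0, false, false) :: w) ↔ Marked w := by simp [Marked, radix, cursor]
  have ht : toNat ((0, false, false) :: w) = toNat w := by simp [toNat]
  refine ⟨hm, fun h => ?_, by rw [ht]⟩
  have h' := hm.1 h
  have hd : ∀ f : PEDigit q → Bool, f (0, false, false) = false → w.countP f = 1 →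
      depth f ((0, false, false) :: w) = depth f w + 1 := by
    intro f hf hc
    have : depth f w ≠ 0 := fun h => by have := (depth_eq_zero_iff f w).1 h; omega
    simp [depth, this]
  have h1 := hd radix rfl h'.1
  have h2 := hd cursor rfl h'.2
  refine ⟨fun s => ?_, ?_⟩
  · unfold num frac
    rw [h1, ht, List.length_cons, pow_succ, pow_succ]
    field_simp
  · unfold pos
    rw [h1, h2]
    push_cast
    ring

theorem sameValue_concat (w : List (PEDigit q)) : SameValue (w ++ [(0, false, false)]) w := by
  have hq : (q : ℚ) ≠ 0 := NeZero.ne _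
  have hm : Marked (w ++ [(0, false, false)]) ↔ Marked w := by simp [Marked, radix, cursor]
  have ht : toNat (w ++ [(0, false, false)]) = toNat w * q := by simp [toNat_append, toNat]
  refine ⟨hm, fun h => ?_, by rw [ht]; simp [NeZero.ne q]⟩
  have hd : ∀ f : PEDigit q → Bool, f (0, false, false) = false →
      depth f (w ++ [(0, false, false)]) = depth f w := by
    intro f hf
    simp [depth_append, depth, hf]
  have h1 := hd radix rfl
  have h2 := hd cursor rfl
  refine ⟨fun s => ?_, by unfold pos; rw [h1, h2]⟩
  unfold num frac
  rw [h1, ht, List.length_append, List.length_singleton, pow_succ]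
  push_cast
  field_simp

theorem sameValue_trim (w : List (PEDigit q)) : SameValue w (trim w) := by
  have hl : ∀ w : List (PEDigit q), SameValue w (w.dropWhile isBlank) := by
    intro w
    induction w with
    | nil => exact SameValue.refl _
    | cons d w ih =>
      by_cases h : isBlank d = true
      · rw [List.dropWhile_cons_of_pos h, (isBlank_iff d).1 h]
        exact (sameValue_cons w).trans ih
      · rw [List.dropWhile_cons_of_neg h]
        exact SameValue.refl _
  have hr : ∀ w : List (PEDigit q), SameValue w (w.rdropWhile isBlank) := by
    intro w
    induction w using List.reverseRecOn with
    | nil => exact SameValue.refl _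
    | append_singleton w d ih =>
      by_cases h : isBlank d = true
      · rw [List.rdropWhile_concat_pos _ _ _ h, (isBlank_iff d).1 h]
        exact (sameValue_concat w).trans ih
      · rw [List.rdropWhile_concat_neg _ _ _ h]
        exact SameValue.refl _
  exact (hr w).trans (hl _)

theorem getLast?_dropWhile {α : Type} (p : α → Bool) (w : List α) {x : α}
    (h : (w.dropWhile p).getLast? = some x) : w.getLast? = some x := by
  induction w with
  | nil => simp at h
  | cons d w ih =>
    by_cases hd : p d = true
    · rw [List.dropWhile_cons_of_pos hd] at h
      have := ih h
      rw [List.getLast?_cons, this]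
      simp
    · rwa [List.dropWhile_cons_of_neg hd] at h

/-- A trimmed word is a pointed expansion. -/
theorem isPE_trim {w : List (PEDigit q)} (hw : Marked w) (s : Bool) :
    ∃ N L c l, IsPE q (s && decide (toNat w ≠ 0)) N L c l ∧ trim w = ofNat q N L c l ∧
      num s w = peNum q (s && decide (toNat w ≠ 0)) N L ∧ pos w = c - L := by
  have hq2 := PointedNum.two_le q
  have hv := sameValue_trim w
  set w' := trim w with hw'
  have hm := hv.1.1 hw
  have e := eq_ofNat w' hm.1.le hm.2.le
  have hd1 := depth_le radix w'
  have hd2 := depth_le cursor w'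
  have hd3 : depth radix w' ≠ 0 := fun h => by
    have := (depth_eq_zero_iff radix w').1 h; have := hm.1; omega
  have hd4 : depth cursor w' ≠ 0 := fun h => by
    have := (depth_eq_zero_iff cursor w').1 h; have := hm.2; omega
  set N := toNat w' with hN
  set L := w'.length - depth radix w' with hL
  set c := w'.length - depth cursor w' with hc
  obtain ⟨l, hl⟩ : ∃ l, w'.length = l + 1 := ⟨w'.length - 1, by omega⟩
  have hNlt : N < q ^ (l + 1) := by rw [← hl]; exact toNat_lt w'
  rw [hl] at e
  -- Neither end of the trimmed word is a blank; this becomes the two minimality conditions of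
  -- `IsPE`.
  have hhead : ∀ d ∈ w'.head?, ¬ isBlank d = true := by
    intro d hd h
    have := List.head?_dropWhile_not isBlank (w.rdropWhile isBlank)
    rw [show (w.rdropWhile isBlank).dropWhile isBlank = w' from rfl] at this
    rw [Option.mem_def.1 hd] at this
    simp [h] at this
  have hlast : ∀ d ∈ w'.getLast?, ¬ isBlank d = true := by
    intro d hd h
    have h1 := getLast?_dropWhile _ _ (Option.mem_def.1 hd)
    have h2 := List.rdropWhile_last_not isBlank w (by
      intro h0; rw [h0] at h1; simp at h1)
    rw [List.getLast?_eq_some_getLast (by intro h0; rw [h0] at h1; simp at h1)] at h1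
    rw [Option.some.inj h1] at h2
    exact h2 h
  refine ⟨N, L, c, l + 1, ⟨by omega, by omega, hNlt, ?_, ?_, ?_⟩, e, ?_, ?_⟩
  · by_contra! hcon
    refine hhead (Fin.ofNat q (N / q ^ l), decide (l = L), decide (l = c))
      (by rw [e, ofNat_succ]; simp) ((isBlank_iff _).2 ?_)
    have h3 : N / q ^ l = 0 := Nat.div_eq_of_lt hcon.2.2
    refine Prod.ext (Fin.ext (by simp [h3])) (Prod.ext ?_ ?_)
    · simp only [decide_eq_false_iff_not]; omega
    · simp only [decide_eq_false_iff_not]; omega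
  · by_contra! hcon
    refine hlast (Fin.ofNat q N, decide (0 = L), decide (0 = c)) ?_ ((isBlank_iff _).2 ?_)
    · rw [e, ofNat, List.range_succ, List.map_append]
      simp
    · refine Prod.ext (Fin.ext (by simp [hcon.2.2])) (Prod.ext ?_ ?_)
      · simp only [decide_eq_false_iff_not]; omega
      · simp only [decide_eq_false_iff_not]; omega
  · intro h
    simp only [Bool.and_eq_true, decide_eq_true_eq] at h
    exact fun h0 => h.2 (hv.2.2.2 h0)
  · rw [(hv.2.1 hw).1 s]
    conv_lhs => rw [e]
    rw [num_ofNat _ _ _ _ _ (by omega) hNlt]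
    unfold peNum
    by_cases h0 : toNat w = 0
    · rw [show N = 0 from hv.2.2.1 h0]
      simp
    · simp [h0]
  · rw [(hv.2.1 hw).2]
    conv_lhs => rw [e]
    rw [pos_ofNat _ _ _ _ (by omega) (by omega)]

theorem rdropWhile_append {α : Type} (p : α → Bool) (u v : List α) : (u ++ v).rdropWhile p =
    if v.rdropWhile p = [] then u.rdropWhile p else u ++ v.rdropWhile p := by
  unfold List.rdropWhile
  rw [List.reverse_append, List.dropWhile_append]
  simp only [List.isEmpty_iff, List.reverse_eq_nil_iff]
  split_ifs <;> simp

end PEWord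

/-! ### Runs, and suffix classes of PE-regular subsets -/

theorem FinAutomaton.Run.append_iff {α : Type} (A : FinAutomaton α) {p p' : ℕ} {u v : List α} :
    A.Run p (u ++ v) p' ↔ ∃ r, A.Run p u r ∧ A.Run r v p' := by
  induction u generalizing p with
  | nil =>
    constructor
    · exact fun h => ⟨p, .nil p, h⟩
    · rintro ⟨r, h, h'⟩
      cases h
      exact h'
  | cons x u ih =>
    constructor
    · intro h
      cases h with
      | cons he h =>
        obtain ⟨r, h1, h2⟩ := ih.1 h
        exact ⟨r, .cons he h1, h2⟩
    · rintro ⟨r, h, h'⟩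
      cases h with
      | cons he h => exact .cons he (ih.2 ⟨r, h, h'⟩)

/-- Only targets of edges are reached by nonempty runs, so the number of edges bounds the number of
states that matter after the sign has been read. -/
theorem FinAutomaton.Run.mem_targets {α : Type} {A : FinAutomaton α} {p p' : ℕ} {x : α} {w : List α}
    (h : A.Run p (x :: w) p') : p' ∈ (A.edges.map fun e => e.2.2).toFinset := by
  induction w generalizing p x with
  | nil =>
    cases h with
    | cons he h =>
      cases h
      simp only [List.mem_toFinset, List.mem_map]
      exact ⟨_, he, rfl⟩
  | cons y w ih =>
    cases h with
    | cons he h => exact ih h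

section

variable {q : ℕ} [q.AtLeastTwo]

/-- A word of digits is accepted from the state `p`. -/
def FinAutomaton.AcceptsDigits (A : FinAutomaton (PELetter q)) (p : ℕ) (w : List (PEDigit q)) : Prop :=
  ∃ f ∈ A.final, A.Run p (w.map Sum.inr) f

/-- The run on the trimmed word is split after its sign, which is forced to `+` if all digits
vanish. -/
theorem BaumslagSolitar.memPred_peSubset_iff_trim (A : FinAutomaton (PELetter q)) (s : Bool)
    {w : List (PEDigit q)} (hw : Marked w) :
    memPred q (peSubset q A) (num s w) (pos w) ↔
      ∃ p, A.Run A.init [Sum.inl (s && decide (toNat w ≠ 0))] p ∧ A.AcceptsDigits p (trim w) := by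
  obtain ⟨N, L, c, l, h1, h2, h3, h4⟩ := isPE_trim hw s
  rw [h3, h4, memPred_peSubset_iff A h1]
  unfold peWord FinAutomaton.language FinAutomaton.AcceptsDigits
  rw [h2, ← List.singleton_append]
  constructor
  · rintro ⟨f, hf, h⟩
    obtain ⟨r, h5, h6⟩ := (FinAutomaton.Run.append_iff A).1 h
    exact ⟨r, h5, f, hf, h6⟩
  · rintro ⟨r, h5, f, hf, h6⟩
    exact ⟨f, hf, (FinAutomaton.Run.append_iff A).2 ⟨r, h5, h6⟩⟩

/-- A bound on the number of classes of suffixes for an automaton with `n` edges. -/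
def peBound (n : ℕ) : ℕ := 36 * (2 ^ n * 2 ^ n)

/-- A suffix `v` enters `trim (u ++ v)` through its right-trimmed form, unless that form is empty
(then only `u` is left) or `u` consists of blanks (then `trim v` is left). So the type records
whether `v` is blank, the states that accept either form of `v`, whether all its digits are `0`
(this affects the sign), and the capped numbers of marks. -/
theorem BaumslagSolitar.finiteSuffixes_peSubset (A : FinAutomaton (PELetter q)) :
    FiniteSuffixes q (memPred q (peSubset q A)) (peBound A.edges.length) := by
  classical
  set S := (A.edges.map fun e => e.2.2).toFinset
  have hS : S.card ≤ A.edges.length := by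
    simpa using List.toFinset_card_le (A.edges.map fun e => e.2.2)
  refine ⟨Bool × Set S × Set S × Bool × Fin 3 × Fin 3, inferInstance, fun v =>
    (decide (v.rdropWhile isBlank = []), {p | A.AcceptsDigits p (v.rdropWhile isBlank)},
      {p | A.AcceptsDigits p (trim v)}, decide (toNat v = 0), capTwo (v.countP radix),
      capTwo (v.countP cursor)), ?_, ?_⟩
  · simp only [Fintype.card_prod, Fintype.card_bool, Fintype.card_fin, Fintype.card_set,
      Fintype.card_coe]
    have : 2 ^ S.card ≤ 2 ^ A.edges.length := Nat.pow_le_pow_right (by norm_num) hS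
    have := Nat.mul_le_mul this this
    unfold peBound
    linarith
  · intro v v' h u s
    simp only [Prod.mk.injEq, decide_eq_decide] at h
    obtain ⟨h1, h2, h3, h4, h5, h6⟩ := h
    have hm := marked_append_iff (u := u) h5 h6
    refine ⟨hm, fun hu => ?_⟩
    rw [memPred_peSubset_iff_trim A s hu, memPred_peSubset_iff_trim A s (hm.1 hu)]
    have hz : toNat (u ++ v) = 0 ↔ toNat (u ++ v') = 0 := by
      rw [toNat_append, toNat_append]
      simp [NeZero.ne q, h4]
    have hz' : decide (toNat (u ++ v) ≠ 0) = decide (toNat (u ++ v') ≠ 0) := by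
      rw [decide_eq_decide]; exact not_congr hz
    rw [hz']
    refine exists_congr fun p => and_congr_right fun hp => ?_
    unfold trim
    rw [rdropWhile_append, rdropWhile_append]
    by_cases h0 : v.rdropWhile isBlank = []
    · rw [if_pos h0, if_pos (h1.1 h0)]
    · rw [if_neg h0, if_neg (mt h1.2 h0), List.dropWhile_append, List.dropWhile_append]
      -- If `u` is blank, the blanks at the beginning of `v` are trimmed as well.
      split_ifs with hu0
      · have := Set.ext_iff.1 h3 ⟨p, hp.mem_targets⟩
        exact this
      · have hrun : ∀ v : List (PEDigit q), A.AcceptsDigits p (u.dropWhile isBlank ++ v) ↔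
            ∃ r, A.Run p ((u.dropWhile isBlank).map Sum.inr) r ∧ A.AcceptsDigits r v := by
          intro v
          unfold FinAutomaton.AcceptsDigits
          rw [List.map_append]
          constructor
          · rintro ⟨f, hf, h⟩
            obtain ⟨r, h5, h6⟩ := (FinAutomaton.Run.append_iff A).1 h
            exact ⟨r, h5, f, hf, h6⟩
          · rintro ⟨r, h5, f, hf, h6⟩
            exact ⟨f, hf, (FinAutomaton.Run.append_iff A).2 ⟨r, h5, h6⟩⟩
        rw [hrun, hrun]
        refine exists_congr fun r => and_congr_right fun hr => ?_
        have hr' : A.Run A.init (Sum.inl (s && decide (toNat (u ++ v') ≠ 0)) ::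
            (u.dropWhile isBlank).map Sum.inr) r :=
          (FinAutomaton.Run.append_iff A (u := [_])).2 ⟨p, hp, hr⟩
        exact Set.ext_iff.1 h2 ⟨r, hr'.mem_targets⟩

end

/-! ### Finite-state sets are PE-regular -/

theorem WordEquiv.refl {q : ℕ} {P : ℚ → ℤ → Prop} (v : List (PEDigit q)) : WordEquiv q P v v :=
  fun _ _ => ⟨Iff.rfl, fun _ => Iff.rfl⟩

theorem WordEquiv.symm {q : ℕ} {P : ℚ → ℤ → Prop} {v v' : List (PEDigit q)} (h : WordEquiv q P v v') :
    WordEquiv q P v' v :=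
  fun u s => ⟨(h u s).1.symm, fun hm => ((h u s).2 ((h u s).1.2 hm)).symm⟩

theorem WordEquiv.trans {q : ℕ} {P : ℚ → ℤ → Prop} {v v' v'' : List (PEDigit q)}
    (h : WordEquiv q P v v') (h' : WordEquiv q P v' v'') : WordEquiv q P v v'' :=
  fun u s => ⟨(h u s).1.trans (h' u s).1, fun hm =>
    ((h u s).2 hm).trans ((h' u s).2 ((h u s).1.1 hm))⟩

theorem WordEquiv.cons {q : ℕ} {P : ℚ → ℤ → Prop} {v v' : List (PEDigit q)} (h : WordEquiv q P v v')
    (d : PEDigit q) : WordEquiv q P (d :: v) (d :: v') := by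
  intro u s
  simpa using h (u ++ [d]) s

/-- The classes of suffixes can be numbered. -/
theorem FiniteSuffixes.exists_numbering {q : ℕ} {P : ℚ → ℤ → Prop} {N : ℕ}
    (h : FiniteSuffixes q P N) : ∃ (m : ℕ) (c : List (PEDigit q) → ℕ),
      (∀ v, c v < m) ∧ ∀ v v', c v = c v' ↔ WordEquiv q P v v' := by
  obtain ⟨T, _, τ, -, hτ⟩ := h
  let S : Setoid (List (PEDigit q)) := ⟨WordEquiv q P, .refl, .symm, .trans⟩
  have : Finite (Quotient S) := by
    have hr : Finite (Set.range τ) := inferInstance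
    refine Finite.of_surjective (fun x : Set.range τ => (⟦x.2.choose⟧ : Quotient S)) ?_
    intro x
    induction x using Quotient.inductionOn with
    | h v =>
      refine ⟨⟨τ v, v, rfl⟩, Quotient.sound (hτ _ _ ?_)⟩
      exact (⟨v, rfl⟩ : ∃ y, τ y = τ v).choose_spec
  let e := Finite.equivFin (Quotient S)
  refine ⟨Nat.card (Quotient S), fun v => e ⟦v⟧, fun v => (e ⟦v⟧).2, fun v v' => ?_⟩
  rw [Fin.val_inj, e.apply_eq_iff_eq, Quotient.eq]
  rfl

section

variable {q : ℕ} [q.AtLeastTwo]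

/-- The Myhill-Nerode automaton for suffixes: its states are the suffix classes, the digit `d` leads
from the class of `d :: v` to the class of `v`, and the class of the empty word is final. The extra
initial state `m`, which is not the number of a class, reads the sign. The construction is not
effective and serves only for the existence of certificates. -/
theorem BaumslagSolitar.exists_peSubset_eq {R : Set (BaumslagSolitar 1 q)} {N : ℕ}
    (h : FiniteSuffixes q (memPred q R) N) : ∃ A : FinAutomaton (PELetter q), peSubset q A = R := by
  obtain ⟨m, c, hcm, hc⟩ := h.exists_numbering
  set Acc : Bool → List (PEDigit q) → Prop := fun s v =>
    Marked v ∧ memPred q R (num s v) (pos v) with hAcc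
  have hAccc : ∀ s v v', c v = c v' → Acc s v → Acc s v' := by
    intro s v v' e h
    have := (hc v v').1 e [] s
    exact ⟨this.1.1 h.1, (this.2 h.1).1 h.2⟩
  set E : Set (ℕ × PELetter q × ℕ) := {e | (∃ v d, e = (c (d :: v), Sum.inr d, c v)) ∨
    ∃ v s, Acc s v ∧ e = (m, Sum.inl s, c v)} with hE
  have hfin : E.Finite := by
    refine ((Set.finite_Iic m).prod (Set.finite_univ.prod (Set.finite_Iic m))).subset ?_
    rintro _ (⟨v, d, rfl⟩ | ⟨v, s, -, rfl⟩)
    · exact ⟨(hcm _).le, trivial, (hcm _).le⟩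
    · exact ⟨Set.mem_Iic.2 le_rfl, trivial, (hcm _).le⟩
  let A : FinAutomaton (PELetter q) := ⟨m, [c []], hfin.toFinset.toList⟩
  have hmem : ∀ e, e ∈ A.edges ↔ e ∈ E := by
    intro e
    simp [A]
  -- Prepending a digit respects the classes, so the automaton is deterministic when read backwards
  -- from the final state.
  have hrun : ∀ (w : List (PEDigit q)) (p : ℕ), A.Run p (w.map Sum.inr) (c []) ↔ p = c w := by
    intro w
    induction w with
    | nil =>
      intro p
      constructor
      · intro h
        cases h
        rfl
      · rintro rfl
        exact .nil _
    | cons d w ih =>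
      intro p
      constructor
      · intro h
        cases h with
        | cons he h =>
          rw [ih] at h
          rw [hmem] at he
          rcases he with ⟨v, d', e⟩ | ⟨v, s, -, e⟩
          · simp only [Prod.mk.injEq, Sum.inr.injEq] at e
            obtain ⟨rfl, rfl, e⟩ := e
            rw [hc]
            exact ((hc _ _).1 (e.symm.trans h)).cons d
          · simp at e
      · rintro rfl
        exact .cons ((hmem _).2 (Or.inl ⟨w, d, rfl⟩)) ((ih _).2 rfl)
  refine ⟨A, ?_⟩
  ext g
  obtain ⟨s, N, L, k, l, h1, h2, h3, h4⟩ := exists_pe_eq g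
  have hacc : g ∈ R ↔ Acc s (PEWord.ofNat q N L k l) := by
    rw [← memPred_iff, hAcc, h2, h3]
    simp only
    rw [num_ofNat _ _ _ _ _ h1.1 h1.2.2.1, pos_ofNat _ _ _ _ h1.1 h1.2.1]
    exact (and_iff_right (marked_ofNat _ _ _ _ h1.1 h1.2.1)).symm
  rw [hacc]
  show pe q g ∈ A.language ↔ _
  rw [h4]
  constructor
  · rintro ⟨f, hf, h⟩
    have hf' : f = c [] := by simpa [A] using hf
    subst hf'
    unfold peWord at h
    cases h with
    | cons he h =>
      rw [hrun] at h
      rw [hmem] at he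
      rcases he with ⟨v, d', e⟩ | ⟨v, s', ha, e⟩
      · simp at e
      · simp only [Prod.mk.injEq, Sum.inl.injEq] at e
        obtain ⟨-, rfl, e⟩ := e
        exact hAccc _ _ _ (e.symm.trans h) ha
  · intro h
    exact ⟨c [], by simp [A], .cons ((hmem _).2 (Or.inr ⟨_, s, h, rfl⟩)) ((hrun _ _).2 rfl)⟩

/-! ### Left multiplication by a letter -/

/-- The preimage of a set under left multiplication by a letter. -/
def leftPred (q : ℕ) (P : ℚ → ℤ → Prop) : BSLetter → ℚ → ℤ → Prop
  | (BSGen.a, true), x, m => P (x + 1) m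
  | (BSGen.a, false), x, m => P (x - 1) m
  | (BSGen.t, true), x, m => P (q * x) (m + 1)
  | (BSGen.t, false), x, m => P (x / q) (m - 1)

theorem isFrac_fract {q : ℕ} {r : ℚ} (hr : r ∈ ZInv q) : IsFrac q (Int.fract r) :=
  ⟨sub_mem hr (intCast_mem _ _), Int.fract_nonneg r, Int.fract_lt_one r⟩

/-- The integer part of a number in `[-1, 2)`. -/
def carry (r : ℚ) : Fin 3 := if r < 0 then 0 else if r < 1 then 1 else 2

theorem carry_eq {r r' : ℚ} (h : -1 ≤ r ∧ r < 2) (h' : -1 ≤ r' ∧ r' < 2) (e : carry r = carry r') :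
    ⌊r⌋ = ⌊r'⌋ := by
  have key : ∀ r : ℚ, -1 ≤ r ∧ r < 2 → ⌊r⌋ = (carry r : ℕ) - 1 := by
    intro r h
    rw [Int.floor_eq_iff]
    unfold carry
    split_ifs with h1 h2 <;> norm_num <;> constructor <;> linarith
  rw [key r h, key r' h', e]

/-- If the radix point is in the upper half, the unit only changes the integer. If it has depth `lo
> 0`, the fraction becomes `y ± q ^ (-lo)`, which passes a carry `-1`, `0` or `1` upwards; the type
records the carry and the type of the new fraction for both signs. -/
theorem FiniteHalves.add_unit {P : ℚ → ℤ → Prop} {N : ℕ} (h : FiniteHalves q P N) (b : Bool) :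
    FiniteHalves q (fun x m => P (x + sgn b) m) (18 * N * N * N) := by
  have hq2 := PointedNum.two_le q
  have hq : (q : ℚ) ≠ 0 := NeZero.ne _
  have hq0 : (0 : ℚ) < q := by positivity
  obtain ⟨T, _, τ, hc, hτ⟩ := h
  let r : Bool → ℚ → ℕ → ℚ := fun σ y lo => y + sgn σ * (q : ℚ) ^ (-(lo : ℤ))
  refine ⟨Bool × T × (Fin 3 × T) × (Fin 3 × T), inferInstance, fun y lo lc => (decide (lo = 0),
    τ y lo lc, (carry (r true y lo), τ (Int.fract (r true y lo)) lo lc),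
      (carry (r false y lo), τ (Int.fract (r false y lo)) lo lc)), ?_, ?_⟩
  · simp only [Fintype.card_prod, Fintype.card_bool, Fintype.card_fin]
    have := Nat.mul_le_mul hc (Nat.mul_le_mul hc hc)
    nlinarith
  · intro y lo lc y' lo' lc' hy hy' e
    simp only [Prod.mk.injEq, decide_eq_decide] at e
    obtain ⟨e0, e1, ⟨e2, e3⟩, ⟨e4, e5⟩⟩ := e
    obtain ⟨g1, g2, g3⟩ := hτ _ _ _ _ _ _ hy hy' e1
    refine ⟨g1, g2, fun u s uo uc => ?_⟩
    have hsh : ∀ (x : ℚ) (o c : ℤ), Shifted q (fun x m => P (x + sgn b) m) x o c ↔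
        Shifted q P (x + sgn b * (q : ℚ) ^ o) o c := by
      intro x o c
      unfold Shifted
      rw [add_mul, mul_assoc, ← zpow_add₀ hq, add_neg_cancel, zpow_zero, mul_one]
    rw [hsh, hsh]
    by_cases h0 : lo = 0
    · have h0' := e0.1 h0
      have := g3 (u + sgn b * (q : ℤ) ^ uo) s uo uc
      simp only [markLevel, h0, h0', if_true] at this ⊢
      push_cast at this
      rw [zpow_natCast, add_right_comm (u : ℚ) (sgn s * y), add_right_comm (u : ℚ) (sgn s * y')]
      exact this
    · have h0' := mt e0.2 h0
      have hr : ∀ y lo, IsFrac q y → ∀ σ, (-1 ≤ r σ y lo ∧ r σ y lo < 2) ∧ r σ y lo ∈ ZInv q := by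
        intro y lo hy σ
        have h1 : (q : ℚ) ^ (-(lo : ℤ)) ≤ 1 := by
          rw [zpow_neg, zpow_natCast]
          exact inv_le_one_of_one_le₀ (one_le_pow₀ (by exact_mod_cast (by omega : 1 ≤ q)))
        have h2 : 0 ≤ (q : ℚ) ^ (-(lo : ℤ)) := by positivity
        have := hy.2.1
        have := hy.2.2
        refine ⟨?_, add_mem hy.1 (mul_mem (intCast_mem _ _) (PointedNum.zpow_mem _ _))⟩
        cases σ <;> simp only [r, sgn, Bool.false_eq_true, if_true, if_false] <;> push_cast <;>
          constructor <;> linarith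
      -- Relative to the sign `s` of the fraction, the unit with sign `b` has the sign `s ^^ b`.
      have hs : ∀ (y : ℚ) (lo : ℕ), (u : ℚ) + sgn s * y + sgn b * (q : ℚ) ^ (-(lo : ℤ)) =
          ((u + sgn s * ⌊r (s ^^ b) y lo⌋ : ℤ) : ℚ) + sgn s * Int.fract (r (s ^^ b) y lo) := by
        intro y lo
        push_cast
        rw [add_assoc (u : ℚ), add_assoc (u : ℚ), ← mul_add, Int.floor_add_fract]
        cases s <;> cases b <;> simp [r, sgn] <;> ring
      have hfl : ⌊r (s ^^ b) y lo⌋ = ⌊r (s ^^ b) y' lo'⌋ := by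
        apply carry_eq (hr y lo hy _).1 (hr y' lo' hy' _).1
        cases hh : s ^^ b <;> assumption
      have hτ' : τ (Int.fract (r (s ^^ b) y lo)) lo lc = τ (Int.fract (r (s ^^ b) y' lo')) lo' lc' := by
        cases hh : s ^^ b <;> assumption
      have := (hτ _ _ _ _ _ _ (isFrac_fract (hr y lo hy (s ^^ b)).2)
        (isFrac_fract (hr y' lo' hy' (s ^^ b)).2) hτ').2.2 (u + sgn s * ⌊r (s ^^ b) y lo⌋) s uo uc
      simp only [markLevel, h0, h0', if_false] at this ⊢
      rw [hs, hs, ← hfl]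
      exact this

/-- Only the radix point moves, down by one level. From level `0` of the upper half it enters the
lower half at depth `1`, so the type for depth `lo + 1` is recorded too. -/
theorem FiniteHalves.move_up {P : ℚ → ℤ → Prop} {N : ℕ} (h : FiniteHalves q P N) :
    FiniteHalves q (fun x m => P (q * x) (m + 1)) (2 * N * N) := by
  have hq : (q : ℚ) ≠ 0 := NeZero.ne _
  obtain ⟨T, _, τ, hc, hτ⟩ := h
  refine ⟨Bool × T × T, inferInstance, fun y lo lc => (decide (lo = 0), τ y lo lc, τ y (lo + 1) lc),
    ?_, ?_⟩
  · simp only [Fintype.card_prod, Fintype.card_bool]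
    have := Nat.mul_le_mul hc hc
    nlinarith
  · intro y lo lc y' lo' lc' hy hy' e
    simp only [Prod.mk.injEq, decide_eq_decide] at e
    obtain ⟨e0, e1, e2⟩ := e
    obtain ⟨g1, g2, g3⟩ := hτ _ _ _ _ _ _ hy hy' e1
    refine ⟨g1, g2, fun u s uo uc => ?_⟩
    have hsh : ∀ (x : ℚ) (o c : ℤ), Shifted q (fun x m => P (q * x) (m + 1)) x o c ↔
        Shifted q P x (o - 1) c := by
      intro x o c
      unfold Shifted
      rw [neg_sub, sub_eq_add_neg 1 o, zpow_add₀ hq, zpow_one, show c - (o - 1) = c - o + 1 by ring]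
      rw [mul_left_comm]
    rw [hsh, hsh]
    by_cases h0 : lo = 0
    · have h0' := e0.1 h0
      cases uo with
      | zero =>
        have := (hτ _ _ _ _ _ _ hy hy' e2).2.2 u s 0 uc
        simp only [markLevel, h0, h0', if_true, zero_add, one_ne_zero, if_false] at this ⊢
        simpa using this
      | succ uo =>
        have := g3 u s uo uc
        simp only [markLevel, h0, h0', if_true] at this ⊢
        simpa using this
    · have h0' := mt e0.2 h0
      have := (hτ _ _ _ _ _ _ hy hy' e2).2.2 u s uo uc
      have hl : ∀ lo : ℕ, -((lo + 1 : ℕ) : ℤ) = -(lo : ℤ) - 1 := fun lo => by push_cast; ring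
      simpa only [markLevel, h0, h0', if_false, Nat.add_eq_zero_iff, one_ne_zero, and_false, hl]
        using this

/-- The radix point moves up by one level. From depth `1` it leaves the lower half, so this depth
has to be distinguished from the larger ones. -/
theorem FiniteHalves.move_down {P : ℚ → ℤ → Prop} {N : ℕ} (h : FiniteHalves q P N) :
    FiniteHalves q (fun x m => P (x / q) (m - 1)) (4 * N * N) := by
  have hq : (q : ℚ) ≠ 0 := NeZero.ne _
  obtain ⟨T, _, τ, hc, hτ⟩ := h
  refine ⟨Bool × Bool × T × T, inferInstance, fun y lo lc => (decide (lo = 0), decide (lo = 1),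
    τ y lo lc, τ y (lo - 1) lc), ?_, ?_⟩
  · simp only [Fintype.card_prod, Fintype.card_bool]
    have := Nat.mul_le_mul hc hc
    nlinarith
  · intro y lo lc y' lo' lc' hy hy' e
    simp only [Prod.mk.injEq, decide_eq_decide] at e
    obtain ⟨e0, e00, e1, e2⟩ := e
    obtain ⟨g1, g2, g3⟩ := hτ _ _ _ _ _ _ hy hy' e1
    refine ⟨g1, g2, fun u s uo uc => ?_⟩
    have hsh : ∀ (x : ℚ) (o c : ℤ), Shifted q (fun x m => P (x / q) (m - 1)) x o c ↔
        Shifted q P x (o + 1) c := by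
      intro x o c
      unfold Shifted
      rw [neg_add, zpow_add₀ hq, zpow_neg_one, show c - (o + 1) = c - o - 1 by ring, ← mul_assoc,
        ← div_eq_mul_inv]
    rw [hsh, hsh]
    by_cases h0 : lo = 0
    · have h0' := e0.1 h0
      have := g3 u s (uo + 1) uc
      simp only [markLevel, h0, h0', if_true] at this ⊢
      simpa using this
    · have h0' := mt e0.2 h0
      by_cases h1 : lo = 1
      · have h1' := e00.1 h1
        have := (hτ _ _ _ _ _ _ hy hy' e2).2.2 u s 0 uc
        simp only [markLevel, h1, h1', if_true, one_ne_zero, if_false, Nat.sub_self] at this ⊢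
        simpa using this
      · have h1' := mt e00.2 h1
        have := (hτ _ _ _ _ _ _ hy hy' e2).2.2 u s uo uc
        have hl : ∀ lo : ℕ, lo ≠ 0 → -((lo - 1 : ℕ) : ℤ) = -(lo : ℤ) + 1 := fun lo h => by omega
        have h2 : lo - 1 ≠ 0 := by omega
        have h2' : lo' - 1 ≠ 0 := by omega
        simpa only [markLevel, h0, h0', h2, h2', if_false, hl lo h0, hl lo' h0'] using this

theorem FiniteHalves.leftPred {P : ℚ → ℤ → Prop} {N : ℕ} (h : FiniteHalves q P N) (x : BSLetter) :
    FiniteHalves q (leftPred q P x) (18 * N * N * N) := by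
  have hN : 1 ≤ N := by
    obtain ⟨T, _, τ, hc, -⟩ := h
    exact (Fintype.card_pos_iff.2 ⟨τ 0 0 0⟩).trans_le hc
  have h1 : 1 * (N * N) ≤ N * (N * N) := Nat.mul_le_mul_right _ hN
  rcases x with ⟨_ | _, _ | _⟩
  · show FiniteHalves q (fun x m => P (x - 1) m) _
    simpa [sgn, sub_eq_add_neg] using h.add_unit true
  · show FiniteHalves q (fun x m => P (x + 1) m) _
    simpa [sgn] using h.add_unit false
  · exact h.move_down.mono (by nlinarith)
  · exact h.move_up.mono (by nlinarith)

end

/-! ### Walks of automata on the levels -/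

/-- The change of the level that a letter causes. -/
def BSLetter.step : BSLetter → ℤ
  | (BSGen.a, _) => 0
  | (BSGen.t, true) => 1
  | (BSGen.t, false) => -1

/-- The contribution of a letter at level `0` to the number. -/
def BSLetter.unit : BSLetter → ℤ
  | (BSGen.a, true) => 1
  | (BSGen.a, false) => -1
  | (BSGen.t, _) => 0

/-- `Walk q A v v' x l`: a run of `A` between configurations (pairs of a level and a state) that
contributes `x` to the number; `l` lists the configurations that it leaves. -/
inductive Walk (q : ℕ) (A : FinAutomaton BSLetter) : ℤ × ℕ → ℤ × ℕ → ℚ → List (ℤ × ℕ) → Prop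
  | nil (v : ℤ × ℕ) : Walk q A v v 0 []
  | cons {i : ℤ} {p p' : ℕ} {e : BSLetter} {v : ℤ × ℕ} {x : ℚ} {l : List (ℤ × ℕ)} :
      (p, e, p') ∈ A.edges → Walk q A (i + BSLetter.step e, p') v x l →
        Walk q A (i, p) v (BSLetter.unit e * (q : ℚ) ^ i + x) ((i, p) :: l)

namespace Walk

variable {q : ℕ} {A : FinAutomaton BSLetter} {v v' v'' u : ℤ × ℕ} {x y z : ℚ}
  {l l' : List (ℤ × ℕ)}

theorem append (h : Walk q A v v' x l) (h' : Walk q A v' v'' y l') :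
    Walk q A v v'' (x + y) (l ++ l') := by
  induction h with
  | nil => simpa using h'
  | cons he _ ih =>
    rw [add_assoc]
    exact .cons he (ih h')

theorem head_eq (h : Walk q A v v' x (u :: l)) : u = v := by
  cases h
  rfl

theorem split {l₁ l₂ : List (ℤ × ℕ)} (h : Walk q A v v' x (l₁ ++ l₂)) :
    ∃ u y z, Walk q A v u y l₁ ∧ Walk q A u v' z l₂ ∧ x = y + z := by
  induction l₁ generalizing v x with
  | nil => exact ⟨v, 0, x, .nil _, h, by simp⟩
  | cons w l₁ ih =>
    cases h with
    | cons he h =>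
      obtain ⟨u, y, z, h1, h2, rfl⟩ := ih h
      exact ⟨u, _, z, .cons he h1, h2, by ring⟩

theorem split_at (h : Walk q A v v' x l) (hu : u ∈ v' :: l) :
    ∃ l₁ l₂ y z, Walk q A v u y l₁ ∧ Walk q A u v' z l₂ ∧ x = y + z ∧ l = l₁ ++ l₂ := by
  rcases List.mem_cons.1 hu with rfl | hu
  · exact ⟨l, [], x, 0, h, .nil _, by simp, by simp⟩
  · obtain ⟨l₁, l₂, rfl⟩ := List.append_of_mem hu
    obtain ⟨u', y, z, h1, h2, e⟩ := h.split
    obtain rfl := h2.head_eq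
    exact ⟨_, _, y, z, h1, h2, e, rfl⟩

theorem insert {l₀ : List (ℤ × ℕ)} (h : Walk q A v v' x l) (hu : u ∈ v' :: l)
    (h₀ : Walk q A u u z l₀) : ∃ l', Walk q A v v' (x + z) l' ∧ l ⊆ l' := by
  obtain ⟨l₁, l₂, y, w, h1, h2, rfl, rfl⟩ := h.split_at hu
  refine ⟨_, (by convert (h1.append h₀).append h2 using 1; ring), ?_⟩
  intro a ha
  simp only [List.mem_append] at ha ⊢
  tauto

/-- A closed walk can be rotated. -/
theorem rotate (h : Walk q A v v x l) (hu : u ∈ l) :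
    ∃ l', Walk q A u u x l' ∧ ∀ w ∈ l', w ∈ l := by
  obtain ⟨l₁, l₂, y, z, h1, h2, rfl, rfl⟩ := h.split_at (List.mem_cons_of_mem _ hu)
  refine ⟨_, (by convert h2.append h1 using 1; ring), ?_⟩
  intro a ha
  simp only [List.mem_append] at ha ⊢
  tauto

theorem nsmul (h : Walk q A v v x l) (n : ℕ) :
    ∃ l', Walk q A v v (n * x) l' ∧ ∀ w ∈ l', w ∈ l := by
  induction n with
  | zero => exact ⟨[], by simpa using .nil v, by simp⟩
  | succ n ih =>
    obtain ⟨l', h', hl⟩ := ih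
    refine ⟨_, (by convert h.append h' using 1; push_cast; ring), ?_⟩
    intro a ha
    rcases List.mem_append.1 ha with ha | ha
    exacts [ha, hl a ha]

theorem shift [NeZero q] (h : Walk q A v v' x l) (d : ℤ) :
    Walk q A (v.1 + d, v.2) (v'.1 + d, v'.2) (x * (q : ℚ) ^ d) (l.map fun u => (u.1 + d, u.2)) := by
  have hq : (q : ℚ) ≠ 0 := NeZero.ne _
  induction h with
  | nil => simpa using .nil _
  | @cons i p p' e v x l he _ ih =>
    rw [List.map_cons, add_mul, mul_assoc, ← zpow_add₀ hq]
    refine .cons he ?_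
    rw [add_right_comm]
    exact ih

/-- A walk that leaves only configurations at levels `≥ i` contributes a multiple of `q ^ i`. -/
theorem exists_int [NeZero q] (h : Walk q A v v' x l) {i : ℤ} (hi : ∀ u ∈ l, i ≤ u.1) :
    ∃ n : ℤ, x = n * (q : ℚ) ^ i := by
  have hq : (q : ℚ) ≠ 0 := NeZero.ne _
  induction h with
  | nil => exact ⟨0, by simp⟩
  | @cons j p p' e v x l he _ ih =>
    obtain ⟨n, rfl⟩ := ih fun u hu => hi u (List.mem_cons_of_mem _ hu)
    have := hi _ List.mem_cons_self
    obtain ⟨k, hk⟩ := Int.eq_ofNat_of_zero_le (sub_nonneg.2 this)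
    obtain rfl : j = k + i := by simp only at hk; omega
    refine ⟨BSLetter.unit e * q ^ k + n, ?_⟩
    rw [zpow_add₀ hq]
    push_cast
    rw [zpow_natCast]
    ring

theorem mem_edges (h : Walk q A v v' x l) (hu : u ∈ l) : u.2 ∈ A.edges.map Prod.fst := by
  induction h with
  | nil => simp at hu
  | @cons j p p' e v x l he _ ih =>
    rcases List.mem_cons.1 hu with rfl | hu
    · exact List.mem_map.2 ⟨_, he, rfl⟩
    · exact ih hu

end Walk

/-! ### Walks and the elements of rational subsets -/

namespace BaumslagSolitar

variable {q : ℕ} [q.AtLeastTwo] {A : FinAutomaton BSLetter}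

theorem toPointed_ofWord_cons (e : BSLetter) (w : List BSLetter) :
    (toPointed q (ofWord 1 q (e :: w))).num = BSLetter.unit e +
      (q : ℚ) ^ (BSLetter.step e) * (toPointed q (ofWord 1 q w)).num ∧
    (toPointed q (ofWord 1 q (e :: w))).pos = BSLetter.step e + (toPointed q (ofWord 1 q w)).pos := by
  have h : ofWord 1 q (e :: w) = ofWord 1 q [e] * ofWord 1 q w := by
    unfold ofWord
    rw [← map_mul, FreeGroup.mul_mk]
    rfl
  have h1 : (toPointed q (ofWord 1 q [e])).num = BSLetter.unit e ∧
      (toPointed q (ofWord 1 q [e])).pos = BSLetter.step e := by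
    have ha := toPointed_a_zpow (q := q)
    have ht := toPointed_t_zpow (q := q)
    rcases e with ⟨_ | _, _ | _⟩
    · have : ofWord 1 q [(BSGen.a, false)] = a q ^ (-1 : ℤ) := by rw [zpow_neg_one]; rfl
      rw [this, (ha _).1, (ha _).2]
      simp [BSLetter.unit, BSLetter.step]
    · have : ofWord 1 q [(BSGen.a, true)] = a q ^ (1 : ℤ) := by rw [zpow_one]; rfl
      rw [this, (ha _).1, (ha _).2]
      simp [BSLetter.unit, BSLetter.step]
    · have : ofWord 1 q [(BSGen.t, false)] = t q ^ (-1 : ℤ) := by rw [zpow_neg_one]; rfl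
      rw [this, (ht _).1, (ht _).2]
      simp [BSLetter.unit, BSLetter.step]
    · have : ofWord 1 q [(BSGen.t, true)] = t q ^ (1 : ℤ) := by rw [zpow_one]; rfl
      rw [this, (ht _).1, (ht _).2]
      simp [BSLetter.unit, BSLetter.step]
  rw [h, map_mul, PointedNum.mul_num, PointedNum.mul_pos, h1.1, h1.2]
  exact ⟨rfl, rfl⟩

theorem toPointed_ofWord_nil : toPointed q (ofWord 1 q []) = 1 := map_one (toPointed q)

theorem exists_walk_of_run {p p' : ℕ} {w : List BSLetter} (h : A.Run p w p') (i : ℤ) :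
    ∃ l, Walk q A (i, p) (i + (toPointed q (ofWord 1 q w)).pos, p')
      ((toPointed q (ofWord 1 q w)).num * (q : ℚ) ^ i) l := by
  have hq : (q : ℚ) ≠ 0 := NeZero.ne _
  induction h generalizing i with
  | nil p => exact ⟨[], by simpa [toPointed_ofWord_nil] using .nil _⟩
  | @cons p p' p'' e w he _ ih =>
    obtain ⟨l, hl⟩ := ih (i + BSLetter.step e)
    obtain ⟨h1, h2⟩ := toPointed_ofWord_cons (q := q) e w
    refine ⟨(i, p) :: l, ?_⟩
    rw [h1, h2]
    convert Walk.cons he hl using 1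
    · rw [add_assoc]
    · rw [zpow_add₀ hq]
      ring

theorem exists_run_of_walk {v v' : ℤ × ℕ} {x : ℚ} {l : List (ℤ × ℕ)} (h : Walk q A v v' x l) :
    ∃ w, A.Run v.2 w v'.2 ∧ v'.1 = v.1 + (toPointed q (ofWord 1 q w)).pos ∧
      x = (toPointed q (ofWord 1 q w)).num * (q : ℚ) ^ v.1 := by
  have hq : (q : ℚ) ≠ 0 := NeZero.ne _
  induction h with
  | nil => exact ⟨[], .nil _, by simp [toPointed_ofWord_nil], by simp [toPointed_ofWord_nil]⟩
  | @cons i p p' e v x l he _ ih =>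
    obtain ⟨w, h3, h4, rfl⟩ := ih
    obtain ⟨h1, h2⟩ := toPointed_ofWord_cons (q := q) e w
    refine ⟨e :: w, .cons he h3, ?_, ?_⟩
    · rw [h2, h4]
      ring
    · rw [h1, zpow_add₀ hq]
      ring

/-- The elements of a rational subset, in terms of walks. -/
theorem shifted_rationalSubset_iff (x : ℚ) (o c : ℤ) :
    Shifted q (memPred q (rationalSubset q A)) x o c ↔
      ∃ f ∈ A.final, ∃ l, Walk q A (o, A.init) (c, f) x l := by
  have hq : (q : ℚ) ≠ 0 := NeZero.ne _
  have hx : ∀ x : ℚ, x * (q : ℚ) ^ (-o) * (q : ℚ) ^ o = x := by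
    intro x
    rw [mul_assoc, ← zpow_add₀ hq, neg_add_cancel, zpow_zero, mul_one]
  constructor
  · rintro ⟨_, ⟨w, ⟨f, hf, hw⟩, rfl⟩, h1, h2⟩
    obtain ⟨l, hl⟩ := exists_walk_of_run (q := q) hw o
    rw [h1, h2, hx, add_sub_cancel] at hl
    exact ⟨f, hf, l, hl⟩
  · rintro ⟨f, hf, l, h⟩
    obtain ⟨w, h1, h2, h3⟩ := exists_run_of_walk h
    refine ⟨_, ⟨w, ⟨f, hf, h1⟩, rfl⟩, ?_, ?_⟩
    · rw [h3, mul_assoc, ← zpow_add₀ hq]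
      simp
    · simp only at h2
      omega

end BaumslagSolitar

/-! ### Thinning walks -/

/-- States `S b` that have closed runs with contribution `D` (`-D` if `b` is `true`), and that are
the lowest states of all closed walks with a positive (negative) contribution. -/
structure IsSlack (q : ℕ) (A : FinAutomaton BSLetter) (D : ℕ) (S : Bool → ℕ → Prop) : Prop where
  pos : 0 < D
  loop : ∀ b s, S b s → ∀ i : ℤ, ∃ l, Walk q A (i, s) (i, s) (sgn b * (D * (q : ℚ) ^ i)) l
  complete : ∀ b i s x l, Walk q A (i, s) (i, s) x l → (∀ u ∈ l, i ≤ u.1) → 0 < sgn b * x → S b s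

theorem exists_sgn_mul (w : ℤ) : ∃ b, w = sgn b * w.natAbs := by
  rcases le_total 0 w with h | h
  · exact ⟨false, by simp [sgn, abs_of_nonneg h]⟩
  · exact ⟨true, by simp [sgn, abs_of_nonpos h]⟩

namespace Walk

variable {q : ℕ} {A : FinAutomaton BSLetter} {v v' u : ℤ × ℕ} {x : ℚ}
  {l : List (ℤ × ℕ)}

theorem start_mem (h : Walk q A v v' x l) : v ∈ v' :: l := by
  cases h <;> simp

theorem exists_loops {n : ℕ} (h : Walk q A v v' x l) (hn : n + 1 ≤ l.count u) :
    ∃ (y z : ℚ) (L : List (ℚ × List (ℤ × ℕ))) (l₀ l₁ : List (ℤ × ℕ)),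
      Walk q A v u y l₀ ∧ Walk q A u v' z l₁ ∧ L.length = n ∧
      (∀ p ∈ L, p.2 ≠ [] ∧ Walk q A u u p.1 p.2) ∧ x = y + (L.map Prod.fst).sum + z ∧
      l = l₀ ++ (L.map Prod.snd).flatten ++ l₁ := by
  induction n generalizing v x l with
  | zero =>
    have hu : u ∈ l := List.count_pos_iff.1 (by omega)
    obtain ⟨l₁, l₂, y, z, h1, h2, h3, h4⟩ := h.split_at (List.mem_cons_of_mem _ hu)
    exact ⟨y, z, [], l₁, l₂, h1, h2, rfl, by simp, by simpa using h3, by simpa using h4⟩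
  | succ n ih =>
    have hu : u ∈ l := List.count_pos_iff.1 (by omega)
    obtain ⟨l₁, l₂, rfl, hl⟩ := List.eq_append_cons_of_mem hu
    obtain ⟨u', y, z, h1, h2, rfl⟩ := h.split
    obtain rfl := h2.head_eq
    rw [List.count_append, List.count_eq_zero_of_not_mem hl, List.count_cons_self] at hn
    cases h2 with
    | @cons i p p' e _ z _ he h2 =>
      obtain ⟨y', z', L, l₀, l₃, h3, h4, h5, h6, rfl, rfl⟩ := ih h2 (by omega)
      refine ⟨y, z', (BSLetter.unit e * (q : ℚ) ^ i + y', (i, p) :: l₀) :: L, l₁, l₃, h1, h4,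
        by simp [h5], ?_, ?_, ?_⟩
      · intro r hr
        rcases List.mem_cons.1 hr with rfl | hr
        · exact ⟨by simp, .cons he h3⟩
        · exact h6 r hr
      · simp only [List.map_cons, List.sum_cons]
        ring
      · simp

theorem of_loops {L : List (ℚ × List (ℤ × ℕ))} (h : ∀ p ∈ L, p.2 ≠ [] ∧ Walk q A u u p.1 p.2) :
    Walk q A u u (L.map Prod.fst).sum (L.map Prod.snd).flatten := by
  induction L with
  | nil => exact .nil _
  | cons p L ih =>
    simp only [List.map_cons, List.sum_cons, List.flatten_cons]
    exact (h p List.mem_cons_self).2.append (ih fun r hr => h r (List.mem_cons_of_mem _ hr))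

end Walk

namespace IsSlack

variable {q : ℕ} [q.AtLeastTwo] {A : FinAutomaton BSLetter} {D : ℕ} {S : Bool → ℕ → Prop}
  {v v' u : ℤ × ℕ} {x : ℚ} {l : List (ℤ × ℕ)}

/-- The visits to `u` delimit `D` loops. Let `i` be the lowest level of the loops; the `D + 1`
partial sums are integer multiples of `q ^ i`, and two of them agree modulo `D`, so the block
between them contributes `D w q ^ i` and can be deleted. If `w ≠ 0`, a state `s` at level `i` is a
slack state for the sign of `w`: all loops together with many copies of the block form a closed walk
of that sign, which can be rotated to start at `(i, s)`. -/
theorem exists_shorter (hS : IsSlack q A D S) (h : Walk q A v v' x l) (hu : D + 1 ≤ l.count u) :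
    ∃ x' l', Walk q A v v' x' l' ∧ l'.length < l.length ∧ l' ⊆ l ∧ ∃ (b : Bool) (k : ℕ) (i : ℤ),
      x = x' + sgn b * (D * k * (q : ℚ) ^ i) ∧ (k ≠ 0 → ∃ s, S b s ∧ (i, s) ∈ l) := by
  have hq2 := PointedNum.two_le q
  have hq0 : (0 : ℚ) < q := by positivity
  have hD := hS.pos
  obtain ⟨y, z, L, l₀, l₁, h0, h1, hL, hloop, rfl, rfl⟩ := h.exists_loops hu
  have hne : (L.map Prod.snd).flatten ≠ [] := by
    cases L with
    | nil => simp at hL; omega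
    | cons p L =>
      have := (hloop p List.mem_cons_self).1
      simp [this]
  obtain ⟨⟨i, s⟩, hmem, hmin⟩ := Finset.exists_min_image (L.map Prod.snd).flatten.toFinset
    (fun u => u.1) (by simpa using hne)
  rw [List.mem_toFinset] at hmem
  have hmin' : ∀ u ∈ (L.map Prod.snd).flatten, i ≤ u.1 := fun u hu => hmin u (by simpa using hu)
  have hpre : ∀ k, ∃ n : ℤ, ((L.take k).map Prod.fst).sum = n * (q : ℚ) ^ i := by
    intro k
    refine (Walk.of_loops fun p hp => hloop p (List.mem_of_mem_take hp)).exists_int fun u hu => ?_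
    refine hmin' u ?_
    rw [← List.take_append_drop k L]
    simp only [List.map_append, List.flatten_append, List.mem_append]
    exact Or.inl hu
  choose n hn using hpre
  obtain ⟨a, ha, c, hc, hac, he⟩ := Finset.exists_ne_map_eq_of_card_lt_of_maps_to
    (s := Finset.range (D + 1)) (t := Finset.Ico (0 : ℤ) D) (f := fun k => n k % D) (by simp)
    (fun k _ => by
      simp only [Finset.coe_Ico, Set.mem_Ico]
      exact ⟨Int.emod_nonneg _ (by omega), Int.emod_lt_of_pos _ (by omega)⟩)
  wlog hlt : a < c generalizing a c
  · exact this c hc a ha hac.symm he.symm (by omega)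
  simp only [Finset.mem_range] at ha hc
  set L₁ := L.take a with hL₁
  set L₂ := (L.take c).drop a with hL₂
  set L₃ := L.drop c with hL₃
  have h12 : L.take c = L₁ ++ L₂ := by
    rw [← List.take_append_drop a (L.take c), List.take_take, min_eq_left hlt.le]
  have h123 : L = L₁ ++ L₂ ++ L₃ := by rw [← h12, List.take_append_drop]
  obtain ⟨w, hw⟩ : (D : ℤ) ∣ n c - n a := Int.ModEq.dvd he
  have hw2 : (L₂.map Prod.fst).sum = D * w * (q : ℚ) ^ i := by
    have e1 := hn c
    rw [h12, List.map_append, List.sum_append, hn a] at e1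
    have e2 : (n c : ℚ) - n a = D * w := by exact_mod_cast hw
    rw [← e2]
    linarith
  have hl1 : ∀ p ∈ L₁, p.2 ≠ [] ∧ Walk q A u u p.1 p.2 := fun p hp => hloop p (by
    rw [h123]; simp [hp])
  have hl2 : ∀ p ∈ L₂, p.2 ≠ [] ∧ Walk q A u u p.1 p.2 := fun p hp => hloop p (by
    rw [h123]; simp [hp])
  have hl3 : ∀ p ∈ L₃, p.2 ≠ [] ∧ Walk q A u u p.1 p.2 := fun p hp => hloop p (by
    rw [h123]; simp [hp])
  have hL2ne : L₂ ≠ [] := by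
    intro h
    have := congrArg List.length h
    simp [hL₂] at this
    omega
  have hF2 : (L₂.map Prod.snd).flatten ≠ [] := by
    cases hh : L₂ with
    | nil => exact absurd hh hL2ne
    | cons p L =>
      have := (hl2 p (by rw [hh]; exact List.mem_cons_self)).1
      simp [this]
  obtain ⟨b, hb⟩ := exists_sgn_mul w
  refine ⟨_, _, (h0.append (Walk.of_loops hl1)).append ((Walk.of_loops hl3).append h1), ?_, ?_,
    b, w.natAbs, i, ?_, ?_⟩
  · have := List.length_pos_iff.2 hF2
    rw [h123]
    simp only [List.map_append, List.flatten_append, List.length_append]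
    omega
  · rw [h123]
    intro p hp
    simp only [List.map_append, List.flatten_append, List.mem_append] at hp ⊢
    tauto
  · have : (w : ℚ) = sgn b * (w.natAbs : ℕ) := by
      conv_lhs => rw [hb]
      rw [Int.cast_mul, Int.cast_natCast]
    rw [h123]
    simp only [List.map_append, List.sum_append, hw2]
    conv_lhs => rw [this]
    ring
  · intro hk
    refine ⟨s, ?_, by simp [hmem]⟩
    have hC := Walk.of_loops hloop
    obtain ⟨N, hN⟩ := hC.exists_int hmin'
    -- As `|D w| ≥ 1`, this many copies of the block outweigh the contribution `N q ^ i` of all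
    -- loops.
    obtain ⟨l', h2', hl'⟩ := (Walk.of_loops hl2).nsmul (N.natAbs + 1)
    have hrot := hC.append h2'
    obtain ⟨l'', h'', hl''⟩ := hrot.rotate (u := (i, s)) (List.mem_append_left _ hmem)
    refine hS.complete b i s _ _ h'' ?_ ?_
    · intro u hu
      refine hmin' u ?_
      rcases List.mem_append.1 (hl'' u hu) with hu | hu
      · exact hu
      · have := hl' u hu
        rw [h123]
        simp only [List.map_append, List.flatten_append, List.mem_append]
        tauto
    · rw [hN, hw2]
      have hqi : (0 : ℚ) < (q : ℚ) ^ i := by positivity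
      have key : 0 < sgn b * (N + ((N.natAbs + 1 : ℕ) : ℤ) * (D * w)) := by
        have h3 : sgn b * (N + ((N.natAbs + 1 : ℕ) : ℤ) * (D * w)) =
            sgn b * N + (N.natAbs + 1 : ℤ) * (D * w.natAbs) := by
          have h4 : (sgn b : ℤ) * sgn b = 1 := by cases b <;> simp [sgn]
          conv_lhs => rw [hb]
          push_cast
          linear_combination ((|N| + 1 : ℤ) * (D * |w|)) * h4
        have h5 : (1 : ℤ) ≤ D * w.natAbs := by
          have : 0 < D * w.natAbs := Nat.mul_pos hD (by omega)
          exact_mod_cast this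
        have h6 : -(N.natAbs : ℤ) ≤ sgn b * N := by
          cases b <;> simp only [sgn, if_true, Bool.false_eq_true, if_false] <;> omega
        rw [h3]
        nlinarith
      have key' : (0 : ℚ) < sgn b * (N + ((N.natAbs + 1 : ℕ) : ℚ) * (D * w)) := by
        have := (Int.cast_pos (R := ℚ)).2 key
        rwa [Int.cast_mul, Int.cast_add, Int.cast_mul, Int.cast_mul, Int.cast_natCast,
          Int.cast_natCast] at this
      calc (0 : ℚ) < (sgn b * (N + ((N.natAbs + 1 : ℕ) : ℚ) * (D * w))) * (q : ℚ) ^ i :=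
            mul_pos key' hqi
        _ = _ := by ring

/-- Deletion is iterated. An amount deleted at a level `i ≥ I b` is a multiple of `D q ^ (I b)`, so
all slack of one sign is gathered at the single level `I b`. -/
theorem exists_thin (hS : IsSlack q A D S) (I : Bool → ℤ) (h : Walk q A v v' x l)
    (hI : ∀ b s i, S b s → (i, s) ∈ l → I b ≤ i) :
    ∃ (x' : ℚ) (l' : List (ℤ × ℕ)) (k : Bool → ℕ), Walk q A v v' x' l' ∧ (∀ u, l'.count u ≤ D) ∧
      l' ⊆ l ∧ x = x' + ∑ b, sgn b * (D * k b * (q : ℚ) ^ (I b)) ∧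
      ∀ b, k b ≠ 0 → ∃ s i, S b s ∧ (i, s) ∈ l := by
  have hq : (q : ℚ) ≠ 0 := NeZero.ne _
  induction hl : l.length using Nat.strong_induction_on generalizing x l with
  | _ n ih =>
    by_cases hu : ∃ u, D + 1 ≤ l.count u
    · obtain ⟨u, hu⟩ := hu
      obtain ⟨x', l', h', hlen, hsub, b, k, i, rfl, hk⟩ := hS.exists_shorter h hu
      obtain ⟨x'', l'', k', h1, h2, h3, rfl, h5⟩ := ih _ (hl ▸ hlen) h'
        (fun b s i hb hi => hI b s i hb (hsub hi)) rfl
      by_cases hk0 : k = 0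
      · refine ⟨x'', l'', k', h1, h2, fun _ hu => hsub (h3 hu), by simp [hk0], fun b hb => ?_⟩
        obtain ⟨s, i, hs, hi⟩ := h5 b hb
        exact ⟨s, i, hs, hsub hi⟩
      · obtain ⟨s, hs, hi⟩ := hk hk0
        obtain ⟨j, hj⟩ := Int.eq_ofNat_of_zero_le (sub_nonneg.2 (hI b s i hs hi))
        obtain rfl : i = j + I b := by omega
        refine ⟨x'', l'', Function.update k' b (k' b + k * q ^ j), h1, h2, fun _ hu => hsub (h3 hu), ?_, ?_⟩
        · rw [zpow_add₀ hq, zpow_natCast]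
          cases b <;> simp [Function.update_apply] <;> ring
        · intro c hc
          by_cases hcb : c = b
          · subst hcb
            exact ⟨s, _, hs, hi⟩
          · rw [Function.update_of_ne hcb] at hc
            obtain ⟨s, i, hs, hi⟩ := h5 c hc
            exact ⟨s, i, hs, hsub hi⟩
    · push Not at hu
      exact ⟨x, l, fun _ => 0, h, fun u => Nat.lt_succ_iff.1 (hu u), fun _ h => h, by simp,
        fun b hb => absurd rfl hb⟩

/-- The configurations where slack will be inserted must survive the thinning. So the walk is split
at them and the at most `M.length + 1` pieces are thinned separately, which preserves their ends. -/
theorem exists_thin_marks (hS : IsSlack q A D S) (I : Bool → ℤ) (M : List (ℤ × ℕ))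
    (h : Walk q A v v' x l) (hM : ∀ m ∈ M, m ∈ v' :: l)
    (hI : ∀ b s i, S b s → (i, s) ∈ l → I b ≤ i) :
    ∃ (x' : ℚ) (l' : List (ℤ × ℕ)) (k : Bool → ℕ), Walk q A v v' x' l' ∧
      (∀ u, l'.count u ≤ (M.length + 1) * D) ∧ (∀ m ∈ M, m ∈ v' :: l') ∧
      x = x' + ∑ b, sgn b * (D * k b * (q : ℚ) ^ (I b)) ∧
      ∀ b, k b ≠ 0 → ∃ s i, S b s ∧ (i, s) ∈ l := by
  induction hn : M.length using Nat.strong_induction_on generalizing x l M v v' with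
  | _ n ih =>
    cases M with
    | nil =>
      obtain ⟨x', l', k, h1, h2, h3, h4, h5⟩ := hS.exists_thin I h hI
      refine ⟨x', l', k, h1, fun u => (h2 u).trans ?_, by simp, h4, h5⟩
      exact Nat.le_mul_of_pos_left _ (by omega)
    | cons m M =>
      obtain ⟨l₁, l₂, y, z, h1, h2, rfl, rfl⟩ := h.split_at (hM m List.mem_cons_self)
      have hl1 := List.length_filter_le (fun u => decide (u ∈ l₁)) M
      have hl := List.length_eq_length_filter_add (l := M) (fun u => decide (u ∈ l₁))
      simp only [List.length_cons] at hn
      obtain ⟨x₁, m₁, k₁, g1, g2, g3, g4, g5⟩ := ih (M.filter (fun u => decide (u ∈ l₁))).length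
        (by omega) _ h1 (fun u hu => List.mem_cons_of_mem _ (by simpa using (List.mem_filter.1 hu).2))
        (fun b s i hb hi => hI b s i hb (List.mem_append_left _ hi)) rfl
      obtain ⟨x₂, m₂, k₂, f1, f2, f3, f4, f5⟩ := ih (M.filter (fun u => !decide (u ∈ l₁))).length
        (by omega) _ h2 (fun u hu => by
          have h3 := List.mem_filter.1 hu
          have h4 := hM u (List.mem_cons_of_mem _ h3.1)
          have h5 : u ∉ l₁ := by simpa using h3.2
          simp only [List.mem_cons, List.mem_append] at h4 ⊢
          tauto)
        (fun b s i hb hi => hI b s i hb (List.mem_append_right _ hi)) rfl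
      have hm : m ∈ v' :: m₂ := f1.start_mem
      refine ⟨x₁ + x₂, m₁ ++ m₂, fun b => k₁ b + k₂ b, g1.append f1, ?_, ?_, ?_, ?_⟩
      · intro u
        rw [List.count_append]
        calc _ ≤ _ := Nat.add_le_add (g2 u) (f2 u)
          _ = (n + 1) * D := by rw [← add_mul]; congr 1; omega
      · intro u hu
        have hmm : m ∈ v' :: (m₁ ++ m₂) := by
          simp only [List.mem_cons, List.mem_append] at hm ⊢
          tauto
        rcases List.mem_cons.1 hu with rfl | hu
        · exact hmm
        · by_cases hul : u ∈ l₁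
          · have := g3 u (List.mem_filter.2 ⟨hu, by simpa using hul⟩)
            rcases List.mem_cons.1 this with rfl | this
            · exact hmm
            · simp [this]
          · have := f3 u (List.mem_filter.2 ⟨hu, by simpa using hul⟩)
            simp only [List.mem_cons, List.mem_append] at this ⊢
            tauto
      · rw [g4, f4]
        push_cast
        simp only [Fintype.sum_bool]
        ring
      · intro b hb
        simp only at hb
        by_cases hb1 : k₁ b = 0
        · obtain ⟨s, i, hs, hi⟩ := f5 b (by omega)
          exact ⟨s, i, hs, List.mem_append_right _ hi⟩
        · obtain ⟨s, i, hs, hi⟩ := g5 b hb1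
          exact ⟨s, i, hs, List.mem_append_left _ hi⟩

/-- Every walk can be thinned, up to a slack that can be inserted into the thin walk. -/
theorem exists_thin_slack (hS : IsSlack q A D S) (h : Walk q A v v' x l) :
    ∃ (x' : ℚ) (l' : List (ℤ × ℕ)) (k : Bool → ℕ) (w : Bool → ℤ × ℕ), Walk q A v v' x' l' ∧
      (∀ u, l'.count u ≤ 3 * D) ∧ x = x' + ∑ b, sgn b * (D * k b * (q : ℚ) ^ (w b).1) ∧
      ∀ b, k b ≠ 0 → S b (w b).2 ∧ w b ∈ v' :: l' := by
  classical
  -- `w b` is a lowest slack configuration for the sign `b`; if there is none, the start of the walk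
  -- serves as a dummy.
  have hw : ∀ b, ∃ w ∈ v' :: l, (∀ s i, S b s → (i, s) ∈ l → w.1 ≤ i) ∧
      ((∃ s i, S b s ∧ (i, s) ∈ l) → S b w.2) := by
    intro b
    by_cases hb : ∃ s i, S b s ∧ (i, s) ∈ l
    · obtain ⟨w, hw, hmin⟩ := Finset.exists_min_image (l.toFinset.filter fun u => S b u.2)
        (fun u => u.1) (by
          obtain ⟨s, i, hs, hi⟩ := hb
          exact ⟨(i, s), by simp [hs, hi]⟩)
      simp only [Finset.mem_filter, List.mem_toFinset] at hw hmin
      exact ⟨w, by simp [hw.1], fun s i hs hi => hmin (i, s) ⟨hi, hs⟩, fun _ => hw.2⟩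
    · push Not at hb
      exact ⟨v, h.start_mem, fun s i hs hi => absurd hi (hb s i hs), fun ⟨s, i, hs, hi⟩ =>
        absurd hi (hb s i hs)⟩
  choose w hw1 hw2 hw3 using hw
  -- Protecting one configuration for each sign gives at most three pieces, hence the multiplicity
  -- `3 * D`.
  obtain ⟨x', l', k, h1, h2, h3, h4, h5⟩ := hS.exists_thin_marks (fun b => (w b).1)
    [w true, w false] h (fun m hm => by
      rcases List.mem_pair.1 hm with rfl | rfl <;> exact hw1 _) hw2
  refine ⟨x', l', k, w, h1, h2, h4, fun b hb => ⟨hw3 b (h5 b hb), h3 _ ?_⟩⟩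
  cases b <;> simp

end IsSlack

/-! ### Cutting walks at level zero -/

/-- The configuration of a port of a lower half: a state at level `-1`, or at the level `-d` of a
mark. -/
def portAt (d : ℕ) (e : ℕ × Bool) : ℤ × ℕ := (if e.2 then -d else -1, e.1)

/-- `LowReal q A lo lc π x m`: the pairs of ports in `π` are connected by walks that contribute `x`
in total and visit the configurations in `m`. -/
inductive LowReal (q : ℕ) (A : FinAutomaton BSLetter) (lo lc : ℕ) :
    List ((ℕ × Bool) × (ℕ × Bool)) → ℚ → List (ℤ × ℕ) → Prop
  | nil : LowReal q A lo lc [] 0 []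
  | cons {e e' : ℕ × Bool} {x y : ℚ} {l m : List (ℤ × ℕ)} {π : List ((ℕ × Bool) × (ℕ × Bool))} :
      Walk q A (portAt lo e) (portAt lc e') x l → LowReal q A lo lc π y m →
        LowReal q A lo lc ((e, e') :: π) (x + y) (portAt lc e' :: l ++ m)

theorem LowReal.insert {q : ℕ} {A : FinAutomaton BSLetter} {lo lc : ℕ}
    {π : List ((ℕ × Bool) × (ℕ × Bool))} {x z : ℚ} {m l₀ : List (ℤ × ℕ)} {u : ℤ × ℕ}
    (h : LowReal q A lo lc π x m) (hu : u ∈ m) (h₀ : Walk q A u u z l₀) :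
    ∃ m', LowReal q A lo lc π (x + z) m' ∧ m ⊆ m' := by
  induction h with
  | nil => simp at hu
  | cons h1 h2 ih =>
    rcases List.mem_append.1 hu with hu | hu
    · obtain ⟨l', h', hl⟩ := h1.insert hu h₀
      refine ⟨_, (by convert LowReal.cons h' h2 using 1; ring), ?_⟩
      intro a ha
      simp only [List.mem_append, List.mem_cons] at ha ⊢
      have := @hl a
      tauto
    · obtain ⟨m', h', hm⟩ := ih hu
      refine ⟨_, (by convert LowReal.cons h1 h' using 1; ring), ?_⟩
      intro a ha
      simp only [List.mem_append, List.mem_cons] at ha ⊢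
      have := @hm a
      tauto

theorem List.forall_mem_cons_cons {α : Type*} {P : α → Prop} {v w : α} {l : List α} :
    (∀ u ∈ v :: w :: l, P u) ↔ P w ∧ ∀ u ∈ v :: l, P u := by
  simp only [List.forall_mem_cons]
  tauto

theorem List.mem_cons_append_cons {α : Type*} {u v w : α} {l l' : List α} (h : u ∈ v :: l) :
    u ∈ v :: (l' ++ w :: l) := by
  simp only [List.mem_cons, List.mem_append] at h ⊢
  tauto

/-- The number of configurations at level `-1` in a list. -/
def crossings (l : List (ℤ × ℕ)) : ℕ := (l.filter fun u => u.1 = -1).length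

/-- The weight of the configurations at negative levels in a list. -/
def lowWeight (q : ℕ) (l : List (ℤ × ℕ)) : ℚ :=
  ((l.filter fun u => u.1 < 0).map fun u => (q : ℚ) ^ u.1).sum

theorem markLevel_of_nonneg {lc uc : ℕ} (h : 0 ≤ markLevel lc uc) : lc = 0 := by
  unfold markLevel at h
  split_ifs at h <;> omega

theorem markLevel_of_neg {lc uc : ℕ} (h : markLevel lc uc < 0) : lc ≠ 0 := by
  rintro rfl
  simp [markLevel] at h
  omega

theorem markLevel_ne {lc : ℕ} (h : lc ≠ 0) (uc : ℕ) : markLevel lc uc = -lc := if_neg h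

theorem BSLetter.step_cases (e : BSLetter) :
    (BSLetter.step e = 0) ∨ (BSLetter.step e = 1 ∧ BSLetter.unit e = 0) ∨
      (BSLetter.step e = -1 ∧ BSLetter.unit e = 0) := by
  rcases e with ⟨_ | _, _ | _⟩ <;> simp [BSLetter.step, BSLetter.unit]

theorem BSLetter.abs_unit_le (e : BSLetter) : |(BSLetter.unit e : ℚ)| ≤ 1 := by
  rcases e with ⟨_ | _, _ | _⟩ <;> simp [BSLetter.unit]

theorem lowWeight_cons_nonneg {q : ℕ} {u : ℤ × ℕ} {l : List (ℤ × ℕ)} (h : 0 ≤ u.1) :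
    lowWeight q (u :: l) = lowWeight q l := by
  simp [lowWeight, h]

theorem lowWeight_cons_neg {q : ℕ} {u : ℤ × ℕ} {l : List (ℤ × ℕ)} (h : u.1 < 0) :
    lowWeight q (u :: l) = (q : ℚ) ^ u.1 + lowWeight q l := by
  simp [lowWeight, h]

theorem crossings_le_cons {u : ℤ × ℕ} {l : List (ℤ × ℕ)} : crossings l ≤ crossings (u :: l) := by
  unfold crossings
  rw [List.filter_cons]
  split_ifs <;> simp

theorem crossings_cons_of {u : ℤ × ℕ} {l : List (ℤ × ℕ)} (h : u.1 = -1) :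
    crossings (u :: l) = crossings l + 1 := by
  simp [crossings, h]

section

variable {q : ℕ} [q.AtLeastTwo] {A : FinAutomaton BSLetter}

/-- Cutting a walk at level `0`. The lower parts may be replaced by any other lower parts between
the same ports. -/
theorem Walk.cut {lc uc f : ℕ} {v v' : ℤ × ℕ} {x : ℚ} {l : List (ℤ × ℕ)} {St : List ℕ}
    (hSt : ∀ e ∈ A.edges, e.1 ∈ St ∧ e.2.2 ∈ St) (hf : f ∈ St) (h : Walk q A v v' x l)
    (hv : v' = (markLevel lc uc, f)) (lo : ℕ) :
    (0 ≤ v.1 → ∃ (π : List ((ℕ × Bool) × (ℕ × Bool))) (n : ℤ) (xl : ℚ) (m : List (ℤ × ℕ)),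
      LowReal q A lo lc π xl m ∧ x = n + xl ∧ |xl| ≤ lowWeight q l ∧ π.length ≤ crossings l + 1 ∧
      (∀ p ∈ π, p.1.1 ∈ St ∧ p.2.1 ∈ St) ∧ (∀ u ∈ v' :: l, u.1 < 0 → u ∈ m) ∧
      ∀ lo' lc', (lc = 0 ↔ lc' = 0) → ∀ y m', LowReal q A lo' lc' π y m' →
        ∃ l', Walk q A v (markLevel lc' uc, f) (n + y) l' ∧
          ∀ u ∈ v' :: l, 0 ≤ u.1 → u ∈ (markLevel lc' uc, f) :: l') ∧
    (v.1 < 0 → ∃ (e' : ℕ × Bool) (π : List ((ℕ × Bool) × (ℕ × Bool))) (n : ℤ) (x₀ xl : ℚ)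
      (l₀ m : List (ℤ × ℕ)), Walk q A v (portAt lc e') x₀ l₀ ∧ LowReal q A lo lc π xl m ∧
      x = n + x₀ + xl ∧ |x₀ + xl| ≤ lowWeight q l ∧ π.length ≤ crossings l ∧ e'.1 ∈ St ∧
      (∀ p ∈ π, p.1.1 ∈ St ∧ p.2.1 ∈ St) ∧
      (∀ u ∈ v' :: l, u.1 < 0 → u ∈ portAt lc e' :: l₀ ++ m) ∧
      ∀ lo' lc', (lc = 0 ↔ lc' = 0) → ∀ v₁ x₁ l₁ y m', Walk q A v₁ (portAt lc' e') x₁ l₁ →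
        LowReal q A lo' lc' π y m' → ∃ l', Walk q A v₁ (markLevel lc' uc, f) (n + x₁ + y) l' ∧
          ∀ u ∈ v' :: l, 0 ≤ u.1 → u ∈ (markLevel lc' uc, f) :: l') := by
  have hq2 := PointedNum.two_le q
  have hq0 : (0 : ℚ) < q := by positivity
  -- Of the two statements, the second is for a walk that starts in the lower half, where the piece
  -- up to the first port `e'` is still open and may be replaced by a walk from any `v₁`.
  -- Replacement pieces need not stay at negative levels: only their ports matter for gluing.
  induction h with
  | nil v =>
    subst hv
    constructor
    · intro h0
      have hlc := markLevel_of_nonneg h0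
      refine ⟨[], 0, 0, [], .nil, by simp, by simp [lowWeight], by simp, by simp, ?_, ?_⟩
      · intro u hu hneg
        obtain rfl := List.mem_singleton.1 hu
        simp only at hneg h0
        omega
      · intro lo' lc' hl y m' hy
        cases hy
        obtain rfl : lc' = 0 := hl.1 hlc
        subst hlc
        exact ⟨[], by simpa using .nil _, fun u hu _ => hu⟩
    · intro h0
      have hlc := markLevel_of_neg h0
      -- The walk ends at a cursor in the lower half, so the open piece ends at the cursor's port.
      refine ⟨(f, true), [], 0, 0, 0, [], [], ?_, .nil, by simp, by simp [lowWeight], by simp, hf,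
        by simp, ?_, ?_⟩
      · rw [markLevel_ne hlc]
        exact .nil _
      · intro u hu _
        obtain rfl := List.mem_singleton.1 hu
        rw [markLevel_ne hlc]
        simp [portAt]
      · intro lo' lc' hl v₁ x₁ l₁ y m' h1 hy
        cases hy
        have hlc' : lc' ≠ 0 := mt hl.2 hlc
        refine ⟨l₁, ?_, ?_⟩
        · rw [markLevel_ne hlc']
          simpa [portAt] using h1
        · intro u hu hpos
          obtain rfl := List.mem_singleton.1 hu
          simp only at hpos h0
          omega
  | @cons i p p' e v x l he hw ih =>
    obtain ⟨ih1, ih2⟩ := ih hv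
    have hstep := BSLetter.step_cases e
    have hpSt := hSt _ he
    constructor
    · intro (h0 : 0 ≤ i)
      rw [lowWeight_cons_nonneg h0]
      by_cases hs : 0 ≤ i + BSLetter.step e
      · obtain ⟨π, n, xl, m, g1, rfl, g3, g4, g5, g6, g7⟩ := ih1 hs
        obtain ⟨k, rfl⟩ := Int.eq_ofNat_of_zero_le h0
        refine ⟨π, BSLetter.unit e * q ^ k + n, xl, m, g1,
          by rw [zpow_natCast]; push_cast; ring, g3,
          g4.trans (Nat.succ_le_succ crossings_le_cons), g5, ?_, ?_⟩
        · exact List.forall_mem_cons_cons.2 ⟨fun hneg => absurd hneg (not_lt.2 h0), g6⟩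
        · intro lo' lc' hl y m' hy
          obtain ⟨l', h', hl'⟩ := g7 lo' lc' hl y m' hy
          refine ⟨(k, p) :: l', ?_, ?_⟩
          · convert Walk.cons he h' using 1
            rw [zpow_natCast]
            push_cast
            ring
          · exact List.forall_mem_cons_cons.2 ⟨fun _ => by simp, fun u hu hpos =>
              List.mem_cons_append_cons (l' := []) (hl' u hu hpos)⟩
      -- A descent from level `0` to `-1` completes the open piece to a pair of ports that begins at
      -- `(p', false)`.
      · obtain ⟨rfl, hst, hun⟩ : i = 0 ∧ BSLetter.step e = -1 ∧ BSLetter.unit e = 0 := by omega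
        obtain ⟨e', π, n, x₀, xl, l₀, m, g0, g1, rfl, g3, g4, g5, g6, g7, g8⟩ := ih2 (by simpa using hs)
        rw [hst, zero_add] at g0
        refine ⟨((p', false), e') :: π, n, x₀ + xl, _, .cons (by simpa [portAt] using g0) g1,
          by rw [hun]; push_cast; ring, g3, ?_, ?_, ?_, ?_⟩
        · simpa using g4.trans crossings_le_cons
        · intro r hr
          rcases List.mem_cons.1 hr with rfl | hr
          · exact ⟨hpSt.2, g5⟩
          · exact g6 r hr
        · exact List.forall_mem_cons_cons.2 ⟨fun hneg => absurd hneg (lt_irrefl _), g7⟩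
        · intro lo' lc' hl y m' hy
          cases hy with
          | @cons _ _ x₁ y l₁ m' _ k1 k2 =>
            obtain ⟨l', h', hl'⟩ := g8 lo' lc' hl _ _ _ _ _ k1 k2
            refine ⟨(0, p) :: l', ?_, ?_⟩
            · have h'' : Walk q A (0 + BSLetter.step e, p') (markLevel lc' uc, f) (n + x₁ + y) l' := by
                rw [hst]
                simpa [portAt] using h'
              convert Walk.cons he h'' using 1
              rw [hun]
              push_cast
              ring
            · exact List.forall_mem_cons_cons.2 ⟨fun _ => by simp, fun u hu hpos =>
                List.mem_cons_append_cons (l' := []) (hl' u hu hpos)⟩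
    · intro (h0 : i < 0)
      rw [lowWeight_cons_neg h0]
      have hqi : (0 : ℚ) < (q : ℚ) ^ i := by positivity
      by_cases hs : 0 ≤ i + BSLetter.step e
      -- An ascent from `-1` to `0` ends a piece. It leaves a configuration at level `-1`, which
      -- pays for the additional crossing.
      · obtain ⟨rfl, hst, hun⟩ : i = -1 ∧ BSLetter.step e = 1 ∧ BSLetter.unit e = 0 := by omega
        obtain ⟨π, n, xl, m, g1, rfl, g3, g4, g5, g6, g7⟩ := ih1 hs
        refine ⟨(p, false), π, n, 0, xl, [], m, ?_, g1, by rw [hun]; push_cast; ring, ?_, ?_, hpSt.1,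
          g5, ?_, ?_⟩
        · exact .nil _
        · rw [zero_add]
          exact g3.trans (le_add_of_nonneg_left hqi.le)
        · rwa [crossings_cons_of rfl]
        · exact List.forall_mem_cons_cons.2 ⟨fun _ => by simp [portAt], fun u hu hneg =>
            List.mem_append_right _ (g6 u hu hneg)⟩
        · intro lo' lc' hl v₁ x₁ l₁ y m' k1 k2
          obtain ⟨l', h', hl'⟩ := g7 lo' lc' hl y m' k2
          refine ⟨l₁ ++ (-1, p) :: l', ?_, ?_⟩
          · have hval : (n : ℚ) + x₁ + y = x₁ + (BSLetter.unit e * (q : ℚ) ^ (-1 : ℤ) + (n + y)) := by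
              rw [hun]
              push_cast
              ring
            rw [hval]
            exact k1.append (Walk.cons he h')
          · exact List.forall_mem_cons_cons.2 ⟨fun _ => by simp, fun u hu hpos =>
              List.mem_cons_append_cons (hl' u hu hpos)⟩
      · obtain ⟨e', π, n, x₀, xl, l₀, m, g0, g1, rfl, g3, g4, g5, g6, g7, g8⟩ := ih2 (by simpa using hs)
        refine ⟨e', π, n, _, xl, _, m, .cons he g0, g1, by ring, ?_, g4.trans crossings_le_cons, g5,
          g6, ?_, ?_⟩
        · rw [add_assoc]
          refine (abs_add_le _ _).trans (add_le_add ?_ g3)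
          rw [abs_mul, abs_of_pos hqi]
          exact mul_le_of_le_one_left hqi.le e.abs_unit_le
        · exact List.forall_mem_cons_cons.2 ⟨fun _ => by simp, fun u hu hneg =>
            List.mem_cons_append_cons (l' := []) (g7 u hu hneg)⟩
        · intro lo' lc' hl v₁ x₁ l₁ y m' k1 k2
          obtain ⟨l', h', hl'⟩ := g8 lo' lc' hl _ _ _ _ _ k1 k2
          exact ⟨l', h', List.forall_mem_cons_cons.2 ⟨fun hpos => absurd h0 (not_lt.2 hpos), hl'⟩⟩

/-- Cutting a walk from the origin to the cursor. -/
theorem Walk.cut_marks {lo lc uo uc f : ℕ} {x : ℚ} {l : List (ℤ × ℕ)} {St : List ℕ}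
    (hSt : ∀ e ∈ A.edges, e.1 ∈ St ∧ e.2.2 ∈ St) (hi : A.init ∈ St) (hf : f ∈ St)
    (h : Walk q A (markLevel lo uo, A.init) (markLevel lc uc, f) x l) :
    ∃ (π : List ((ℕ × Bool) × (ℕ × Bool))) (n : ℤ) (xl : ℚ) (m : List (ℤ × ℕ)),
      LowReal q A lo lc π xl m ∧ x = n + xl ∧ |xl| ≤ lowWeight q l ∧ π.length ≤ crossings l + 1 ∧
      (∀ p ∈ π, p.1.1 ∈ St ∧ p.2.1 ∈ St) ∧
      (∀ u ∈ (markLevel lc uc, f) :: l, u.1 < 0 → u ∈ m) ∧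
      ∀ lo' lc', (lo = 0 ↔ lo' = 0) → (lc = 0 ↔ lc' = 0) → ∀ y m', LowReal q A lo' lc' π y m' →
        ∃ l', Walk q A (markLevel lo' uo, A.init) (markLevel lc' uc, f) (n + y) l' ∧
          ∀ u ∈ (markLevel lc uc, f) :: l, 0 ≤ u.1 → u ∈ (markLevel lc' uc, f) :: l' := by
  obtain ⟨h1, h2⟩ := h.cut hSt hf rfl lo
  by_cases h0 : 0 ≤ markLevel lo uo
  · obtain ⟨π, n, xl, m, g1, g2, g3, g4, g5, g6, g7⟩ := h1 h0
    have hlo := markLevel_of_nonneg h0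
    refine ⟨π, n, xl, m, g1, g2, g3, g4, g5, g6, fun lo' lc' ho hl y m' hy => ?_⟩
    obtain rfl : lo' = 0 := ho.1 hlo
    subst hlo
    exact g7 0 lc' hl y m' hy
  · rw [not_le] at h0
    have hlo := markLevel_of_neg h0
    obtain ⟨e', π, n, x₀, xl, l₀, m, g0, g1, rfl, g3, g4, g5, g6, g7, g8⟩ := h2 h0
    -- A radix point in the lower half makes the open piece start at the port of the radix point.
    refine ⟨((A.init, true), e') :: π, n, x₀ + xl, _, .cons ?_ g1, by ring, g3, by simpa using g4,
      ?_, g7, ?_⟩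
    · rw [markLevel_ne hlo] at g0
      simpa [portAt] using g0
    · intro r hr
      rcases List.mem_cons.1 hr with rfl | hr
      · exact ⟨hi, g5⟩
      · exact g6 r hr
    · intro lo' lc' ho hl y m' hy
      cases hy with
      | @cons _ _ x₁ y l₁ m' _ k1 k2 =>
        have hlo' : lo' ≠ 0 := mt ho.2 hlo
        obtain ⟨l', h', hl'⟩ := g8 lo' lc' hl _ _ _ _ _ k1 k2
        refine ⟨l', ?_, hl'⟩
        rw [markLevel_ne hlo', ← add_assoc]
        simpa [portAt] using h'

end

/-! ### Rational subsets are finite-state -/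

theorem sum_range_zpow_neg_le {q : ℕ} (hq : 2 ≤ q) (M : ℕ) :
    ∑ j ∈ Finset.range M, (q : ℚ) ^ (-((j : ℤ) + 1)) ≤ 1 - (q : ℚ) ^ (-(M : ℤ)) := by
  have hq2 : (2 : ℚ) ≤ q := by exact_mod_cast hq
  have hq0 : (q : ℚ) ≠ 0 := by positivity
  induction M with
  | zero => simp
  | succ M ih =>
    rw [Finset.sum_range_succ]
    have h1 : (q : ℚ) ^ (-(M : ℤ)) = q * (q : ℚ) ^ (-((M : ℤ) + 1)) := by
      rw [← zpow_one_add₀ hq0]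
      congr 1
      ring
    have h2 : (0 : ℚ) < (q : ℚ) ^ (-((M : ℤ) + 1)) := by positivity
    push_cast
    nlinarith

theorem crossings_le {l : List (ℤ × ℕ)} {St : List ℕ} {c : ℕ} (hl : ∀ u ∈ l, u.2 ∈ St)
    (hc : ∀ u, l.count u ≤ c) : crossings l ≤ St.length * c := by
  classical
  unfold crossings
  rw [← List.sum_toFinset_count_eq_length]
  have hc' : ∀ p u, @List.count _ instBEqOfDecidableEq u (l.filter p) ≤ c := fun p u => by
    convert Nat.le_trans ((List.filter_sublist (p := p)).count_le u) (hc u)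
  calc _ ≤ ∑ _u ∈ (l.filter fun u => u.1 = -1).toFinset, c :=
        Finset.sum_le_sum fun u _ => hc' _ u
    _ = (l.filter fun u => u.1 = -1).toFinset.card * c := by simp
    _ ≤ ((Finset.range 1).image (fun _ => (-1 : ℤ)) ×ˢ St.toFinset).card * c := by
        refine Nat.mul_le_mul_right _ (Finset.card_le_card ?_)
        intro u hu
        rw [List.mem_toFinset, List.mem_filter] at hu
        simp only [Finset.mem_product, List.mem_toFinset]
        exact ⟨by simpa using hu.2, hl u hu.1⟩
    _ ≤ St.length * c := by
        rw [Finset.card_product]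
        refine Nat.mul_le_mul_right _ ?_
        have := List.toFinset_card_le St
        simpa using this

/-- Each level has at most `St.length` configurations, each with multiplicity at most `c`, and the
weights `q ^ (-1) + q ^ (-2) + ⋯` of the negative levels sum up to at most `1`. -/
theorem lowWeight_le {q : ℕ} (hq : 2 ≤ q) {l : List (ℤ × ℕ)} {St : List ℕ} {c : ℕ}
    (hl : ∀ u ∈ l, u.2 ∈ St) (hc : ∀ u, l.count u ≤ c) : lowWeight q l ≤ St.length * c := by
  classical
  have hq0 : (0 : ℚ) < q := by positivity
  obtain ⟨M, hM⟩ : ∃ M : ℕ, ∀ u ∈ l, -(M : ℤ) ≤ u.1 := by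
    obtain ⟨M, hM⟩ := (l.toFinset.image fun u => u.1.natAbs).exists_le
    refine ⟨M, fun u hu => ?_⟩
    have := hM u.1.natAbs (Finset.mem_image_of_mem _ (by simpa using hu))
    omega
  have hc' : ∀ p u, @List.count _ instBEqOfDecidableEq u (l.filter p) ≤ c := fun p u => by
    convert Nat.le_trans ((List.filter_sublist (p := p)).count_le u) (hc u)
  unfold lowWeight
  rw [Finset.sum_list_map_count]
  have hsub : (l.filter fun u => u.1 < 0).toFinset ⊆
      (Finset.range M ×ˢ St.toFinset).image fun u => (-((u.1 : ℤ) + 1), u.2) := by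
    intro u hu
    rw [List.mem_toFinset, List.mem_filter] at hu
    have h1 := hM u hu.1
    have h2 : u.1 < 0 := by simpa using hu.2
    refine Finset.mem_image.2 ⟨((-u.1 - 1).toNat, u.2), ?_, ?_⟩
    · simp only [Finset.mem_product, Finset.mem_range, List.mem_toFinset]
      exact ⟨by omega, hl u hu.1⟩
    · ext
      · simp only
        omega
      · rfl
  calc _ ≤ ∑ u ∈ (l.filter fun u => u.1 < 0).toFinset, (c : ℚ) * (q : ℚ) ^ u.1 := by
        refine Finset.sum_le_sum fun u _ => ?_
        rw [nsmul_eq_mul]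
        refine mul_le_mul_of_nonneg_right ?_ (by positivity)
        exact_mod_cast hc' _ u
    _ ≤ ∑ u ∈ (Finset.range M ×ˢ St.toFinset).image fun u : ℕ × ℕ => (-((u.1 : ℤ) + 1), u.2),
          (c : ℚ) * (q : ℚ) ^ u.1 :=
        Finset.sum_le_sum_of_subset_of_nonneg hsub fun _ _ _ => by positivity
    _ = ∑ u ∈ Finset.range M ×ˢ St.toFinset, (c : ℚ) * (q : ℚ) ^ (-((u.1 : ℤ) + 1)) := by
        rw [Finset.sum_image]
        rintro ⟨a, b⟩ _ ⟨a', b'⟩ _ h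
        simp only [Prod.mk.injEq] at h ⊢
        exact ⟨by omega, h.2⟩
    _ = St.toFinset.card * (c * ∑ j ∈ Finset.range M, (q : ℚ) ^ (-((j : ℤ) + 1))) := by
        rw [Finset.sum_product_right]
        simp [Finset.mul_sum]
    _ ≤ St.length * (c * 1) := by
        have h1 := sum_range_zpow_neg_le hq M
        have h2 : (0 : ℚ) < (q : ℚ) ^ (-(M : ℤ)) := by positivity
        have h3 : (St.toFinset.card : ℚ) ≤ St.length := by exact_mod_cast List.toFinset_card_le St
        gcongr
        linarith
    _ = _ := by ring

/-- The codes of bounded lower profiles. -/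
abbrev Profile (m K Z : ℕ) : Type :=
  (Fin K → Option ((Fin m × Bool) × (Fin m × Bool))) × (Bool → Bool) × Fin (2 * Z + 1)

/-- The list of pairs of ports that a code describes. -/
def Profile.ports (St : List ℕ) {K Z : ℕ} (d : Profile St.length K Z) :
    List ((ℕ × Bool) × (ℕ × Bool)) :=
  (List.ofFn d.1).reduceOption.map fun p => ((St.get p.1.1, p.1.2), (St.get p.2.1, p.2.2))

theorem exists_ofFn_reduceOption {α : Type*} (K : ℕ) (l : List α) (h : l.length ≤ K) :
    ∃ g : Fin K → Option α, (List.ofFn g).reduceOption = l := by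
  induction K generalizing l with
  | zero =>
    obtain rfl : l = [] := List.length_eq_zero_iff.1 (by omega)
    exact ⟨fun _ => none, by simp⟩
  | succ K ih =>
    cases l with
    | nil =>
      obtain ⟨g, hg⟩ := ih [] (by simp)
      exact ⟨Fin.cons none g, by simpa [List.ofFn_succ, List.reduceOption_cons_of_none] using hg⟩
    | cons a l =>
      obtain ⟨g, hg⟩ := ih l (by simpa using h)
      exact ⟨Fin.cons (some a) g, by simpa [List.ofFn_succ, List.reduceOption_cons_of_some] using hg⟩

theorem Profile.exists_ports {St : List ℕ} {K Z : ℕ} {π : List ((ℕ × Bool) × (ℕ × Bool))}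
    (hπ : ∀ p ∈ π, p.1.1 ∈ St ∧ p.2.1 ∈ St) (hK : π.length ≤ K) (f : Bool → Bool) {z : ℤ}
    (hz : |z| ≤ Z) : ∃ d : Profile St.length K Z, d.ports St = π ∧ d.2.1 = f ∧ (d.2.2 : ℤ) - Z = z := by
  have h1 : ∃ l : List ((Fin St.length × Bool) × (Fin St.length × Bool)),
      l.map (fun p => ((St.get p.1.1, p.1.2), (St.get p.2.1, p.2.2))) = π := by
    clear hK
    induction π with
    | nil => exact ⟨[], rfl⟩
    | cons p π ih =>
      obtain ⟨l, hl⟩ := ih fun r hr => hπ r (List.mem_cons_of_mem _ hr)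
      obtain ⟨ha, hb⟩ := hπ p List.mem_cons_self
      obtain ⟨a, ha⟩ := List.get_of_mem ha
      obtain ⟨b, hb⟩ := List.get_of_mem hb
      exact ⟨((a, p.1.2), (b, p.2.2)) :: l, by simp [hl, -List.get_eq_getElem, ha, hb]⟩
  obtain ⟨l, rfl⟩ := h1
  obtain ⟨g, hg⟩ := exists_ofFn_reduceOption K l (by simpa using hK)
  rw [abs_le] at hz
  refine ⟨(g, f, ⟨(z + Z).toNat, by omega⟩), by simp [Profile.ports, hg], rfl, ?_⟩
  simp only
  omega

/-- All states that occur in an automaton. -/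
def FinAutomaton.states {α : Type} (A : FinAutomaton α) : List ℕ :=
  A.init :: (A.final ++ (A.edges.map fun e => e.1) ++ A.edges.map fun e => e.2.2)

/-- A bound on the number of classes of lower halves for a rational subset, where `m` is the number
of states. -/
def rationalBound (m D : ℕ) : ℕ :=
  4 * 2 ^ (2 * ((m * 2 * (m * 2) + 1) ^ (m * (3 * D) + 1) *
    (4 * (2 * (m * (3 * D) + 2 * D + 1) + 1))))

namespace IsSlack

theorem nsmul_loop {q : ℕ} {A : FinAutomaton BSLetter} {D : ℕ} {S : Bool → ℕ → Prop}
    (hS : IsSlack q A D S) {b : Bool} {u : ℤ × ℕ} (hu : S b u.2) (k : ℕ) :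
    ∃ l, Walk q A u u (sgn b * (D * k * (q : ℚ) ^ u.1)) l := by
  obtain ⟨l, hl⟩ := hS.loop b u.2 hu u.1
  obtain ⟨l', hl', -⟩ := hl.nsmul k
  exact ⟨l', by convert hl' using 1; ring⟩

variable {q : ℕ} [q.AtLeastTwo] {A : FinAutomaton BSLetter} {D : ℕ} {S : Bool → ℕ → Prop}

/-- The slack of a given sign can be inserted, in a lower half up to multiples of `D`. -/
theorem exists_reduce (D k : ℕ) (i : ℤ) (hi : i < 0) : ∃ k₀ k₁ : ℕ,
    (D * k * (q : ℚ) ^ i = D * k₀ * (q : ℚ) ^ i + D * k₁) ∧ (D * k₀ * (q : ℚ) ^ i ≤ D) ∧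
    (k₁ ≠ 0 → k ≠ 0) ∧ ∀ k' : ℕ, ∃ k'' : ℕ, D * k'' * (q : ℚ) ^ i = D * k₀ * (q : ℚ) ^ i + D * k' := by
  have hq2 := PointedNum.two_le q
  have hq0 : (0 : ℚ) < q := by positivity
  obtain ⟨j, hj⟩ : ∃ j : ℕ, i = -j := ⟨(-i).toNat, by omega⟩
  have hQ : (q : ℚ) ^ i = ((q ^ j : ℕ) : ℚ)⁻¹ := by
    rw [hj, zpow_neg, zpow_natCast]
    push_cast
    rfl
  have hQ0 : 0 < q ^ j := by positivity
  have hQ1 : ((q ^ j : ℕ) : ℚ) ≠ 0 := by positivity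
  rw [hQ]
  -- Division by `q ^ j`, where `i = -j`: the remainder is slack worth at most `D`, the quotient
  -- counts multiples of `D` at level `0`.
  refine ⟨k % q ^ j, k / q ^ j, ?_, ?_, ?_, fun k' => ⟨k % q ^ j + q ^ j * k', ?_⟩⟩
  · have : (k : ℚ) = (k % q ^ j : ℕ) + (q ^ j : ℕ) * (k / q ^ j : ℕ) := by
      exact_mod_cast (Nat.mod_add_div k (q ^ j)).symm
    conv_lhs => rw [this]
    field_simp
  · rw [mul_assoc]
    refine mul_le_of_le_one_right (by positivity) ?_
    rw [← div_eq_mul_inv, div_le_one (by positivity)]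
    exact_mod_cast (Nat.mod_lt k hQ0).le
  · rintro h rfl
    simp at h
  · push_cast
    have : (q : ℚ) ^ j ≠ 0 := by positivity
    field_simp

/-- The type of a lower half consists of the signed profiles that it realizes: ports, an integer
`z`, and flags for the signs of available slack, such that the fraction with its sign, plus `z + D
k`, is the value of lower pieces between the ports for every `k` that the flags allow. An accepting
walk is thinned and cut. Its upper part, with the upper slack, is kept; its lower part has a bounded
profile in the type of `y`, which an equivalent `y'` must realize too. The unbounded number of
multiples of `D` is not part of the profile, because the slack loops supply all of them. -/
theorem finiteHalves (hS : IsSlack q A D S) :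
    FiniteHalves q (BaumslagSolitar.memPred q (BaumslagSolitar.rationalSubset q A))
      (rationalBound A.states.length D) := by
  classical
  have hq2 := PointedNum.two_le q
  have hq0 : (0 : ℚ) < q := by positivity
  set St := A.states with hSt
  have hSte : ∀ e ∈ A.edges, e.1 ∈ St ∧ e.2.2 ∈ St := by
    intro e he
    simp only [hSt, FinAutomaton.states, List.mem_cons, List.mem_append, List.mem_map]
    exact ⟨Or.inr (Or.inl (Or.inr ⟨e, he, rfl⟩)), Or.inr (Or.inr ⟨e, he, rfl⟩)⟩
  have hSti : A.init ∈ St := by simp [hSt, FinAutomaton.states]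
  have hStf : ∀ f ∈ A.final, f ∈ St := by
    intro f hf
    simp [hSt, FinAutomaton.states, hf]
  -- `K` bounds the number of lower pieces by that of the crossings of a thin walk. `Z` bounds the
  -- carry: the low weight of a thin walk, at most `D` for each of the two slack remainders, and `1`
  -- for the fraction.
  set K := St.length * (3 * D) + 1 with hK
  set Z := St.length * (3 * D) + 2 * D + 1 with hZ
  refine ⟨Bool × Bool × Set (Bool × Profile St.length K Z), inferInstance, fun y lo lc =>
    (decide (lo = 0), decide (lc = 0), {p | ∀ k : ℤ, (∀ b, 0 < sgn b * k → p.2.2.1 b = true) →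
      ∃ m, LowReal q A lo lc (p.2.ports St) (sgn p.1 * y + ((p.2.2.2 : ℤ) - Z + D * k : ℤ)) m}), ?_, ?_⟩
  · simp only [Fintype.card_prod, Fintype.card_bool, Fintype.card_set, Fintype.card_fun,
      Fintype.card_fin, Fintype.card_option, rationalBound]
    apply le_of_eq
    rw [← hK, ← hZ]
    ring
  · suffices key : ∀ y lo lc y' lo' lc', IsFrac q y → (lo = 0 ↔ lo' = 0) → (lc = 0 ↔ lc' = 0) →
        (∀ p : Bool × Profile St.length K Z, (∀ k : ℤ, (∀ b, 0 < sgn b * k → p.2.2.1 b = true) →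
          ∃ m, LowReal q A lo lc (p.2.ports St) (sgn p.1 * y + ((p.2.2.2 : ℤ) - Z + D * k : ℤ)) m) →
          (∀ k : ℤ, (∀ b, 0 < sgn b * k → p.2.2.1 b = true) →
          ∃ m, LowReal q A lo' lc' (p.2.ports St)
            (sgn p.1 * y' + ((p.2.2.2 : ℤ) - Z + D * k : ℤ)) m)) →
        ∀ (u : ℤ) (s : Bool) (uo uc : ℕ),
        Shifted q (BaumslagSolitar.memPred q (BaumslagSolitar.rationalSubset q A)) (u + sgn s * y)
          (markLevel lo uo) (markLevel lc uc) →
        Shifted q (BaumslagSolitar.memPred q (BaumslagSolitar.rationalSubset q A)) (u + sgn s * y')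
          (markLevel lo' uo) (markLevel lc' uc) by
      intro y lo lc y' lo' lc' hy hy' e
      simp only [Prod.mk.injEq, decide_eq_decide] at e
      obtain ⟨e1, e2, e3⟩ := e
      exact ⟨e1, e2, fun u s uo uc => ⟨key y lo lc y' lo' lc' hy e1 e2
        (fun p hp => (Set.ext_iff.1 e3 p).1 hp) u s uo uc, key y' lo' lc' y lo lc hy' e1.symm e2.symm
        (fun p hp => (Set.ext_iff.1 e3 p).2 hp) u s uo uc⟩⟩
    intro y lo lc y' lo' lc' hy ho hc hτ u s uo uc
    simp only [BaumslagSolitar.shifted_rationalSubset_iff]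
    rintro ⟨f, hf, l, hw⟩
    refine ⟨f, hf, ?_⟩
    obtain ⟨x', l', k, w, h1, h2, h3, h4⟩ := hS.exists_thin_slack hw
    obtain ⟨π, n, xl, m, g1, g2, g3, g4, g5, g6, g7⟩ := h1.cut_marks hSte hSti (hStf f hf)
    have hl' : ∀ u ∈ l', u.2 ∈ St := by
      intro u hu
      obtain ⟨e, he, heq⟩ := List.mem_map.1 (h1.mem_edges hu)
      rw [← heq]
      exact (hSte e he).1
    have hcr := crossings_le hl' h2
    have hlw := lowWeight_le hq2 hl' h2
    -- the slack of each sign, split into an upper and a lower part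
    have hsl : ∀ b, ∃ (σu : ℕ) (r : ℚ) (k₁ : ℕ) (fl : Bool),
        D * k b * (q : ℚ) ^ (w b).1 = σu + r + D * k₁ ∧ 0 ≤ r ∧ r ≤ D ∧ (k₁ ≠ 0 → fl = true) ∧
        (∀ k' : ℕ, (k' ≠ 0 → fl = true) → ∀ x m, LowReal q A lo lc π x m →
          (∀ u ∈ (markLevel lc uc, f) :: l', u.1 < 0 → u ∈ m) →
          ∃ m', LowReal q A lo lc π (x + sgn b * (r + D * k')) m' ∧ m ⊆ m') ∧
        (∀ v v' x l₁, Walk q A v v' x l₁ →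
          (∀ u ∈ (markLevel lc uc, f) :: l', 0 ≤ u.1 → u ∈ v' :: l₁) →
          ∃ l₂, Walk q A v v' (x + sgn b * σu) l₂ ∧ l₁ ⊆ l₂) := by
      intro b
      by_cases hk : k b = 0
      · refine ⟨0, 0, 0, false, by simp [hk], le_rfl, by positivity, by simp, ?_, ?_⟩
        · intro k' hk' x m hx _
          have : k' = 0 := by by_contra h; simpa using hk' h
          subst this
          exact ⟨m, by simpa using hx, fun _ h => h⟩
        · intro v v' x l₁ hx _
          exact ⟨l₁, by simpa using hx, fun _ h => h⟩
      · obtain ⟨hSb, hmem⟩ := h4 b hk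
        by_cases hneg : (w b).1 < 0
        · obtain ⟨k₀, k₁, e1, e2, e3, e4⟩ := exists_reduce (q := q) D (k b) _ hneg
          refine ⟨0, D * k₀ * (q : ℚ) ^ (w b).1, k₁, true, by rw [e1]; simp, by positivity, e2,
            fun _ => rfl, ?_, ?_⟩
          · intro k' _ x m hx hm
            obtain ⟨k'', hk''⟩ := e4 k'
            obtain ⟨l₀, hl₀⟩ := hS.nsmul_loop hSb k''
            obtain ⟨m', hm', hsub⟩ := hx.insert (hm _ hmem hneg) hl₀
            exact ⟨m', by rwa [← hk''], hsub⟩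
          · intro v v' x l₁ hx _
            exact ⟨l₁, by simpa using hx, fun _ h => h⟩
        · rw [not_lt] at hneg
          obtain ⟨j, hj⟩ := Int.eq_ofNat_of_zero_le hneg
          refine ⟨D * k b * q ^ j, 0, 0, false, by rw [hj]; simp, le_rfl, by positivity, by simp, ?_,
            ?_⟩
          · intro k' hk' x m hx _
            have : k' = 0 := by by_contra h; simpa using hk' h
            subst this
            exact ⟨m, by simpa using hx, fun _ h => h⟩
          · intro v v' x l₁ hx hm
            obtain ⟨l₀, hl₀⟩ := hS.nsmul_loop hSb (k b)
            obtain ⟨l₂, hl₂, hsub⟩ := hx.insert (hm _ hmem hneg) hl₀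
            refine ⟨l₂, ?_, hsub⟩
            convert hl₂ using 1
            rw [hj]
            push_cast
            rw [zpow_natCast]
    choose σu r k₁ fl s1 s2 s3 s4 s5 s6 using hsl
    have hsum : ∀ F : Bool → ℚ, ∑ b, sgn b * F b = F false - F true := by
      intro F
      simp [sgn]
      ring
    set kk : ℤ := k₁ false - k₁ true with hkk
    -- The integer that the lower half has to supply besides its fraction, once the upper part, the
    -- upper slack and the multiples `D * kk` are accounted for.
    set z : ℤ := u - n - (σu false - σu true) - D * kk with hz
    have hzval : (sgn s : ℚ) * y + z = xl + (r false - r true) := by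
      rw [hsum] at h3
      rw [s1, s1, g2] at h3
      rw [hz, hkk]
      push_cast
      linarith
    have hzabs : |z| ≤ Z := by
      have hr1 := s2 false
      have hr2 := s3 false
      have hr3 := s2 true
      have hr4 := s3 true
      have hy1 := hy.2.1
      have hy2 := hy.2.2
      have hxl := abs_le.1 (g3.trans hlw)
      have hsy : |(sgn s : ℚ) * y| ≤ 1 := by
        rw [abs_mul, abs_of_nonneg hy1]
        cases s <;> simp [sgn, hy2.le]
      have hsy := abs_le.1 hsy
      have h5 : |(z : ℚ)| ≤ (Z : ℕ) := by
        rw [hZ, abs_le]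
        push_cast at hxl ⊢
        have hD : (0 : ℚ) ≤ D := by positivity
        constructor <;> linarith
      exact_mod_cast h5
    obtain ⟨d, hd1, hd2, hd3⟩ := Profile.exists_ports g5 (g4.trans (Nat.succ_le_succ hcr)) fl hzabs
    -- The profile belongs to `y`, as inserting slack loops of both signs realizes every allowed
    -- multiple `k'`. It is then used for `y'` with the actual multiple `kk`.
    obtain ⟨m', hm'⟩ := hτ (s, d) (by
      simp only
      rw [hd1, hd2, hd3]
      intro k' hk'
      have hpos := s5 false k'.toNat (fun h => hk' false (by simp [sgn]; omega))
        xl m g1 g6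
      obtain ⟨m₁, hm₁, hsub⟩ := hpos
      obtain ⟨m₂, hm₂, -⟩ := s5 true (-k').toNat (fun h => hk' true (by simp [sgn]; omega))
        _ m₁ hm₁ (fun u hu hn => hsub (g6 u hu hn))
      refine ⟨m₂, ?_⟩
      convert hm₂ using 1
      have : (k' : ℚ) = (k'.toNat : ℕ) - ((-k').toNat : ℕ) := by
        have : k' = (k'.toNat : ℤ) - ((-k').toNat : ℤ) := by omega
        exact_mod_cast this
      push_cast
      rw [← add_assoc, hzval, this]
      simp [sgn]
      ring) kk (by
      simp only
      rw [hd2]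
      intro b hb
      apply s4
      cases b <;> simp [sgn, hkk] at hb <;> omega)
    simp only at hm'
    rw [hd1, hd3] at hm'
    obtain ⟨l₁, hl₁, hsub₁⟩ := g7 lo' lc' ho hc _ _ hm'
    obtain ⟨l₂, hl₂, hsub₂⟩ := s6 false _ _ _ _ hl₁ hsub₁
    obtain ⟨l₃, hl₃, -⟩ := s6 true _ _ _ _ hl₂ (fun u hu hn => by
      rcases List.mem_cons.1 (hsub₁ u hu hn) with h | h
      · exact h ▸ List.mem_cons_self
      · exact List.mem_cons_of_mem _ (hsub₂ h))
    refine ⟨l₃, ?_⟩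
    convert hl₃ using 1
    rw [hz]
    push_cast
    simp [sgn]
    ring

end IsSlack

/-! ### Certificates for slack -/

namespace Walk

variable {q : ℕ} {A : FinAutomaton BSLetter}

/-- A walk from a level above `i` to level `i` decomposes at its first arrival at level `i`. -/
theorem exists_return {v v' : ℤ × ℕ} {i : ℤ} {x : ℚ} {l : List (ℤ × ℕ)} (h : Walk q A v v' x l)
    (hv : i + 1 ≤ v.1) (hv' : v'.1 = i) (hl : ∀ u ∈ l, i ≤ u.1) :
    ∃ p r x₁ x₂ l₁ l₂, Walk q A v (i + 1, p) x₁ l₁ ∧ (∀ u ∈ l₁, i + 1 ≤ u.1) ∧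
      (p, (BSGen.t, false), r) ∈ A.edges ∧ Walk q A (i, r) v' x₂ l₂ ∧ (∀ u ∈ l₂, i ≤ u.1) ∧
      x = x₁ + x₂ ∧ l₁.length + l₂.length < l.length := by
  induction h with
  | nil v => omega
  | @cons j p p' e v x l he h ih =>
    have hl' : ∀ u ∈ l, i ≤ u.1 := fun u hu => hl u (List.mem_cons_of_mem _ hu)
    simp only at hv
    by_cases hs : i + 1 ≤ j + BSLetter.step e
    · obtain ⟨p₁, r, x₁, x₂, l₁, l₂, h1, h2, h3, h4, h5, rfl, h7⟩ := ih hs hv' hl'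
      refine ⟨p₁, r, _, x₂, _, l₂, .cons he h1, ?_, h3, h4, h5, by ring, ?_⟩
      · exact List.forall_mem_cons.2 ⟨hv, h2⟩
      · simp only [List.length_cons]
        omega
    · have h1 : j = i + 1 ∧ e = (BSGen.t, false) := by
        rcases e with ⟨_ | _, _ | _⟩ <;> simp [BSLetter.step] at hs ⊢ <;> omega
      obtain ⟨rfl, rfl⟩ := h1
      refine ⟨p, p', 0, x, [], l, .nil _, by simp, he, ?_, hl', by simp [BSLetter.unit], by simp⟩
      simpa [BSLetter.step] using h

end Walk

/-- `v` is at most the bound `p.1 - p.2`, if `β = some p`. -/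
def BoundedBy (v : ℤ) (β : Option (ℕ × ℕ)) : Prop := ∀ p ∈ β, v ≤ (p.1 : ℤ) - p.2

/-- Comparison of bounds, where `none` is the trivial bound. -/
def boundLe : Option (ℕ × ℕ) → Option (ℕ × ℕ) → Bool
  | _, none => true
  | none, some _ => false
  | some p, some r => decide (p.1 + r.2 ≤ r.1 + p.2)

theorem BoundedBy.trans {v : ℤ} {β β' : Option (ℕ × ℕ)} (h : BoundedBy v β)
    (h' : boundLe β β' = true) : BoundedBy v β' := by
  intro r hr
  obtain rfl : β' = some r := hr
  cases β with
  | none => simp [boundLe] at h'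
  | some p =>
    simp only [boundLe, decide_eq_true_eq] at h'
    have := h p rfl
    omega

/-- The bound for `q * v + w + (c - d)`. -/
def boundAdd (q c d : ℕ) (β β' : Option (ℕ × ℕ)) : Option (ℕ × ℕ) :=
  β.bind fun p => β'.map fun r => (q * p.1 + r.1 + c, q * p.2 + r.2 + d)

theorem BoundedBy.add {v w : ℤ} {β β' : Option (ℕ × ℕ)} (q c d : ℕ) (h : BoundedBy v β)
    (h' : BoundedBy w β') : BoundedBy (q * v + w + (c - d)) (boundAdd q c d β β') := by
  intro r hr
  cases β with
  | none => simp [boundAdd] at hr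
  | some p =>
    cases β' with
    | none => simp [boundAdd] at hr
    | some p' =>
      simp only [boundAdd, Option.bind_some, Option.map_some, Option.mem_def, Option.some.injEq] at hr
      subst hr
      have h1 := h p rfl
      have h2 := h' p' rfl
      have h3 : (q : ℤ) * v ≤ q * (p.1 - p.2) := mul_le_mul_of_nonneg_left h1 (by positivity)
      push_cast
      linarith

/-- The positive part of the signed contribution of a letter. -/
def BSLetter.gain (b : Bool) (e : BSLetter) : ℕ := (sgn b * BSLetter.unit e).toNat

theorem BSLetter.gain_sub (b : Bool) (e : BSLetter) :
    (BSLetter.gain b e : ℤ) - BSLetter.gain (!b) e = sgn b * BSLetter.unit e := by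
  rcases e with ⟨_ | _, _ | _⟩ <;> cases b <;> simp [BSLetter.gain, sgn, BSLetter.unit]

/-- A finite certificate that `P` lists slack states. The words in `W` give closed runs for the
states in `P`, the bounds in `G` show that there are no others. -/
def SlackCert (q : ℕ) [NeZero q] (A : FinAutomaton BSLetter) (D : ℕ) (P : List (Bool × ℕ))
    (G : List (Bool × ℕ × ℕ × Option (ℕ × ℕ))) (W : List (List BSLetter)) : Prop :=
  0 < D ∧
  (∀ p ∈ P, ∃ w ∈ W, A.Run p.2 w p.2 ∧
    (BaumslagSolitar.toPointed q (BaumslagSolitar.ofWord 1 q w)).num = (sgn p.1 * D : ℤ) ∧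
    (BaumslagSolitar.toPointed q (BaumslagSolitar.ofWord 1 q w)).pos = 0) ∧
  (∀ s ∈ A.states, ∀ b ∈ [true, false], ∃ g ∈ G, g.1 = b ∧ g.2.1 = s ∧ g.2.2.1 = s ∧
    boundLe (some (0, 0)) g.2.2.2 = true) ∧
  (∀ e ∈ A.edges, ∀ g ∈ G, BSLetter.step e.2.1 = 0 → g.2.1 = e.2.2 →
    ∃ g' ∈ G, g'.1 = g.1 ∧ g'.2.1 = e.1 ∧ g'.2.2.1 = g.2.2.1 ∧
      boundLe (boundAdd 0 (BSLetter.gain g.1 e.2.1) (BSLetter.gain (!g.1) e.2.1) (some (0, 0)) g.2.2.2)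
        g'.2.2.2 = true) ∧
  (∀ e ∈ A.edges, ∀ g ∈ G, ∀ e' ∈ A.edges, ∀ h ∈ G, e.2.1 = (BSGen.t, true) → g.2.1 = e.2.2 →
    g.2.2.1 = e'.1 → e'.2.1 = (BSGen.t, false) → h.2.1 = e'.2.2 → g.1 = h.1 →
    ∃ g' ∈ G, g'.1 = g.1 ∧ g'.2.1 = e.1 ∧ g'.2.2.1 = h.2.2.1 ∧
      boundLe (boundAdd q 0 0 g.2.2.2 h.2.2.2) g'.2.2.2 = true) ∧
  (∀ g ∈ G, g.2.1 = g.2.2.1 → (g.1, g.2.1) ∈ P ∨ boundLe g.2.2.2 (some (0, 0)) = true)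

section

variable {q : ℕ} [q.AtLeastTwo] {A : FinAutomaton BSLetter} {D : ℕ} {P : List (Bool × ℕ)}
  {G : List (Bool × ℕ × ℕ × Option (ℕ × ℕ))} {W : List (List BSLetter)}

theorem FinAutomaton.mem_states {α : Type} (A : FinAutomaton α) {e : ℕ × α × ℕ} (he : e ∈ A.edges) :
    e.1 ∈ A.states ∧ e.2.2 ∈ A.states := by
  simp only [FinAutomaton.states, List.mem_cons, List.mem_append, List.mem_map]
  exact ⟨Or.inr (Or.inl (Or.inr ⟨e, he, rfl⟩)), Or.inr (Or.inr ⟨e, he, rfl⟩)⟩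

/-- A walk on levels `≥ i` that returns to `i` is empty, begins with a letter that keeps the level,
or begins with `t`. In the last case its first return splits it into an excursion above `i + 1`,
whose value is scaled by `q`, and a remaining walk. The closure conditions on `G` mirror these three
cases; a walk that begins with `t⁻¹` would leave the levels `≥ i`. -/
theorem SlackCert.exists_bound (h : SlackCert q A D P G W) (b : Bool) {i : ℤ} {s s' : ℕ} {x : ℚ}
    {l : List (ℤ × ℕ)} (hw : Walk q A (i, s) (i, s') x l) (hl : ∀ u ∈ l, i ≤ u.1)
    (hs : s ∈ A.states) : ∃ g ∈ G, g.1 = b ∧ g.2.1 = s ∧ g.2.2.1 = s' ∧ ∃ v : ℤ,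
      sgn b * x = v * (q : ℚ) ^ i ∧ BoundedBy v g.2.2.2 := by
  have hq : (q : ℚ) ≠ 0 := NeZero.ne _
  obtain ⟨-, -, r0, r1, r2, -⟩ := h
  induction hn : l.length using Nat.strong_induction_on generalizing i s s' x l with
  | _ n ih =>
    cases hw with
    | nil =>
      obtain ⟨g, hg, h1, h2, h3, h4⟩ := r0 s hs b (by cases b <;> simp)
      exact ⟨g, hg, h1, h2, h3, 0, by simp, BoundedBy.trans (β := some (0, 0)) (by
        intro p hp
        obtain rfl : (0, 0) = p := by simpa using hp
        simp) h4⟩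
    | @cons _ _ p' e _ x l he hw =>
      simp only [List.length_cons] at hn
      have hl' : ∀ u ∈ l, i ≤ u.1 := fun u hu => hl u (List.mem_cons_of_mem _ hu)
      have hp' : p' ∈ A.states := (A.mem_states he).2
      by_cases hst : BSLetter.step e = 0
      · rw [hst, add_zero] at hw
        obtain ⟨g, hg, h1, h2, h3, v, h4, h5⟩ := ih l.length (by omega) hw hl' hp' rfl
        obtain ⟨g', hg', k1, k2, k3, k4⟩ := r1 _ he g hg hst h2
        refine ⟨g', hg', k1.trans h1, k2, k3.trans h3, v + sgn b * BSLetter.unit e, ?_, ?_⟩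
        · rw [mul_add, h4]
          push_cast
          ring
        · refine BoundedBy.trans ?_ k4
          have h6 : BoundedBy 0 (some (0, 0)) := by
            intro p hp
            obtain rfl : (0, 0) = p := by simpa using hp
            simp
          have := h6.add 0 (BSLetter.gain g.1 e) (BSLetter.gain (!g.1) e) h5
          rw [BSLetter.gain_sub, mul_zero, zero_add] at this
          simpa only [h1] using this
      · by_cases hst' : BSLetter.step e = 1
        · obtain ⟨rfl⟩ : e = (BSGen.t, true) := by
            rcases e with ⟨_ | _, _ | _⟩ <;> simp [BSLetter.step] at hst'
            rfl
          rw [hst'] at hw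
          obtain ⟨p₁, r, x₁, x₂, l₁, l₂, m1, m2, m3, m4, m5, rfl, m7⟩ :=
            hw.exists_return le_rfl rfl hl'
          obtain ⟨g, hg, h1, h2, h3, v, h4, h5⟩ := ih l₁.length (by omega) m1 m2 hp' rfl
          obtain ⟨g', hg', h1', h2', h3', v', h4', h5'⟩ := ih l₂.length (by omega) m4 m5
            (A.mem_states m3).2 rfl
          obtain ⟨g'', hg'', k1, k2, k3, k4⟩ := r2 _ he g hg _ m3 g' hg' rfl h2 h3 rfl h2'
            (h1.trans h1'.symm)
          refine ⟨g'', hg'', k1.trans h1, k2, k3.trans h3', q * v + v', ?_, ?_⟩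
          · rw [mul_add, mul_add, h4, h4', zpow_add₀ hq, zpow_one]
            simp only [BSLetter.unit]
            push_cast
            ring
          · refine BoundedBy.trans ?_ k4
            simpa using h5.add q 0 0 h5'
        · have hst'' : BSLetter.step e = -1 := by
            rcases BSLetter.step_cases e with h | h | h <;> omega
          rw [hst''] at hw
          have := hw.start_mem
          rcases List.mem_cons.1 this with h | h
          · simp at h
          · have := hl' _ h
            simp only at this
            omega

/-- Outside `P` the certified bound for closed walks is at most `0`, so such a state is not the
lowest one of a closed walk of the given sign. -/
theorem SlackCert.isSlack (h : SlackCert q A D P G W) :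
    IsSlack q A D (fun b s => (b, s) ∈ P) := by
  refine ⟨h.1, ?_, ?_⟩
  · intro b s hs i
    obtain ⟨w, -, h1, h2, h3⟩ := h.2.1 _ hs
    obtain ⟨l, hl⟩ := BaumslagSolitar.exists_walk_of_run (q := q) h1 i
    rw [h2, h3, add_zero] at hl
    refine ⟨l, ?_⟩
    convert hl using 1
    push_cast
    ring
  · intro b i s x l hw hl hx
    have hs : s ∈ A.states := by
      cases hw with
      | nil => simp at hx
      | cons he _ => exact (A.mem_states he).1
    obtain ⟨g, hg, h1, h2, h3, v, h4, h5⟩ := h.exists_bound b hw hl hs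
    rcases h.2.2.2.2.2 g hg (h2.trans h3.symm) with h6 | h6
    · rwa [h1, h2] at h6
    · have h7 := (h5.trans h6) (0, 0) rfl
      have h8 : (v : ℚ) ≤ 0 := by exact_mod_cast h7
      have h9 : (0 : ℚ) ≤ (q : ℚ) ^ i := by positivity
      rw [h4] at hx
      nlinarith [mul_nonneg (neg_nonneg.2 h8) h9]

/-! ### Existence of slack certificates -/

/-- The signed contributions of the walks between two states that start and end at level `0` and
stay at levels `≥ 0`. -/
def returnValues (q : ℕ) (A : FinAutomaton BSLetter) (b : Bool) (s s' : ℕ) : Set ℤ :=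
  {v | ∃ l, Walk q A (0, s) (0, s') ((sgn b * v : ℤ) : ℚ) l ∧ ∀ u ∈ l, 0 ≤ u.1}

theorem sgn_mul_sgn_mul (b : Bool) (v : ℤ) : sgn b * (sgn b * v) = v := by
  cases b <;> simp [sgn]

open Classical in
/-- The optimal bound for a set of integers. -/
noncomputable def optimalBound (V : Set ℤ) : Option (ℕ × ℕ) :=
  if BddAbove V then some ((sSup V).toNat, (-sSup V).toNat) else none

/-- This verifies the closure conditions for optimal bounds: `V` is produced from return values by
one rule and is contained in the set `V'` of the target, while `β` is attained in `V`, or trivial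
with `V` unbounded. -/
theorem boundLe_optimalBound {V V' : Set ℤ} {β : Option (ℕ × ℕ)}
    (h : ∀ p, β = some p → (p.1 : ℤ) - p.2 ∈ V) (h' : β = none → ¬ BddAbove V) (hV' : V ⊆ V') :
    boundLe β (optimalBound V') = true := by
  unfold optimalBound
  split_ifs with hb
  · cases β with
    | none => exact absurd (hb.mono hV') (h' rfl)
    | some p =>
      have := le_csSup hb (hV' (h p rfl))
      simp only [boundLe, decide_eq_true_eq]
      omega
  · cases β <;> rfl

theorem optimalBound_mem {V : Set ℤ} (hV : V.Nonempty) {p : ℕ × ℕ} (h : optimalBound V = some p) :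
    (p.1 : ℤ) - p.2 ∈ V := by
  unfold optimalBound at h
  split_ifs at h with hb
  have := Int.csSup_mem hV hb
  simp only [Option.some.injEq] at h
  subst h
  simp only
  convert this using 1
  omega

theorem optimalBound_none {V : Set ℤ} (h : optimalBound V = none) : ¬ BddAbove V := by
  unfold optimalBound at h
  split_ifs at h with hb
  exact hb

theorem returnValues_nil {q : ℕ} {A : FinAutomaton BSLetter} (b : Bool) (s : ℕ) : 0 ∈ returnValues q A b s s :=
  ⟨[], by simpa using .nil _, by simp⟩

theorem returnValues_cons {q : ℕ} {A : FinAutomaton BSLetter} {b : Bool} {e : ℕ × BSLetter × ℕ} {s' : ℕ} {v : ℤ} (he : e ∈ A.edges)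
    (hst : BSLetter.step e.2.1 = 0) (hv : v ∈ returnValues q A b e.2.2 s') :
    v + sgn b * BSLetter.unit e.2.1 ∈ returnValues q A b e.1 s' := by
  obtain ⟨l, h1, h2⟩ := hv
  refine ⟨(0, e.1) :: l, ?_, List.forall_mem_cons.2 ⟨le_rfl, h2⟩⟩
  have h3 := Walk.cons (q := q) (i := 0) (e := e.2.1) (p := e.1) (p' := e.2.2) he
    (by rw [hst, add_zero]; exact h1)
  convert h3 using 1
  have h4 := sgn_mul_sgn_mul b (BSLetter.unit e.2.1)
  rw [mul_add, h4]
  push_cast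
  simp
  ring

theorem returnValues_excursion {b : Bool} {s p p' r s' : ℕ} {v w : ℤ}
    (he : (s, (BSGen.t, true), p) ∈ A.edges) (hv : v ∈ returnValues q A b p p')
    (he' : (p', (BSGen.t, false), r) ∈ A.edges) (hw : w ∈ returnValues q A b r s') :
    q * v + w ∈ returnValues q A b s s' := by
  obtain ⟨l, h1, h2⟩ := hv
  obtain ⟨m, k1, k2⟩ := hw
  have h3 := h1.shift 1
  have h4 := Walk.cons (q := q) (i := 1) he' (by simpa [BSLetter.step] using k1)
  have h5 := Walk.cons (q := q) (i := 0) he (by simpa [BSLetter.step] using h3.append (by simpa using h4))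
  refine ⟨_, (by convert h5 using 1; simp [BSLetter.unit]; ring), ?_⟩
  intro u hu
  simp only [List.mem_cons, List.mem_append, List.mem_map] at hu
  rcases hu with rfl | ⟨u', hu', rfl⟩ | rfl | hu
  · exact le_rfl
  · have := h2 u' hu'
    simp only
    omega
  · simp
  · exact k2 u hu

/-- `P` collects all states with a return value of the respective sign, and `G` the optimal bounds
of all nonempty sets of return values. These sets satisfy the closure rules, and their suprema do so
as well. -/
theorem exists_slackCert (q : ℕ) [q.AtLeastTwo] (A : FinAutomaton BSLetter) :
    ∃ D P G W, SlackCert q A D P G W := by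
  classical
  have hq2 := PointedNum.two_le q
  -- slack states
  set P : List (Bool × ℕ) := (([true, false].product A.states).filter fun p =>
    ∃ v ∈ returnValues q A p.1 p.2 p.2, 0 < v) with hP
  have hPv : ∀ p : Bool × ℕ, ∃ v : ℤ, 0 < v ∧ (p ∈ P → v ∈ returnValues q A p.1 p.2 p.2) := by
    intro p
    by_cases hp : p ∈ P
    · obtain ⟨v, h1, h2⟩ := of_decide_eq_true (List.mem_filter.1 hp).2
      exact ⟨v, h2, fun _ => h1⟩
    · exact ⟨1, one_pos, fun h => absurd h hp⟩
  choose v hv0 hv using hPv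
  -- A common multiple of chosen values, so that each loop, suitably repeated, contributes exactly
  -- `± D`.
  set D : ℕ := (P.map fun p => (v p).toNat).prod with hD
  have hD0 : 0 < D := by
    refine List.prod_pos fun x hx => ?_
    obtain ⟨p, -, rfl⟩ := List.mem_map.1 hx
    have := hv0 p
    omega
  have hloop : ∀ p, ∃ w, p ∈ P → A.Run p.2 w p.2 ∧
      (BaumslagSolitar.toPointed q (BaumslagSolitar.ofWord 1 q w)).num = (sgn p.1 * D : ℤ) ∧
      (BaumslagSolitar.toPointed q (BaumslagSolitar.ofWord 1 q w)).pos = 0 := by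
    intro p
    by_cases hp : p ∈ P
    · obtain ⟨l, h1, -⟩ := hv p hp
      obtain ⟨k, hk⟩ : (v p).toNat ∣ D := List.dvd_prod (List.mem_map_of_mem hp)
      obtain ⟨l', h2, -⟩ := h1.nsmul k
      obtain ⟨w, h3, h4, h5⟩ := BaumslagSolitar.exists_run_of_walk h2
      refine ⟨w, fun _ => ⟨h3, ?_, ?_⟩⟩
      · simp only [zpow_zero, mul_one] at h5
        rw [← h5, hk]
        have := hv0 p
        have h6 : ((v p).toNat : ℤ) = v p := by omega
        push_cast [h6]
        ring
      · simp only at h4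
        omega
    · exact ⟨[], fun h => absurd h hp⟩
  choose w hw using hloop
  -- Empty sets are left out, since their supremum is a meaningless default value.
  set G : List (Bool × ℕ × ℕ × Option (ℕ × ℕ)) :=
    (([true, false].product (A.states.product A.states)).filter fun g =>
      (returnValues q A g.1 g.2.1 g.2.2).Nonempty).map
      fun g => (g.1, g.2.1, g.2.2, optimalBound (returnValues q A g.1 g.2.1 g.2.2)) with hG
  have hb : ∀ b : Bool, b ∈ [true, false] := by intro b; cases b <;> simp
  have hmemG : ∀ b s s', s ∈ A.states → s' ∈ A.states → (returnValues q A b s s').Nonempty →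
      (b, s, s', optimalBound (returnValues q A b s s')) ∈ G := by
    intro b s s' hs hs' hne
    refine List.mem_map.2 ⟨(b, s, s'), List.mem_filter.2 ⟨?_, decide_eq_true hne⟩, rfl⟩
    exact List.mem_product.2 ⟨hb b, List.mem_product.2 ⟨hs, hs'⟩⟩
  have hofG : ∀ b s s' β, (b, s, s', β) ∈ G → s ∈ A.states ∧ s' ∈ A.states ∧
      (returnValues q A b s s').Nonempty ∧ β = optimalBound (returnValues q A b s s') := by
    intro b s s' β hg
    obtain ⟨⟨b₁, s₁, s₂⟩, hx, he⟩ := List.mem_map.1 hg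
    simp only [Prod.mk.injEq] at he
    obtain ⟨rfl, rfl, rfl, rfl⟩ := he
    obtain ⟨h1, h2⟩ := List.mem_filter.1 hx
    obtain ⟨-, h3⟩ := List.mem_product.1 h1
    obtain ⟨h4, h5⟩ := List.mem_product.1 h3
    exact ⟨h4, h5, of_decide_eq_true h2, rfl⟩
  refine ⟨D, P, G, P.map w, hD0, ?_, ?_, ?_, ?_, ?_⟩
  · intro p hp
    exact ⟨w p, List.mem_map_of_mem hp, hw p hp⟩
  · intro s hs b _
    refine ⟨_, hmemG b s s hs hs ⟨0, returnValues_nil b s⟩, rfl, rfl, rfl, ?_⟩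
    refine boundLe_optimalBound (V := {0}) (fun p hp => ?_) (by simp)
      (by simpa using returnValues_nil b s)
    obtain rfl : (0, 0) = p := by simpa using hp
    simp
  · rintro e he ⟨b, s₁, s', β⟩ hg hst rfl
    obtain ⟨g1, g2, g3, rfl⟩ := hofG _ _ _ _ hg
    simp only at g1 g2 g3 ⊢
    obtain ⟨v₀, hv₀⟩ := g3
    refine ⟨_, hmemG b e.1 s' (A.mem_states he).1 g2 ⟨_, returnValues_cons he hst hv₀⟩, rfl, rfl,
      rfl, ?_⟩
    have hgs := BSLetter.gain_sub b e.2.1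
    refine boundLe_optimalBound (V := (fun v => v + sgn b * BSLetter.unit e.2.1) ''
      returnValues q A b e.2.2 s') (fun p hp => ?_) (fun hn => ?_)
      (Set.image_subset_iff.2 fun v hv => returnValues_cons he hst hv)
    · cases hβ : optimalBound (returnValues q A b e.2.2 s') with
      | none => simp [boundAdd, hβ] at hp
      | some r =>
        refine ⟨_, optimalBound_mem ⟨v₀, hv₀⟩ hβ, ?_⟩
        simp only [boundAdd, hβ, Option.bind_some, Option.map_some, Option.some.injEq] at hp
        subst hp
        simp only
        rw [← hgs]
        push_cast
        ring
    · cases hβ : optimalBound (returnValues q A b e.2.2 s') with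
      | some r => simp [boundAdd, hβ] at hn
      | none =>
        refine fun ⟨B, hB⟩ => optimalBound_none hβ ⟨B - sgn b * BSLetter.unit e.2.1, fun v hv => ?_⟩
        have := hB ⟨v, hv, rfl⟩
        simp only at this
        omega
  · rintro ⟨s, e, _⟩ he ⟨b, p, p', β⟩ hg ⟨_, e', _⟩ he' ⟨b', r, s', β'⟩ hh rfl rfl rfl rfl rfl rfl
    obtain ⟨g1, g2, g3, rfl⟩ := hofG _ _ _ _ hg
    obtain ⟨k1, k2, k3, rfl⟩ := hofG _ _ _ _ hh
    simp only at g1 g2 g3 k1 k2 k3 ⊢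
    obtain ⟨v₀, hv₀⟩ := g3
    obtain ⟨w₀, hw₀⟩ := k3
    refine ⟨_, hmemG b s s' (A.mem_states he).1 k2 ⟨_, returnValues_excursion he hv₀ he' hw₀⟩, rfl,
      rfl, rfl, ?_⟩
    refine boundLe_optimalBound (V := Set.image2 (fun v w => q * v + w)
      (returnValues q A b p p') (returnValues q A b r s'))
      (fun x hx => ?_) (fun hn => ?_)
      (Set.image2_subset_iff.2 fun v hv w hw => returnValues_excursion he hv he' hw)
    · cases hβ : optimalBound (returnValues q A b p p') with
      | none => simp [boundAdd, hβ] at hx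
      | some y =>
        cases hβ' : optimalBound (returnValues q A b r s') with
        | none => simp [boundAdd, hβ'] at hx
        | some y' =>
          refine ⟨_, optimalBound_mem ⟨v₀, hv₀⟩ hβ, _, optimalBound_mem ⟨w₀, hw₀⟩ hβ', ?_⟩
          simp only [boundAdd, hβ, hβ', Option.bind_some, Option.map_some, Option.some.injEq] at hx
          subst hx
          simp only
          push_cast
          ring
    · rintro ⟨B, hB⟩
      cases hβ : optimalBound (returnValues q A b p p') with
      | none =>
        -- A value `v > 0` satisfies `v ≤ q * v`, so a bound for `q * v + w₀` also bounds `v`.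
        refine optimalBound_none hβ ⟨max 0 (B - w₀), fun v hv => ?_⟩
        have := hB ⟨v, hv, w₀, hw₀, rfl⟩
        simp only at this
        by_contra hlt
        push Not at hlt
        have h0 := le_max_left 0 (B - w₀)
        have h1 := le_max_right 0 (B - w₀)
        have : v ≤ q * v := by nlinarith
        omega
      | some y =>
        cases hβ' : optimalBound (returnValues q A b r s') with
        | some y' => simp [boundAdd, hβ, hβ'] at hn
        | none =>
          refine optimalBound_none hβ' ⟨B - q * v₀, fun w hw => ?_⟩
          have := hB ⟨v₀, hv₀, w, hw, rfl⟩
          simp only at this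
          omega
  · rintro ⟨b, s, s', β⟩ hg (rfl : s = s')
    obtain ⟨g1, g2, g3, rfl⟩ := hofG _ _ _ _ hg
    simp only at g1 g3 ⊢
    by_cases hpos : ∃ v ∈ returnValues q A b s s, 0 < v
    · exact Or.inl (List.mem_filter.2 ⟨List.mem_product.2 ⟨hb b, g1⟩, decide_eq_true hpos⟩)
    · right
      push Not at hpos
      cases hβ : optimalBound (returnValues q A b s s) with
      | none => exact absurd ⟨0, fun v hv => hpos v hv⟩ (optimalBound_none hβ)
      | some y =>
        have := hpos _ (optimalBound_mem g3 hβ)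
        simp only [boundLe, decide_eq_true_eq]
        omega

end

/-! ### Primitive recursive functions and predicates -/

attribute [fun_prop] Primrec
attribute [fun_prop] PrimrecPred

section

variable {α β γ σ : Type*} [Primcodable α] [Primcodable β] [Primcodable γ] [Primcodable σ]

@[fun_prop]
theorem Primrec.id_fun : Primrec fun x : α => x := Primrec.id

@[fun_prop]
theorem Primrec.const_fun (x : σ) : Primrec fun _ : α => x := Primrec.const x

@[fun_prop]
theorem Primrec.comp_fun {f : β → σ} {g : α → β} (hf : Primrec f) (hg : Primrec g) :
    Primrec fun a => f (g a) := hf.comp hg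

@[fun_prop]
theorem Primrec.fst_fun {f : α → β × γ} (hf : Primrec f) : Primrec fun a => (f a).1 :=
  Primrec.fst.comp hf

@[fun_prop]
theorem Primrec.snd_fun {f : α → β × γ} (hf : Primrec f) : Primrec fun a => (f a).2 :=
  Primrec.snd.comp hf

@[fun_prop]
theorem Primrec.pair_fun {f : α → β} {g : α → γ} (hf : Primrec f) (hg : Primrec g) :
    Primrec fun a => (f a, g a) := hf.pair hg

@[fun_prop]
theorem Primrec.add_fun {f g : α → ℕ} (hf : Primrec f) (hg : Primrec g) :
    Primrec fun a => f a + g a := Primrec.nat_add.comp hf hg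

@[fun_prop]
theorem Primrec.sub_fun {f g : α → ℕ} (hf : Primrec f) (hg : Primrec g) :
    Primrec fun a => f a - g a := Primrec.nat_sub.comp hf hg

@[fun_prop]
theorem Primrec.mul_fun {f g : α → ℕ} (hf : Primrec f) (hg : Primrec g) :
    Primrec fun a => f a * g a := Primrec.nat_mul.comp hf hg

@[fun_prop]
theorem Primrec.div_fun {f g : α → ℕ} (hf : Primrec f) (hg : Primrec g) :
    Primrec fun a => f a / g a := Primrec.nat_div.comp hf hg

@[fun_prop]
theorem Primrec.mod_fun {f g : α → ℕ} (hf : Primrec f) (hg : Primrec g) :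
    Primrec fun a => f a % g a := Primrec.nat_mod.comp hf hg

@[fun_prop]
theorem Primrec.pow_fun {f g : α → ℕ} (hf : Primrec f) (hg : Primrec g) :
    Primrec fun a => f a ^ g a := (Primrec₂.unpaired'.1 Nat.Primrec.pow).comp hf hg

@[fun_prop]
theorem Primrec.length_fun {f : α → List β} (hf : Primrec f) : Primrec fun a => (f a).length :=
  Primrec.list_length.comp hf

@[fun_prop]
theorem Primrec.append_fun {f g : α → List β} (hf : Primrec f) (hg : Primrec g) :
    Primrec fun a => f a ++ g a := Primrec.list_append.comp hf hg

@[fun_prop]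
theorem Primrec.cons_fun {f : α → β} {g : α → List β} (hf : Primrec f) (hg : Primrec g) :
    Primrec fun a => f a :: g a := Primrec.list_cons.comp hf hg

@[fun_prop]
theorem Primrec.range_fun {f : α → ℕ} (hf : Primrec f) : Primrec fun a => List.range (f a) :=
  Primrec.list_range.comp hf

@[fun_prop]
theorem Primrec.inl_fun {f : α → β} (hf : Primrec f) : Primrec fun a => (Sum.inl (f a) : β ⊕ γ) :=
  Primrec.sumInl.comp hf

@[fun_prop]
theorem Primrec.inr_fun {f : α → γ} (hf : Primrec f) : Primrec fun a => (Sum.inr (f a) : β ⊕ γ) :=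
  Primrec.sumInr.comp hf

@[fun_prop]
theorem Primrec.bnot_fun {f : α → Bool} (hf : Primrec f) : Primrec fun a => !(f a) :=
  Primrec.not.comp hf

theorem Primrec.map_fun {f : α → List β} {g : α → β → σ} (hf : Primrec f)
    (hg : Primrec fun x : α × β => g x.1 x.2) : Primrec fun a => (f a).map (g a) :=
  Primrec.list_map hf hg

theorem Primrec.flatMap_fun {f : α → List β} {g : α → β → List σ} (hf : Primrec f)
    (hg : Primrec fun x : α × β => g x.1 x.2) : Primrec fun a => (f a).flatMap (g a) :=
  Primrec.list_flatMap hf hg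

@[fun_prop]
theorem PrimrecPred.le_fun {f g : α → ℕ} (hf : Primrec f) (hg : Primrec g) :
    PrimrecPred fun a => f a ≤ g a := Primrec.nat_le.comp hf hg

@[fun_prop]
theorem PrimrecPred.lt_fun {f g : α → ℕ} (hf : Primrec f) (hg : Primrec g) :
    PrimrecPred fun a => f a < g a := Primrec.nat_lt.comp hf hg

@[fun_prop]
theorem PrimrecPred.eq_fun {f g : α → β} (hf : Primrec f) (hg : Primrec g) :
    PrimrecPred fun a => f a = g a := Primrec.eq.comp hf hg

@[fun_prop]
theorem PrimrecPred.and_fun {p r : α → Prop} (hp : PrimrecPred p) (hr : PrimrecPred r) :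
    PrimrecPred fun a => p a ∧ r a := hp.and hr

@[fun_prop]
theorem PrimrecPred.or_fun {p r : α → Prop} (hp : PrimrecPred p) (hr : PrimrecPred r) :
    PrimrecPred fun a => p a ∨ r a := hp.or hr

@[fun_prop]
theorem PrimrecPred.not_fun {p : α → Prop} (hp : PrimrecPred p) :
    PrimrecPred fun a => ¬ p a := hp.not

theorem PrimrecPred.imp_fun {p r : α → Prop} (hp : PrimrecPred p) (hr : PrimrecPred r) :
    PrimrecPred fun a => p a → r a := (hp.not.or hr).of_eq fun _ => imp_iff_not_or.symm

theorem PrimrecPred.forall_mem {f : α → List β} {p : α → β → Prop} (hf : Primrec f)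
    (hp : PrimrecPred fun x : α × β => p x.1 x.2) : PrimrecPred fun a => ∀ b ∈ f a, p a b := by
  have h : PrimrecRel fun (b : β) (a : α) => p a b := PrimrecPred.primrecRel
    (p := fun x : β × α => p x.2 x.1) (hp.comp (f := fun x : β × α => (x.2, x.1)) (by fun_prop))
  exact h.forall_mem_list.comp hf Primrec.id

theorem PrimrecPred.exists_mem {f : α → List β} {p : α → β → Prop} (hf : Primrec f)
    (hp : PrimrecPred fun x : α × β => p x.1 x.2) : PrimrecPred fun a => ∃ b ∈ f a, p a b := by
  have h : PrimrecRel fun (b : β) (a : α) => p a b := PrimrecPred.primrecRel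
    (p := fun x : β × α => p x.2 x.1) (hp.comp (f := fun x : β × α => (x.2, x.1)) (by fun_prop))
  exact h.exists_mem_list.comp hf Primrec.id

theorem PrimrecPred.exists_lt_fun {f : α → ℕ} {p : α → ℕ → Prop} (hf : Primrec f)
    (hp : PrimrecPred fun x : α × ℕ => p x.1 x.2) : PrimrecPred fun a => ∃ b < f a, p a b :=
  (PrimrecPred.exists_mem (Primrec.range_fun hf) hp).of_eq fun _ => by simp

@[fun_prop]
theorem PrimrecPred.mem_fun {f : α → β} {g : α → List β} (hf : Primrec f) (hg : Primrec g) :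
    PrimrecPred fun a => f a ∈ g a :=
  (PrimrecPred.exists_mem (p := fun a b => b = f a) hg (by fun_prop)).of_eq fun a => by simp

@[fun_prop]
theorem PrimrecPred.modEq_fun {n f g : α → ℕ} (hn : Primrec n) (hf : Primrec f) (hg : Primrec g) :
    PrimrecPred fun a => f a ≡ g a [MOD n a] := by
  unfold Nat.ModEq
  fun_prop

@[fun_prop]
theorem Primrec.decide_fun {p : α → Prop} [DecidablePred p] (hp : PrimrecPred p) :
    Primrec fun a => decide (p a) := hp.decide

theorem Primrec.ite_fun {c : α → Prop} [DecidablePred c] {f g : α → σ} (hc : PrimrecPred c)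
    (hf : Primrec f) (hg : Primrec g) : Primrec fun a => if c a then f a else g a :=
  Primrec.ite hc hf hg

end

/-! ### Computing with automata -/

section

variable {α β : Type} [Primcodable α] [Primcodable β]

@[fun_prop]
theorem FinAutomaton.primrec_init {f : α → FinAutomaton β} (hf : Primrec f) :
    Primrec fun a => (f a).init :=
  Primrec.fst.comp ((Primrec.of_equiv (e := FinAutomaton.equivTuple β)).comp hf)

@[fun_prop]
theorem FinAutomaton.primrec_final {f : α → FinAutomaton β} (hf : Primrec f) :
    Primrec fun a => (f a).final :=
  Primrec.fst.comp (Primrec.snd.comp ((Primrec.of_equiv (e := FinAutomaton.equivTuple β)).comp hf))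

@[fun_prop]
theorem FinAutomaton.primrec_edges {f : α → FinAutomaton β} (hf : Primrec f) :
    Primrec fun a => (f a).edges :=
  Primrec.snd.comp (Primrec.snd.comp ((Primrec.of_equiv (e := FinAutomaton.equivTuple β)).comp hf))

@[fun_prop]
theorem FinAutomaton.primrec_states {f : α → FinAutomaton β} (hf : Primrec f) :
    Primrec fun a => (f a).states := by
  have h1 : Primrec fun a => (f a).edges.map fun e => e.1 := Primrec.map_fun (by fun_prop) (by fun_prop)
  have h2 : Primrec fun a => (f a).edges.map fun e => e.2.2 :=
    Primrec.map_fun (by fun_prop) (by fun_prop)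
  unfold FinAutomaton.states
  fun_prop

/-- The states from which a word leads to a given state. -/
def FinAutomaton.sources {β : Type} [DecidableEq β] (A : FinAutomaton β) (w : List β) (f : ℕ) : List ℕ :=
  w.foldr (fun x S => A.edges.flatMap fun e => if e.2.1 = x ∧ e.2.2 ∈ S then [e.1] else []) [f]

theorem FinAutomaton.mem_sources {β : Type} [DecidableEq β] (A : FinAutomaton β) (w : List β)
    (p f : ℕ) : p ∈ A.sources w f ↔ A.Run p w f := by
  induction w generalizing p with
  | nil =>
    constructor
    · intro h
      obtain rfl : p = f := by simpa [sources] using h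
      exact .nil _
    · intro h
      cases h
      simp [sources]
  | cons x w ih =>
    have h1 : A.sources (x :: w) f =
        A.edges.flatMap fun e => if e.2.1 = x ∧ e.2.2 ∈ A.sources w f then [e.1] else [] := rfl
    rw [h1, List.mem_flatMap]
    constructor
    · rintro ⟨⟨p₁, y, p₂⟩, he, hp⟩
      split_ifs at hp with hc
      · simp only [List.mem_singleton] at hp
        obtain ⟨rfl, hc⟩ := hc
        subst hp
        exact .cons he ((ih _).1 hc)
      · simp at hp
    · intro h
      cases h with
      | @cons _ p' _ _ _ he h =>
        exact ⟨_, he, by rw [if_pos ⟨rfl, (ih _).2 h⟩]; simp⟩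

end

section

variable {α β : Type} [Primcodable α] [Primcodable β]

@[fun_prop]
theorem FinAutomaton.primrec_sources [DecidableEq β] {A : α → FinAutomaton β} {w : α → List β} {f : α → ℕ}
    (hA : Primrec A) (hw : Primrec w) (hf : Primrec f) :
    Primrec fun a => (A a).sources (w a) (f a) := by
  unfold FinAutomaton.sources
  refine Primrec.list_foldr (h := fun (a : α) (p : β × List ℕ) => (A a).edges.flatMap fun e =>
    if e.2.1 = p.1 ∧ e.2.2 ∈ p.2 then [e.1] else []) hw (g := fun a => [f a])
    (by fun_prop) ?_
  refine Primrec.flatMap_fun (g := fun (x : α × (β × List ℕ)) (e : ℕ × β × ℕ) =>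
    if e.2.1 = x.2.1 ∧ e.2.2 ∈ x.2.2 then [e.1] else []) (f := fun x => (A x.1).edges)
    (by fun_prop) ?_
  exact Primrec.ite_fun (by fun_prop) (by fun_prop) (by fun_prop)

@[fun_prop]
theorem FinAutomaton.primrecPred_run {A : α → FinAutomaton β} {w : α → List β} {p f : α → ℕ}
    (hA : Primrec A) (hw : Primrec w) (hp : Primrec p) (hf : Primrec f) :
    PrimrecPred fun a => (A a).Run (p a) (w a) (f a) := by
  classical
  refine PrimrecPred.of_eq (p := fun a => p a ∈ (A a).sources (w a) (f a)) (by fun_prop) fun a => ?_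
  exact FinAutomaton.mem_sources _ _ _ _

@[fun_prop]
theorem FinAutomaton.primrecPred_language {A : α → FinAutomaton β} {w : α → List β}
    (hA : Primrec A) (hw : Primrec w) : PrimrecPred fun a => w a ∈ (A a).language :=
  PrimrecPred.exists_mem (p := fun a f => (A a).Run (A a).init (w a) f) (by fun_prop) (by fun_prop)

end

/-! ### Recursively enumerable predicates -/

/-- Unbounded search through the codes of `β`: decode and test. -/
theorem REPred.exists_of_primrec {α β : Type*} [Primcodable α] [Primcodable β] {p : α × β → Prop}
    (hp : PrimrecPred p) : REPred fun a => ∃ b, p (a, b) := by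
  obtain ⟨_, hp⟩ := hp.computablePred
  let g : α → ℕ → Bool := fun a n =>
    ((Encodable.decode n : Option β).map fun b => decide (p (a, b))).getD false
  have hg : Computable₂ g := by
    refine Computable.option_getD (Computable.option_map (Computable.decode.comp Computable.snd) ?_)
      (Computable.const false)
    exact hp.comp (Computable.pair (Computable.fst.comp Computable.fst) Computable.snd)
  have h : Partrec fun a => Nat.rfind fun n => Part.some (g a n) := Partrec.rfind hg.partrec
  refine h.dom_re.of_eq fun a => ?_
  refine Iff.trans Nat.rfind_dom ?_
  constructor
  · rintro ⟨n, hn, -⟩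
    have hn' : g a n = true := by simpa using hn
    simp only [g] at hn'
    cases hd : (Encodable.decode n : Option β) with
    | none => simp [hd] at hn'
    | some b => exact ⟨b, by simpa [hd] using hn'⟩
  · rintro ⟨b, hb⟩
    refine ⟨Encodable.encode b, ?_, fun _ => trivial⟩
    simp [g, hb]

/-! ### Finite descriptions of elements -/

/-- The tuple `(a, b, s, i, j)` describes the element `((a - b) / q ^ s, i - j)`. -/
abbrev ElemData : Type := ℕ × ℕ × ℕ × ℕ × ℕ

namespace ElemData

/-- The number that a description represents. -/
def num (q : ℕ) (d : ElemData) : ℚ := ((d.1 : ℚ) - d.2.1) / (q : ℚ) ^ d.2.2.1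

/-- The cursor that a description represents. -/
def pos (d : ElemData) : ℤ := (d.2.2.2.1 : ℤ) - d.2.2.2.2

/-- The description of the product of a letter and an element. -/
def letterMul (q : ℕ) : BSLetter → ElemData → ElemData
  | (BSGen.a, true), d => (d.1 + q ^ d.2.2.1, d.2)
  | (BSGen.a, false), d => (d.1, d.2.1 + q ^ d.2.2.1, d.2.2)
  | (BSGen.t, true), d => (q * d.1, q * d.2.1, d.2.2.1, d.2.2.2.1 + 1, d.2.2.2.2)
  | (BSGen.t, false), d => (d.1, d.2.1, d.2.2.1 + 1, d.2.2.2.1, d.2.2.2.2 + 1)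

/-- The description of the element that a word represents. -/
def ofWord (q : ℕ) (w : List BSLetter) : ElemData := w.foldr (letterMul q) (0, 0, 0, 0, 0)

/-- Two descriptions represent elements with congruent numbers and cursors. -/
def Congr (q n k : ℕ) (d d' : ElemData) : Prop :=
  d.1 * q ^ d'.2.2.1 + d'.2.1 * q ^ d.2.2.1 ≡ d'.1 * q ^ d.2.2.1 + d.2.1 * q ^ d'.2.2.1 [MOD n] ∧
    d.2.2.2.1 + d'.2.2.2.2 ≡ d'.2.2.2.1 + d.2.2.2.2 [MOD k]

section

variable {q : ℕ} [NeZero q]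

theorem num_sub_num (d d' : ElemData) : num q d - num q d' =
    (((d.1 * q ^ d'.2.2.1 + d'.2.1 * q ^ d.2.2.1 : ℕ) : ℤ) -
      ((d'.1 * q ^ d.2.2.1 + d.2.1 * q ^ d'.2.2.1 : ℕ) : ℤ) : ℤ) / (q : ℚ) ^ (d.2.2.1 + d'.2.2.1) := by
  have hq : (q : ℚ) ≠ 0 := NeZero.ne _
  unfold num
  push_cast
  field_simp
  ring

/-- `n ∣ q ^ k - 1` makes `n` coprime to `q`, so the denominators, powers of `q`, can be cleared
without changing divisibility by `n`. -/
theorem modEq_iff {n k : ℕ} (hk : 0 < k) (h : n ∣ q ^ k - 1) (d d' : ElemData) :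
    ModEq q n (num q d) (num q d') ↔
      d.1 * q ^ d'.2.2.1 + d'.2.1 * q ^ d.2.2.1 ≡ d'.1 * q ^ d.2.2.1 + d.2.1 * q ^ d'.2.2.1 [MOD n] := by
  have hq : (q : ℚ) ≠ 0 := NeZero.ne _
  have hcop : IsCoprime (n : ℤ) q := by
    obtain ⟨c, hc⟩ := h
    have h1 : 1 ≤ q ^ k := Nat.pos_of_ne_zero (pow_ne_zero _ (NeZero.ne q))
    refine ⟨-c, (q : ℤ) ^ (k - 1), ?_⟩
    have h2 : q ^ (k - 1) * q = q ^ k := by rw [← pow_succ]; congr 1; omega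
    have h3 : q ^ k = n * c + 1 := by omega
    have h4 : (q : ℤ) ^ (k - 1) * q = n * c + 1 := by exact_mod_cast h2.trans h3
    linarith
  unfold ModEq
  rw [num_sub_num, Nat.modEq_iff_dvd]
  set X : ℤ := ((d.1 * q ^ d'.2.2.1 + d'.2.1 * q ^ d.2.2.1 : ℕ) : ℤ)
  set Y : ℤ := ((d'.1 * q ^ d.2.2.1 + d.2.1 * q ^ d'.2.2.1 : ℕ) : ℤ)
  rw [← dvd_neg, neg_sub]
  constructor
  · rintro ⟨z, hz, h1⟩
    obtain ⟨i, w, h2⟩ := ZInv.exists_mul_pow hz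
    refine (hcop.pow_right (n := i)).dvd_of_dvd_mul_right
      (Dvd.intro (w * (q : ℤ) ^ (d.2.2.1 + d'.2.2.1)) ?_)
    have h3 : ((X - Y : ℤ) : ℚ) = n * z * (q : ℚ) ^ (d.2.2.1 + d'.2.2.1) := by
      rw [← h1]
      field_simp
    have : ((n * (w * (q : ℤ) ^ (d.2.2.1 + d'.2.2.1)) : ℤ) : ℚ) = (((X - Y) * (q : ℤ) ^ i : ℤ) : ℚ) := by
      rw [Int.cast_mul (X - Y), h3]
      push_cast
      rw [← h2]
      ring
    exact_mod_cast this
  · rintro ⟨w, hw⟩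
    refine ⟨w * (q : ℚ) ^ (-((d.2.2.1 + d'.2.2.1 : ℕ) : ℤ)),
      mul_mem (intCast_mem _ _) (PointedNum.zpow_mem q _), ?_⟩
    rw [hw, zpow_neg, zpow_natCast]
    push_cast
    ring

theorem congr_iff {n k : ℕ} (hk : 0 < k) (h : n ∣ q ^ k - 1) (d d' : ElemData) :
    Congr q n k d d' ↔ ModEq q n (num q d) (num q d') ∧ (k : ℤ) ∣ pos d - pos d' := by
  rw [modEq_iff hk h]
  refine and_congr_right fun _ => ?_
  rw [Nat.modEq_iff_dvd, ← dvd_neg]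
  unfold pos
  push_cast
  ring_nf

/-- With moduli `0`, congruence is equality; the same predicate thus serves to compare elements
exactly. -/
theorem congr_zero_iff (d d' : ElemData) :
    Congr q 0 0 d d' ↔ num q d = num q d' ∧ pos d = pos d' := by
  have hq : (q : ℚ) ≠ 0 := NeZero.ne _
  unfold Congr
  rw [Nat.modEq_zero_iff, Nat.modEq_zero_iff, ← sub_eq_zero (a := num q d), num_sub_num,
    div_eq_zero_iff, or_iff_left (pow_ne_zero _ hq), Int.cast_eq_zero, sub_eq_zero, Int.natCast_inj]
  refine and_congr_right fun _ => ?_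
  unfold pos
  omega

theorem num_letterMul (e : BSLetter) (d : ElemData) :
    num q (letterMul q e d) = BSLetter.unit e + (q : ℚ) ^ BSLetter.step e * num q d := by
  have hq : (q : ℚ) ≠ 0 := NeZero.ne _
  rcases e with ⟨_ | _, _ | _⟩ <;> simp [letterMul, num, BSLetter.unit, BSLetter.step] <;>
    field_simp <;> ring

theorem pos_letterMul {q : ℕ} (e : BSLetter) (d : ElemData) :
    pos (letterMul q e d) = BSLetter.step e + pos d := by
  rcases e with ⟨_ | _, _ | _⟩ <;> simp [letterMul, pos, BSLetter.step] <;> ring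

theorem toPointed_ofWord {q : ℕ} [q.AtLeastTwo] (w : List BSLetter) :
    (BaumslagSolitar.toPointed q (BaumslagSolitar.ofWord 1 q w)).num = num q (ofWord q w) ∧
      (BaumslagSolitar.toPointed q (BaumslagSolitar.ofWord 1 q w)).pos = pos (ofWord q w) := by
  induction w with
  | nil =>
    rw [BaumslagSolitar.toPointed_ofWord_nil]
    simp [ofWord, num, pos]
  | cons e w ih =>
    have h := BaumslagSolitar.toPointed_ofWord_cons (q := q) e w
    have h1 : ofWord q (e :: w) = letterMul q e (ofWord q w) := rfl
    rw [h.1, h.2, h1, num_letterMul, pos_letterMul, ih.1, ih.2]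
    exact ⟨rfl, rfl⟩

end

end ElemData

/-- The tuple `(s, N, L, c, l)` describes a candidate for a pointed expansion. -/
abbrev PETuple : Type := Bool × ℕ × ℕ × ℕ × ℕ

namespace PETuple

/-- The word of a tuple. -/
def word (q : ℕ) [NeZero q] (t : PETuple) : List (PELetter q) :=
  peWord q t.1 t.2.1 t.2.2.1 t.2.2.2.1 t.2.2.2.2

/-- The tuple describes a pointed expansion. -/
def Valid (q : ℕ) (t : PETuple) : Prop := IsPE q t.1 t.2.1 t.2.2.1 t.2.2.2.1 t.2.2.2.2

/-- The description of the element with a given pointed expansion. -/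
def data (t : PETuple) : ElemData :=
  (if t.1 = true then 0 else t.2.1, if t.1 = true then t.2.1 else 0, t.2.2.1, t.2.2.2.1, t.2.2.1)

/-- A list of tuples that contains all valid ones that describe words of length less than `b`. -/
def below (q b : ℕ) : List PETuple :=
  (List.range b).flatMap fun l => (List.range (q ^ l)).flatMap fun N =>
    (List.range l).flatMap fun L => (List.range l).flatMap fun c => [(false, N, L, c, l), (true, N, L, c, l)]

section

variable {q : ℕ}

theorem num_data (t : PETuple) : ElemData.num q t.data = peNum q t.1 t.2.1 t.2.2.1 := by
  obtain ⟨_ | _, N, L, c, l⟩ := t <;> simp [data, ElemData.num, peNum, sgn, neg_div]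

theorem pos_data (t : PETuple) : ElemData.pos t.data = t.2.2.2.1 - t.2.2.1 := rfl

theorem num_data_mem (t : PETuple) : ElemData.num q t.data ∈ ZInv q := by
  rw [num_data]
  exact peNum_mem _ _ _

theorem mem_below {b : ℕ} {t : PETuple} (h : t.Valid q) (hb : t.2.2.2.2 < b) : t ∈ below q b := by
  obtain ⟨s, N, L, c, l⟩ := t
  simp only [below, List.mem_flatMap, List.mem_range]
  exact ⟨l, hb, N, h.2.2.1, L, h.1, c, h.2.1, by cases s <;> simp⟩

theorem word_mem_language_iff [q.AtLeastTwo] (A : FinAutomaton (PELetter q)) {t : PETuple}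
    (h : t.Valid q) : t.word q ∈ A.language ↔ BaumslagSolitar.memPred q
      (BaumslagSolitar.peSubset q A) (ElemData.num q t.data) (ElemData.pos t.data) := by
  rw [num_data, pos_data]
  exact (BaumslagSolitar.memPred_peSubset_iff A h).symm

end

end PETuple

theorem FiniteSuffixes.exists_mem_below {q : ℕ} [q.AtLeastTwo] {P : ℚ → ℤ → Prop} {B : ℕ}
    (h : FiniteSuffixes q P B) {x : ℚ} {m : ℤ} (hx : x ∈ ZInv q) (hP : P x m) :
    ∃ t ∈ PETuple.below q B, t.Valid q ∧ P (ElemData.num q t.data) (ElemData.pos t.data) := by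
  obtain ⟨s, N, L, c, l, h1, h2, h3⟩ := h.exists_small hx hP
  refine ⟨(s, N, L, c, l), PETuple.mem_below h2 h1, h2, ?_⟩
  rw [PETuple.num_data, PETuple.pos_data]
  exact h3

/-! ### Primitive recursive operations on descriptions -/

section

variable {α : Type} [Primcodable α] {q : ℕ}

@[fun_prop]
theorem ElemData.primrec_letterMul {e : α → BSLetter} {d : α → ElemData} (he : Primrec e)
    (hd : Primrec d) : Primrec fun x => ElemData.letterMul q (e x) (d x) := by
  classical
  refine Primrec.of_eq (f := fun x => if e x = (BSGen.a, true) then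
      ((d x).1 + q ^ (d x).2.2.1, (d x).2) else if e x = (BSGen.a, false) then
      ((d x).1, (d x).2.1 + q ^ (d x).2.2.1, (d x).2.2) else if e x = (BSGen.t, true) then
      (q * (d x).1, q * (d x).2.1, (d x).2.2.1, (d x).2.2.2.1 + 1, (d x).2.2.2.2) else
      ((d x).1, (d x).2.1, (d x).2.2.1 + 1, (d x).2.2.2.1, (d x).2.2.2.2 + 1)) ?_ fun x => ?_
  · exact Primrec.ite_fun (by fun_prop) (by fun_prop) (Primrec.ite_fun (by fun_prop) (by fun_prop)
      (Primrec.ite_fun (by fun_prop) (by fun_prop) (by fun_prop)))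
  · generalize e x = e
    rcases e with ⟨_ | _, _ | _⟩ <;> simp [ElemData.letterMul]

@[fun_prop]
theorem ElemData.primrec_ofWord {w : α → List BSLetter} (hw : Primrec w) :
    Primrec fun x => ElemData.ofWord q (w x) := by
  unfold ElemData.ofWord
  exact Primrec.list_foldr (h := fun (_ : α) (p : BSLetter × ElemData) => ElemData.letterMul q p.1 p.2)
    (g := fun _ => (0, 0, 0, 0, 0)) hw (by fun_prop)
    (show Primrec fun x : α × (BSLetter × ElemData) => ElemData.letterMul q x.2.1 x.2.2 by fun_prop)

@[fun_prop]
theorem ElemData.primrecPred_congr {n k : α → ℕ} {d d' : α → ElemData} (hn : Primrec n)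
    (hk : Primrec k) (hd : Primrec d) (hd' : Primrec d') :
    PrimrecPred fun x => ElemData.Congr q (n x) (k x) (d x) (d' x) := by
  unfold ElemData.Congr
  fun_prop

@[fun_prop]
theorem PETuple.primrec_word [NeZero q] {t : α → PETuple} (ht : Primrec t) :
    Primrec fun x => (t x).word q := by
  unfold PETuple.word peWord PEWord.ofNat
  refine Primrec.cons_fun (by fun_prop) ?_
  refine Primrec.map_fun (g := fun _ y => Sum.inr y) (Primrec.map_fun
    (g := fun x j => (Fin.ofNat q ((t x).2.1 / q ^ ((t x).2.2.2.2 - 1 - j)),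
      decide ((t x).2.2.2.2 - 1 - j = (t x).2.2.1), decide ((t x).2.2.2.2 - 1 - j = (t x).2.2.2.1)))
    (by fun_prop) ?_) (by fun_prop)
  have h : Primrec fun x : α × ℕ => Fin.ofNat q ((t x.1).2.1 / q ^ ((t x.1).2.2.2.2 - 1 - x.2)) := by
    rw [← Primrec.fin_val_iff]
    simp only [Fin.val_ofNat]
    fun_prop
  fun_prop

@[fun_prop]
theorem PETuple.primrecPred_valid {t : α → PETuple} (ht : Primrec t) :
    PrimrecPred fun x => (t x).Valid q := by
  unfold PETuple.Valid IsPE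
  have h : PrimrecPred fun x => (t x).1 = true → (t x).2.1 ≠ 0 :=
    PrimrecPred.imp_fun (by fun_prop) (by fun_prop)
  fun_prop

@[fun_prop]
theorem PETuple.primrec_data {t : α → PETuple} (ht : Primrec t) : Primrec fun x => (t x).data := by
  unfold PETuple.data
  exact Primrec.pair_fun (Primrec.ite_fun (by fun_prop) (by fun_prop) (by fun_prop))
    (Primrec.pair_fun (Primrec.ite_fun (by fun_prop) (by fun_prop) (by fun_prop)) (by fun_prop))

@[fun_prop]
theorem PETuple.primrec_below {b : α → ℕ} (hb : Primrec b) :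
    Primrec fun x => PETuple.below q (b x) := by
  unfold PETuple.below
  refine Primrec.flatMap_fun (by fun_prop) ?_
  refine Primrec.flatMap_fun (f := fun x : α × ℕ => List.range (q ^ x.2)) (by fun_prop) ?_
  refine Primrec.flatMap_fun (f := fun x : (α × ℕ) × ℕ => List.range x.1.2) (by fun_prop) ?_
  exact Primrec.flatMap_fun (f := fun x : ((α × ℕ) × ℕ) × ℕ => List.range x.1.1.2)
    (g := fun x c => [(false, x.1.2, x.2, c, x.1.1.2), (true, x.1.2, x.2, c, x.1.1.2)])
    (by fun_prop) (by fun_prop)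

@[fun_prop]
theorem primrec_peBound {n : α → ℕ} (hn : Primrec n) : Primrec fun x => peBound (n x) := by
  unfold peBound
  fun_prop

@[fun_prop]
theorem primrec_rationalBound {m D : α → ℕ} (hm : Primrec m) (hD : Primrec D) :
    Primrec fun x => rationalBound (m x) (D x) := by
  unfold rationalBound
  fun_prop

end

/-! ### Recognizability of PE-regular subsets is decidable -/

/-- A bound for the number of half classes of a PE-regular subset. -/
def peHalfBound (n : ℕ) : ℕ := 8 * (peBound n * peBound n)

@[fun_prop]
theorem primrec_peHalfBound {α : Type} [Primcodable α] {n : α → ℕ} (hn : Primrec n) :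
    Primrec fun x => peHalfBound (n x) := by
  unfold peHalfBound
  fun_prop

theorem BaumslagSolitar.finiteHalves_peSubset {q : ℕ} [q.AtLeastTwo] (A : FinAutomaton (PELetter q)) :
    FiniteHalves q (memPred q (peSubset q A)) (peHalfBound A.edges.length) :=
  (finiteSuffixes_peSubset A).finiteHalves (PointedNum.two_le q)

/-- The criterion for small numbers, with all quantifiers bounded and all arithmetic carried out in
`ℕ`. -/
theorem BaumslagSolitar.isRecognizable_peSubset_iff {q : ℕ} [q.AtLeastTwo]
    (A : FinAutomaton (PELetter q)) : IsRecognizable (peSubset q A) ↔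
      ∃ n < peHalfBound A.edges.length + 1,
      ∃ k < peHalfBound A.edges.length * peHalfBound A.edges.length + 1,
        0 < n ∧ 0 < k ∧ (q ^ k - 1) % n = 0 ∧
        ∀ t ∈ PETuple.below q (9 * peHalfBound A.edges.length * (9 * (4 * n * k * k))),
        ∀ t' ∈ PETuple.below q (9 * peHalfBound A.edges.length * (9 * (4 * n * k * k))),
          t.Valid q ∧ t'.Valid q ∧ ElemData.Congr q n k t.data t'.data ∧ t.word q ∈ A.language →
            t'.word q ∈ A.language := by
  rw [isRecognizable_iff_small (finiteHalves_peSubset A)]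
  simp only [Nat.lt_succ_iff, ← Nat.dvd_iff_mod_eq_zero]
  refine exists_congr fun n => and_congr_right fun _ => exists_congr fun k =>
    and_congr_right fun _ => and_congr_right fun _ => and_congr_right fun hk => and_congr_right fun hd => ?_
  constructor
  · rintro h t ht t' ht' ⟨hv, hv', hc, hw⟩
    rw [ElemData.congr_iff hk hd, PETuple.num_data, PETuple.num_data] at hc
    have h1 := (memPred_peSubset_iff A hv').1
    have hlt : ∀ {t : PETuple} {b : ℕ}, t ∈ PETuple.below q b → t.2.2.2.2 < b := by
      intro t b ht
      simp only [PETuple.below, List.mem_flatMap, List.mem_range] at ht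
      obtain ⟨l, hl, N, -, L, -, c, -, h⟩ := ht
      have : t = (false, N, L, c, l) ∨ t = (true, N, L, c, l) := by simpa using h
      rcases this with rfl | rfl <;> exact hl
    exact h1 (h _ _ _ _ _ _ _ _ _ _ (hlt ht) (hlt ht') hv hv' hc.1 hc.2
      ((memPred_peSubset_iff A hv).2 hw))
  · intro h s N L c l s' N' L' c' l' hl hl' hv hv' hm hp hR
    have hv1 : PETuple.Valid q (s, N, L, c, l) := hv
    have hv2 : PETuple.Valid q (s', N', L', c', l') := hv'
    refine (memPred_peSubset_iff A hv').2 (h _ (PETuple.mem_below hv1 hl) _ (PETuple.mem_below hv2 hl')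
      ⟨hv1, hv2, ?_, (memPred_peSubset_iff A hv).1 hR⟩)
    rw [ElemData.congr_iff hk hd, PETuple.num_data, PETuple.num_data]
    exact ⟨hm, hp⟩

theorem BaumslagSolitar.primrecPred_isRecognizable_peSubset (q : ℕ) [q.AtLeastTwo] :
    PrimrecPred fun A : FinAutomaton (PELetter q) => IsRecognizable (peSubset q A) := by
  simp only [isRecognizable_peSubset_iff]
  refine PrimrecPred.exists_lt_fun (by fun_prop) ?_
  refine PrimrecPred.exists_lt_fun (α := FinAutomaton (PELetter q) × ℕ) (by fun_prop) ?_
  refine PrimrecPred.and_fun (by fun_prop) (PrimrecPred.and_fun (by fun_prop)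
    (PrimrecPred.and_fun (by fun_prop) ?_))
  have h : Primrec fun x : (FinAutomaton (PELetter q) × ℕ) × ℕ => PETuple.below q
      (9 * peHalfBound x.1.1.edges.length * (9 * (4 * x.1.2 * x.2 * x.2))) := by fun_prop
  refine PrimrecPred.forall_mem h ?_
  refine PrimrecPred.forall_mem (h.comp Primrec.fst) ?_
  exact PrimrecPred.imp_fun (by fun_prop) (by fun_prop)

/-! ### Certificates for pointed expansions of rational subsets -/

section

variable {α : Type} [Primcodable α]

instance : Finite BSGen := Finite.of_equiv _ BSGen.equivBool.symm

@[fun_prop]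
theorem primrec_boundLe {β β' : α → Option (ℕ × ℕ)} (h : Primrec β) (h' : Primrec β') :
    Primrec fun x => boundLe (β x) (β' x) := by
  refine (Primrec.option_casesOn (f := fun _ => true)
    (g := fun x r => (Option.casesOn (β x) false fun p => decide (p.1 + r.2 ≤ r.1 + p.2) : Bool))
    h' (by fun_prop) ?_).of_eq fun x => ?_
  · exact Primrec.option_casesOn (o := fun x : α × (ℕ × ℕ) => β x.1) (f := fun _ => false)
      (g := fun x p => decide (p.1 + x.2.2 ≤ x.2.1 + p.2)) (by fun_prop) (by fun_prop)
      (show Primrec fun y : (α × (ℕ × ℕ)) × (ℕ × ℕ) => decide (y.2.1 + y.1.2.2 ≤ y.1.2.1 + y.2.2) by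
        fun_prop)
  · generalize β x = b
    generalize β' x = b'
    cases b <;> cases b' <;> rfl

@[fun_prop]
theorem primrec_boundAdd {q : ℕ} {c d : α → ℕ} {β β' : α → Option (ℕ × ℕ)} (hc : Primrec c)
    (hd : Primrec d) (h : Primrec β) (h' : Primrec β') :
    Primrec fun x => boundAdd q (c x) (d x) (β x) (β' x) := by
  unfold boundAdd
  refine Primrec.option_bind h (Primrec.option_map (f := fun x : α × (ℕ × ℕ) => β' x.1)
    (g := fun x r => (q * x.2.1 + r.1 + c x.1, q * x.2.2 + r.2 + d x.1)) (by fun_prop) ?_)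
  exact show Primrec fun y : (α × (ℕ × ℕ)) × (ℕ × ℕ) =>
    (q * y.1.2.1 + y.2.1 + c y.1.1, q * y.1.2.2 + y.2.2 + d y.1.1) by fun_prop

@[fun_prop]
theorem BSLetter.primrec_gain {b : α → Bool} {e : α → BSLetter} (hb : Primrec b) (he : Primrec e) :
    Primrec fun x => BSLetter.gain (b x) (e x) :=
  (Primrec.dom_finite fun y : Bool × BSLetter => BSLetter.gain y.1 y.2).comp (hb.pair he)

@[fun_prop]
theorem BSLetter.primrecPred_step {e : α → BSLetter} (he : Primrec e) :
    PrimrecPred fun x => BSLetter.step (e x) = 0 :=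
  PrimrecPred.comp (p := fun e => BSLetter.step e = 0) ⟨inferInstance, Primrec.dom_finite _⟩ he

end

/-- The data of a certificate for slack. -/
abbrev SlackData : Type :=
  ℕ × List (Bool × ℕ) × List (Bool × ℕ × ℕ × Option (ℕ × ℕ)) × List (List BSLetter)

theorem primrecPred_slackCert (q : ℕ) [q.AtLeastTwo] :
    PrimrecPred fun x : FinAutomaton BSLetter × SlackData =>
      SlackCert q x.1 x.2.1 x.2.2.1 x.2.2.2.1 x.2.2.2.2 := by
  have hloop : ∀ (b : Bool) (D : ℕ) (w : List BSLetter),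
      ((BaumslagSolitar.toPointed q (BaumslagSolitar.ofWord 1 q w)).num = (sgn b * D : ℤ) ∧
        (BaumslagSolitar.toPointed q (BaumslagSolitar.ofWord 1 q w)).pos = 0) ↔
      ElemData.Congr q 0 0 (ElemData.ofWord q w) (PETuple.data (b, D, 0, 0, 0)) := by
    intro b D w
    rw [ElemData.congr_zero_iff, PETuple.num_data, PETuple.pos_data, (ElemData.toPointed_ofWord w).1,
      (ElemData.toPointed_ofWord w).2]
    simp [peNum]
  unfold SlackCert
  simp only [hloop]
  refine PrimrecPred.and_fun (by fun_prop) (PrimrecPred.and_fun ?_ (PrimrecPred.and_fun ?_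
    (PrimrecPred.and_fun ?_ (PrimrecPred.and_fun ?_ ?_))))
  · refine PrimrecPred.forall_mem (by fun_prop) ?_
    exact PrimrecPred.exists_mem (α := (FinAutomaton BSLetter × SlackData) × (Bool × ℕ))
      (f := fun x => x.1.2.2.2.2) (by fun_prop) (by fun_prop)
  · refine PrimrecPred.forall_mem (by fun_prop) ?_
    refine PrimrecPred.forall_mem (α := (FinAutomaton BSLetter × SlackData) × ℕ) (by fun_prop) ?_
    exact PrimrecPred.exists_mem (α := ((FinAutomaton BSLetter × SlackData) × ℕ) × Bool)
      (f := fun x => x.1.1.2.2.2.1) (by fun_prop) (by fun_prop)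
  · refine PrimrecPred.forall_mem (by fun_prop) ?_
    refine PrimrecPred.forall_mem (α := (FinAutomaton BSLetter × SlackData) × (ℕ × BSLetter × ℕ))
      (f := fun x => x.1.2.2.2.1) (by fun_prop) ?_
    refine PrimrecPred.imp_fun (by fun_prop) (PrimrecPred.imp_fun (by fun_prop) ?_)
    exact PrimrecPred.exists_mem (α := ((FinAutomaton BSLetter × SlackData) × (ℕ × BSLetter × ℕ)) ×
      (Bool × ℕ × ℕ × Option (ℕ × ℕ))) (f := fun x => x.1.1.2.2.2.1) (by fun_prop) (by fun_prop)
  · refine PrimrecPred.forall_mem (by fun_prop) ?_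
    refine PrimrecPred.forall_mem (α := (FinAutomaton BSLetter × SlackData) × (ℕ × BSLetter × ℕ))
      (f := fun x => x.1.2.2.2.1) (by fun_prop) ?_
    refine PrimrecPred.forall_mem (α := ((FinAutomaton BSLetter × SlackData) × (ℕ × BSLetter × ℕ)) ×
      (Bool × ℕ × ℕ × Option (ℕ × ℕ))) (f := fun x => x.1.1.1.edges) (by fun_prop) ?_
    refine PrimrecPred.forall_mem (α := (((FinAutomaton BSLetter × SlackData) × (ℕ × BSLetter × ℕ)) ×
      (Bool × ℕ × ℕ × Option (ℕ × ℕ))) × (ℕ × BSLetter × ℕ)) (f := fun x => x.1.1.1.2.2.2.1)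
      (by fun_prop) ?_
    refine PrimrecPred.imp_fun (by fun_prop) (PrimrecPred.imp_fun (by fun_prop)
      (PrimrecPred.imp_fun (by fun_prop) (PrimrecPred.imp_fun (by fun_prop)
      (PrimrecPred.imp_fun (by fun_prop) (PrimrecPred.imp_fun (by fun_prop) ?_)))))
    exact PrimrecPred.exists_mem (α := ((((FinAutomaton BSLetter × SlackData) × (ℕ × BSLetter × ℕ)) ×
      (Bool × ℕ × ℕ × Option (ℕ × ℕ))) × (ℕ × BSLetter × ℕ)) × (Bool × ℕ × ℕ × Option (ℕ × ℕ)))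
      (f := fun x => x.1.1.1.1.2.2.2.1) (by fun_prop) (by fun_prop)
  · refine PrimrecPred.forall_mem (by fun_prop) ?_
    exact PrimrecPred.imp_fun (by fun_prop) (by fun_prop)

/-- The data of a certificate for the equality of a rational and a PE-regular subset: automata for
the languages accepted from the states, tuples, a certificate for slack, and words. -/
abbrev RatData (q : ℕ) : Type :=
  List (ℕ × FinAutomaton (PELetter q)) × List PETuple × SlackData × List (List BSLetter)

/-- A bound for counterexamples to closure under left multiplication by a letter. -/
def stepBound (n n' : ℕ) : ℕ :=
  peBound n' * (9 * (18 * peHalfBound n * peHalfBound n * peHalfBound n))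

/-- The multiplication by a letter that labels an edge maps one PE-regular subset into the other. -/
def StepClosed (q : ℕ) [NeZero q] (T : List PETuple) (x : BSLetter) (A A' : FinAutomaton (PELetter q)) :
    Prop :=
  ∀ t ∈ PETuple.below q (stepBound A.edges.length A'.edges.length),
    t.Valid q ∧ t.word q ∈ A'.language →
      ∃ t' ∈ T, t'.Valid q ∧ ElemData.Congr q 0 0 (ElemData.letterMul q x t.data) t'.data ∧
        t'.word q ∈ A.language

/-- A finite certificate for the equality of a rational and a PE-regular subset. -/
def RatCert (q : ℕ) [NeZero q] (A : FinAutomaton BSLetter) (A' : FinAutomaton (PELetter q))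
    (C : RatData q) : Prop :=
  (A.init, A') ∈ C.1 ∧
  (∀ y ∈ C.1, y.1 ∈ A.final → PETuple.word q (false, 0, 0, 0, 1) ∈ y.2.language) ∧
  (∀ y ∈ C.1, ∀ e ∈ A.edges, e.1 = y.1 → ∃ y' ∈ C.1, y'.1 = e.2.2 ∧
    StepClosed q C.2.1 e.2.1 y.2 y'.2) ∧
  SlackCert q A C.2.2.1.1 C.2.2.1.2.1 C.2.2.1.2.2.1 C.2.2.1.2.2.2 ∧
  (∀ t ∈ PETuple.below q (peBound A'.edges.length * (9 * rationalBound A.states.length C.2.2.1.1)),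
    t.Valid q ∧ t.word q ∈ A'.language →
      ∃ w ∈ C.2.2.2, w ∈ A.language ∧ ElemData.Congr q 0 0 (ElemData.ofWord q w) t.data)

theorem primrecPred_stepClosed (q : ℕ) [q.AtLeastTwo] :
    PrimrecPred fun y : List PETuple × BSLetter × FinAutomaton (PELetter q) ×
      FinAutomaton (PELetter q) => StepClosed q y.1 y.2.1 y.2.2.1 y.2.2.2 := by
  have h1 : Primrec fun y : List PETuple × BSLetter × FinAutomaton (PELetter q) ×
      FinAutomaton (PELetter q) =>
      PETuple.below q (stepBound y.2.2.1.edges.length y.2.2.2.edges.length) := by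
    unfold stepBound
    fun_prop
  unfold StepClosed
  refine PrimrecPred.forall_mem h1 ?_
  refine PrimrecPred.imp_fun (by fun_prop) ?_
  exact PrimrecPred.exists_mem (α := (List PETuple × BSLetter × FinAutomaton (PELetter q) ×
    FinAutomaton (PELetter q)) × PETuple) (f := fun x => x.1.1) (by fun_prop) (by fun_prop)

theorem primrecPred_ratCert (q : ℕ) [q.AtLeastTwo] :
    PrimrecPred fun x : FinAutomaton BSLetter × FinAutomaton (PELetter q) × RatData q =>
      RatCert q x.1 x.2.1 x.2.2 := by
  unfold RatCert
  refine PrimrecPred.and_fun (by fun_prop) (PrimrecPred.and_fun ?_ (PrimrecPred.and_fun ?_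
    (PrimrecPred.and_fun ?_ ?_)))
  · refine PrimrecPred.forall_mem (by fun_prop) ?_
    exact PrimrecPred.imp_fun (by fun_prop) (by fun_prop)
  · refine PrimrecPred.forall_mem (by fun_prop) ?_
    refine PrimrecPred.forall_mem (α := (FinAutomaton BSLetter × FinAutomaton (PELetter q) × RatData q) ×
      (ℕ × FinAutomaton (PELetter q))) (f := fun x => x.1.1.edges) (by fun_prop) ?_
    refine PrimrecPred.imp_fun (by fun_prop) ?_
    have h := primrecPred_stepClosed q
    refine PrimrecPred.exists_mem (α := ((FinAutomaton BSLetter × FinAutomaton (PELetter q) × RatData q) ×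
      (ℕ × FinAutomaton (PELetter q))) × (ℕ × BSLetter × ℕ)) (f := fun x => x.1.1.2.2.1) (by fun_prop)
      (PrimrecPred.and_fun (by fun_prop) ?_)
    exact h.comp (f := fun x : (((FinAutomaton BSLetter × FinAutomaton (PELetter q) × RatData q) ×
      (ℕ × FinAutomaton (PELetter q))) × (ℕ × BSLetter × ℕ)) × (ℕ × FinAutomaton (PELetter q)) =>
      (x.1.1.1.2.2.2.1, x.1.2.2.1, x.1.1.2.2, x.2.2)) (by fun_prop)
  · exact (primrecPred_slackCert q).comp (f := fun x : FinAutomaton BSLetter ×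
      FinAutomaton (PELetter q) × RatData q => (x.1, x.2.2.2.2.1)) (by fun_prop)
  · refine PrimrecPred.forall_mem (by fun_prop) ?_
    refine PrimrecPred.imp_fun (by fun_prop) ?_
    exact PrimrecPred.exists_mem (α := (FinAutomaton BSLetter × FinAutomaton (PELetter q) × RatData q) ×
      PETuple) (f := fun x => x.1.2.2.2.2.2) (by fun_prop) (by fun_prop)

/-! ### Recognizability of rational subsets is decidable -/

section

variable {q : ℕ} [q.AtLeastTwo]

theorem leftPred_iff {q : ℕ} (P : ℚ → ℤ → Prop) (e : BSLetter) (x : ℚ) (m : ℤ) :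
    leftPred q P e x m ↔ P (BSLetter.unit e + (q : ℚ) ^ BSLetter.step e * x) (BSLetter.step e + m) := by
  rcases e with ⟨_ | _, _ | _⟩ <;>
    simp [leftPred, BSLetter.unit, BSLetter.step, add_comm, sub_eq_add_neg, div_eq_mul_inv, mul_comm]

theorem leftPred_data_iff (P : ℚ → ℤ → Prop) (e : BSLetter) (d : ElemData) :
    leftPred q P e (ElemData.num q d) (ElemData.pos d) ↔
      P (ElemData.num q (ElemData.letterMul q e d)) (ElemData.pos (ElemData.letterMul q e d)) := by
  rw [leftPred_iff, ElemData.num_letterMul, ElemData.pos_letterMul]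

namespace BaumslagSolitar

theorem leftPred_ofWord_iff (P : ℚ → ℤ → Prop) (e : BSLetter) (w : List BSLetter) :
    leftPred q P e (toPointed q (ofWord 1 q w)).num (toPointed q (ofWord 1 q w)).pos ↔
      P (toPointed q (ofWord 1 q (e :: w))).num (toPointed q (ofWord 1 q (e :: w))).pos := by
  rw [leftPred_iff, (toPointed_ofWord_cons e w).1, (toPointed_ofWord_cons e w).2]

end BaumslagSolitar

open BaumslagSolitar

/-- Counterexamples form a finite-state set, the intersection of one PE-regular set with the
complement of a preimage of the other; `stepBound` bounds its suffix classes, so a counterexample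
would appear among the tested tuples. -/
theorem StepClosed.leftPred {T : List PETuple} {e : BSLetter} {A A' : FinAutomaton (PELetter q)}
    (h : StepClosed q T e A A') {x : ℚ} {m : ℤ} (hx : x ∈ ZInv q)
    (hm : memPred q (peSubset q A') x m) : leftPred q (memPred q (peSubset q A)) e x m := by
  by_contra hcon
  obtain ⟨t, h1, h2, h3, h4⟩ := ((finiteSuffixes_peSubset A').and
    ((finiteHalves_peSubset A).leftPred e).finiteSuffixes.not).exists_mem_below hx ⟨hm, hcon⟩
  obtain ⟨t', -, k1, k2, k3⟩ := h t h1 ⟨h2, (PETuple.word_mem_language_iff A' h2).2 h3⟩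
  rw [leftPred_data_iff] at h4
  rw [ElemData.congr_zero_iff] at k2
  rw [PETuple.word_mem_language_iff A k1, ← k2.1, ← k2.2] at k3
  exact h4 k3

/-- The tuple of the identity, the value of the empty word. -/
theorem valid_zero : PETuple.Valid q (false, 0, 0, 0, 1) := by
  have := PointedNum.two_le q
  refine ⟨by simp, by simp, ?_, Or.inl rfl, Or.inl rfl, by simp⟩
  simp
  omega

/-- The automata attached to a state contain all elements of words accepted from it, by induction
along the run; this is one inclusion. For the other one, the slack certificate makes the rational
set finite-state with a known bound, so an element of the difference would give a small one, and
each small element of the PE-regular set has an accepted word in the certificate. -/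
theorem RatCert.eq {A : FinAutomaton BSLetter} {A' : FinAutomaton (PELetter q)} {C : RatData q}
    (h : RatCert q A A' C) : rationalSubset q A = peSubset q A' := by
  obtain ⟨hi, hf, he, hS, hw⟩ := h
  have key : ∀ {p w f}, A.Run p w f → f ∈ A.final → ∀ y ∈ C.1, y.1 = p → memPred q (peSubset q y.2)
      (toPointed q (ofWord 1 q w)).num (toPointed q (ofWord 1 q w)).pos := by
    intro p w f hr hff
    induction hr with
    | nil p =>
      rintro y hy rfl
      have h1 := (PETuple.word_mem_language_iff y.2 valid_zero).1 (hf y hy hff)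
      rw [toPointed_ofWord_nil]
      simpa [PETuple.num_data, PETuple.pos_data, peNum] using h1
    | @cons p p' p'' x w hx _ ih =>
      rintro y hy rfl
      obtain ⟨y', hy', h1, h2⟩ := he y hy _ hx rfl
      exact (leftPred_ofWord_iff _ x w).1
        (h2.leftPred (toPointed q (ofWord 1 q w)).num_mem (ih hff y' hy' h1))
  ext g
  constructor
  · rintro ⟨w, ⟨f, hff, hr⟩, rfl⟩
    exact (memPred_iff _ _).1 (key hr hff _ hi rfl)
  · intro hg
    by_contra hcon
    rw [← memPred_iff] at hg hcon
    obtain ⟨t, h1, h2, h3, h4⟩ := ((finiteSuffixes_peSubset A').and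
      hS.isSlack.finiteHalves.finiteSuffixes.not).exists_mem_below (toPointed q g).num_mem ⟨hg, hcon⟩
    obtain ⟨w, -, k1, k2⟩ := hw t h1 ⟨h2, (PETuple.word_mem_language_iff A' h2).2 h3⟩
    rw [ElemData.congr_zero_iff] at k2
    refine h4 ⟨ofWord 1 q w, ⟨w, k1, rfl⟩, ?_, ?_⟩
    · rw [(ElemData.toPointed_ofWord w).1, k2.1]
    · rw [(ElemData.toPointed_ofWord w).2, k2.2]

theorem PETuple.exists_valid {x : ℚ} (hx : x ∈ ZInv q) (m : ℤ) :
    ∃ t : PETuple, t.Valid q ∧ ElemData.num q t.data = x ∧ ElemData.pos t.data = m := by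
  obtain ⟨g, rfl, rfl⟩ := exists_toPointed hx m
  obtain ⟨s, N, L, c, l, h1, h2, h3, -⟩ := exists_pe_eq g
  exact ⟨(s, N, L, c, l), h1, by rw [num_data, h2], by rw [pos_data, h3]⟩

theorem ElemData.num_letterMul_mem (e : BSLetter) {d : ElemData} (h : num q d ∈ ZInv q) :
    num q (letterMul q e d) ∈ ZInv q := by
  rw [num_letterMul]
  exact add_mem (intCast_mem _ _) (mul_mem (PointedNum.zpow_mem q _) h)

/-- For each state `p` an automaton for the set accepted from `p` is chosen; it exists since
rational sets are finite-state and hence PE-regular. Expansions of the products and accepted words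
are chosen as well. The choices need not be effective, as certificates are found by search. -/
theorem exists_ratCert (A : FinAutomaton BSLetter) : ∃ A' C, RatCert q A A' C := by
  classical
  have hF : ∀ p, ∃ A' : FinAutomaton (PELetter q),
      peSubset q A' = rationalSubset q { A with init := p } := by
    intro p
    obtain ⟨D, P, G, W, hS⟩ := exists_slackCert q { A with init := p }
    exact exists_peSubset_eq hS.isSlack.finiteHalves.finiteSuffixes
  choose F hF using hF
  obtain ⟨D, P, G, W, hS⟩ := exists_slackCert q A
  have hτ : ∀ (e : BSLetter) (t : PETuple), ∃ t' : PETuple, t'.Valid q ∧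
      ElemData.Congr q 0 0 (ElemData.letterMul q e t.data) t'.data := by
    intro e t
    obtain ⟨t', h1, h2, h3⟩ := PETuple.exists_valid
      (ElemData.num_letterMul_mem (q := q) e t.num_data_mem) (ElemData.pos (ElemData.letterMul q e t.data))
    exact ⟨t', h1, (ElemData.congr_zero_iff _ _).2 ⟨h2.symm, h3.symm⟩⟩
  choose τ hτ1 hτ2 using hτ
  have hω : ∀ t : PETuple, ∃ w, t.Valid q ∧ t.word q ∈ (F A.init).language →
      w ∈ A.language ∧ ElemData.Congr q 0 0 (ElemData.ofWord q w) t.data := by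
    intro t
    by_cases h : t.Valid q ∧ t.word q ∈ (F A.init).language
    · obtain ⟨h1, h2⟩ := h
      rw [PETuple.word_mem_language_iff _ h1, hF] at h2
      obtain ⟨_, ⟨w, hw, rfl⟩, h3, h4⟩ := h2
      rw [(ElemData.toPointed_ofWord w).1] at h3
      rw [(ElemData.toPointed_ofWord w).2] at h4
      exact ⟨w, fun _ => ⟨hw, (ElemData.congr_zero_iff _ _).2 ⟨h3, h4⟩⟩⟩
    · exact ⟨[], fun h' => absurd h' h⟩
  choose ω hω using hω
  refine ⟨F A.init, (A.states.map fun p => (p, F p),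
    A.edges.flatMap fun e => (PETuple.below q
      (stepBound (F e.1).edges.length (F e.2.2).edges.length)).map (τ e.2.1),
    (D, P, G, W),
    (PETuple.below q (peBound (F A.init).edges.length * (9 * rationalBound A.states.length D))).map ω),
    ?_, ?_, ?_, hS, ?_⟩
  · exact List.mem_map.2 ⟨A.init, by simp [FinAutomaton.states], rfl⟩
  · intro y hy hf
    obtain ⟨p, -, rfl⟩ := List.mem_map.1 hy
    rw [PETuple.word_mem_language_iff _ valid_zero, hF]
    refine ⟨ofWord 1 q [], ⟨[], ⟨p, hf, .nil _⟩, rfl⟩, ?_, ?_⟩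
    · rw [toPointed_ofWord_nil]
      simp [PETuple.num_data, peNum]
    · rw [toPointed_ofWord_nil]
      simp [PETuple.pos_data]
  · rintro y hy e he hey
    obtain ⟨p, -, rfl⟩ := List.mem_map.1 hy
    obtain rfl : e.1 = p := hey
    refine ⟨(e.2.2, F e.2.2), List.mem_map.2 ⟨_, (A.mem_states he).2, rfl⟩, rfl, ?_⟩
    rintro t ht ⟨h1, h2⟩
    refine ⟨τ e.2.1 t, List.mem_flatMap.2 ⟨e, he, List.mem_map.2 ⟨t, ht, rfl⟩⟩, hτ1 _ _, hτ2 _ _, ?_⟩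
    have h3 := (ElemData.congr_zero_iff _ _).1 (hτ2 e.2.1 t)
    rw [PETuple.word_mem_language_iff _ (hτ1 _ _), ← h3.1, ← h3.2, hF]
    refine (leftPred_data_iff _ _ _).1 ?_
    rw [PETuple.word_mem_language_iff _ h1, hF] at h2
    obtain ⟨_, ⟨w, ⟨f, hf, hw⟩, rfl⟩, h4, h5⟩ := h2
    rw [← h4, ← h5, leftPred_ofWord_iff, memPred_iff]
    have hrun : ∀ {p p' w f}, FinAutomaton.Run { A with init := p } p' w f ↔ A.Run p' w f := by
      intro p p' w f
      constructor <;> intro h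
      · induction h with
        | nil => exact .nil _
        | cons h _ ih => exact .cons h ih
      · induction h with
        | nil => exact .nil _
        | cons h _ ih => exact .cons h ih
    exact ⟨e.2.1 :: w, ⟨f, hf, .cons he (hrun.2 (hrun.1 hw))⟩, rfl⟩
  · intro t ht h
    exact ⟨ω t, List.mem_map.2 ⟨t, ht, rfl⟩, hω t h⟩

end

/-- Post's theorem: one searches for a certified PE automaton and decides recognizability for it. A
certificate always exists, and all of them give the same answer. -/
theorem BaumslagSolitar.computablePred_isRecognizable_rationalSubset (q : ℕ) [q.AtLeastTwo] :
    ComputablePred fun A : FinAutomaton BSLetter => IsRecognizable (rationalSubset q A) := by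
  have hE := primrecPred_ratCert q
  have hP : PrimrecPred fun x : FinAutomaton BSLetter × FinAutomaton (PELetter q) × RatData q =>
      IsRecognizable (peSubset q x.2.1) :=
    (primrecPred_isRecognizable_peSubset q).comp (f := fun x : FinAutomaton BSLetter ×
      FinAutomaton (PELetter q) × RatData q => x.2.1) (by fun_prop)
  rw [ComputablePred.computable_iff_re_compl_re']
  constructor
  · refine (REPred.exists_of_primrec (hE.and hP)).of_eq fun A => ⟨?_, fun h => ?_⟩
    · rintro ⟨_, h1, h2⟩
      rwa [h1.eq]
    · obtain ⟨A', C, hC⟩ := exists_ratCert (q := q) A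
      exact ⟨(A', C), hC, by rwa [hC.eq] at h⟩
  · refine (REPred.exists_of_primrec (hE.and hP.not)).of_eq fun A => ⟨?_, fun h => ?_⟩
    · rintro ⟨_, h1, h2⟩
      rwa [h1.eq]
    · obtain ⟨A', C, hC⟩ := exists_ratCert (q := q) A
      exact ⟨(A', C), hC, by rwa [hC.eq] at h⟩

/-! ### Subgroups of finite index -/

namespace BaumslagSolitar

variable {q : ℕ} [q.AtLeastTwo]

/-- The numbers `x` such that `(x, 0)` belongs to a given subgroup. -/
def levelSubgroup (H : Subgroup (BaumslagSolitar 1 q)) : AddSubgroup ℚ where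
  carrier := {x | memPred q H x 0}
  zero_mem' := ⟨1, H.one_mem, by simp, by simp⟩
  add_mem' := by
    rintro x y ⟨g, hg, rfl, h0⟩ ⟨g', hg', rfl, h0'⟩
    exact ⟨g * g', H.mul_mem hg hg', by simp [h0], by simp [h0, h0']⟩
  neg_mem' := by
    rintro x ⟨g, hg, rfl, h0⟩
    exact ⟨g⁻¹, H.inv_mem hg, by simp [h0], by simp [h0]⟩

theorem mem_levelSubgroup {H : Subgroup (BaumslagSolitar 1 q)} {x : ℚ} :
    x ∈ levelSubgroup H ↔ memPred q H x 0 := Iff.rfl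

/-- Conjugation by `g` sends `(x, 0)` to `(q ^ pos x, 0)`. -/
theorem zpow_mul_mem_levelSubgroup {H : Subgroup (BaumslagSolitar 1 q)} {g : BaumslagSolitar 1 q}
    (hg : g ∈ H) {x : ℚ} (hx : x ∈ levelSubgroup H) :
    (q : ℚ) ^ (toPointed q g).pos * x ∈ levelSubgroup H := by
  have hq : (q : ℚ) ≠ 0 := NeZero.ne _
  obtain ⟨h, hh, rfl, h0⟩ := hx
  refine ⟨g * h * g⁻¹, H.mul_mem (H.mul_mem hg hh) (H.inv_mem hg), ?_, ?_⟩
  · simp only [map_mul, map_inv, PointedNum.mul_num, PointedNum.mul_pos, PointedNum.inv_num, h0,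
      add_zero, zpow_neg]
    field_simp
    ring
  · simp [h0]

/-- Conjugation by `g⁻¹` divides by `q ^ pos`, so arbitrarily large denominators become available.
-/
theorem mul_mem_levelSubgroup {H : Subgroup (BaumslagSolitar 1 q)} {g : BaumslagSolitar 1 q}
    (hg : g ∈ H) (hpos : 0 < (toPointed q g).pos) {x r : ℚ} (hx : x ∈ levelSubgroup H)
    (hr : r ∈ ZInv q) : r * x ∈ levelSubgroup H := by
  have hq : (q : ℚ) ≠ 0 := NeZero.ne _
  have hdown : ∀ i : ℕ, (q : ℚ) ^ (-((toPointed q g).pos * i)) * x ∈ levelSubgroup H := by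
    intro i
    induction i with
    | zero => simpa using hx
    | succ i ih =>
      have := zpow_mul_mem_levelSubgroup (H.inv_mem hg) ih
      rw [map_inv, PointedNum.inv_pos, ← mul_assoc, ← zpow_add₀ hq] at this
      convert this using 3
      push_cast
      ring
  obtain ⟨m, hm⟩ : ∃ m : ℕ, (toPointed q g).pos = m + 1 := ⟨((toPointed q g).pos - 1).toNat, by omega⟩
  obtain ⟨i, n, hn⟩ := exists_mul_pow hr
  -- With `pos = m + 1`, the fraction `n / q ^ i` is rewritten as `n q ^ (m i) / q ^ (pos i)`.
  have h1 := (levelSubgroup H).zsmul_mem (hdown i) (n * (q : ℤ) ^ (m * i))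
  have h2 : r = n * ((q : ℚ) ^ i)⁻¹ := by
    rw [← hn]
    field_simp
  have h3 : (q : ℚ) ^ (-((toPointed q g).pos * i)) = ((q : ℚ) ^ (m * i))⁻¹ * ((q : ℚ) ^ i)⁻¹ := by
    rw [hm, ← mul_inv, ← pow_add, ← zpow_natCast, ← zpow_neg]
    congr 1
    push_cast
    ring
  rw [h3] at h1
  convert h1 using 1
  rw [h2, zsmul_eq_mul]
  push_cast
  field_simp

/-- The powers of `q` modulo `N` repeat. Since `q` need not be invertible modulo `N`, there may be a
preperiod `i`. -/
theorem exists_dvd_pow_mul (q : ℕ) {N : ℤ} (hN : N ≠ 0) :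
    ∃ i k : ℕ, 0 < k ∧ N ∣ (q : ℤ) ^ i * ((q : ℤ) ^ k - 1) := by
  have : NeZero N.natAbs := ⟨Int.natAbs_ne_zero.2 hN⟩
  obtain ⟨i, j, hij, h⟩ : ∃ i j : ℕ, i < j ∧ (q : ZMod N.natAbs) ^ i = (q : ZMod N.natAbs) ^ j := by
    obtain ⟨i, j, hne, h⟩ := Finite.exists_ne_map_eq_of_infinite fun i : ℕ => (q : ZMod N.natAbs) ^ i
    rcases lt_or_gt_of_ne hne with h1 | h1
    exacts [⟨i, j, h1, h⟩, ⟨j, i, h1, h.symm⟩]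
  refine ⟨i, j - i, by omega, ?_⟩
  rw [← Int.natAbs_dvd, ← ZMod.intCast_zmod_eq_zero_iff_dvd]
  push_cast
  rw [mul_sub, ← pow_add, Nat.add_sub_cancel' hij.le, h, mul_one, sub_self]

/-- The group `H` contains `n ℤ[1/q]` at cursor `0` for some `n = q ^ k - 1`. A power `g ^ E`,
trivial modulo the congruence for `(n, k)`, has a cursor `m` divisible by `k`. Then `H` contains the
kernel of the finite quotient for `(n, m)`: a kernel element times a power of `g ^ E` has cursor `0`
and its number in `n ℤ[1/q]`. -/
theorem finiteIndex_of_pos_ne_zero {H : Subgroup (BaumslagSolitar 1 q)} {g u : BaumslagSolitar 1 q}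
    (hg : g ∈ H) (hpos : (toPointed q g).pos ≠ 0) (hu : u ∈ H) (hu0 : (toPointed q u).pos = 0)
    (hnum : (toPointed q u).num ≠ 0) : H.FiniteIndex := by
  have hq2 := PointedNum.two_le q
  have hq : (q : ℚ) ≠ 0 := NeZero.ne _
  wlog hp : 0 < (toPointed q g).pos generalizing g
  · refine this (H.inv_mem hg) ?_ ?_ <;> simp only [map_inv, PointedNum.inv_pos] <;> omega
  have hux : (toPointed q u).num ∈ levelSubgroup H := ⟨u, hu, rfl, hu0⟩
  obtain ⟨i, N, hN⟩ := exists_mul_pow (toPointed q u).num_mem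
  have hN0 : N ≠ 0 := by
    rintro rfl
    rw [Int.cast_zero, mul_eq_zero] at hN
    exact hN.elim hnum (pow_ne_zero _ hq)
  obtain ⟨j, k, hk, c, hc⟩ := exists_dvd_pow_mul q hN0
  set n : ℕ := q ^ k - 1 with hn
  have hn1 : (n : ℤ) = (q : ℤ) ^ k - 1 := by
    rw [hn, Nat.cast_sub (Nat.one_le_pow _ _ (by omega))]
    simp
  have hn0 : 0 < n := by
    have := Nat.one_lt_pow hk.ne' (show 1 < q by omega)
    omega
  have hlev : ∀ r ∈ ZInv q, n * r ∈ levelSubgroup H := by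
    intro r hr
    -- With `x = N / q ^ i` and `q ^ j n = N c`, this is the factor that takes `x` to `n r`.
    have h1 : (q : ℚ) ^ (i : ℤ) * (q : ℚ) ^ (-(j : ℤ)) * c * r ∈ ZInv q :=
      mul_mem (mul_mem (mul_mem (PointedNum.zpow_mem _ _) (PointedNum.zpow_mem _ _))
        (intCast_mem _ _)) hr
    have h2 := mul_mem_levelSubgroup hg hp hux h1
    convert h2 using 1
    have h3 : (q : ℚ) ^ j * n = N * c := by
      rw [← hn1] at hc
      exact_mod_cast hc
    rw [← hN] at h3
    rw [zpow_neg, zpow_natCast, zpow_natCast]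
    field_simp
    linear_combination r * h3
  have hfin := finite_periodCon (q := q) n k dvd_rfl hn0 hk
  obtain ⟨E, hE, hgE⟩ := isOfFinOrder_iff_pow_eq_one.1
    (isOfFinOrder_of_finite (g : (periodCon n k (dvd_refl (q ^ k - 1)) : Con _).Quotient))
  have hgE' : (periodCon n k (dvd_refl (q ^ k - 1))) (g ^ E) 1 := (Con.eq _).1 hgE
  set m : ℕ := (toPointed q (g ^ E)).pos.toNat with hm
  have hposE : (toPointed q (g ^ E)).pos = E * (toPointed q g).pos := by
    have : ∀ j : ℕ, (toPointed q (g ^ j)).pos = j * (toPointed q g).pos := by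
      intro j
      induction j with
      | zero => simp
      | succ j ih =>
        rw [pow_succ, map_mul, PointedNum.mul_pos, ih]
        push_cast
        ring
    exact this E
  have hm0 : 0 < (toPointed q (g ^ E)).pos := by rw [hposE]; positivity
  have hm1 : (m : ℤ) = (toPointed q (g ^ E)).pos := Int.toNat_of_nonneg hm0.le
  have hkm : k ∣ m := by
    have h1 : (k : ℤ) ∣ _ := hgE'.2
    rw [map_one, PointedNum.one_pos, sub_zero, ← hm1] at h1
    exact_mod_cast h1
  have hnm : n ∣ q ^ m - 1 := Nat.pow_sub_one_dvd_pow_sub_one q hkm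
  have hfin' := finite_periodCon (q := q) n m hnm hn0 (by omega)
  refine @Subgroup.finiteIndex_of_le _ _ (periodCon n m hnm).mk'.ker _
    (Subgroup.finiteIndex_ker _) fun h hh => ?_
  have hh' : (periodCon n m hnm) h 1 := (Con.eq _).1 hh
  obtain ⟨⟨z, hz, hz'⟩, b, hb⟩ := hh'
  have hgb : (periodCon n k (dvd_refl (q ^ k - 1))) ((g ^ E) ^ (-b)) 1 := by
    have := (periodCon n k (dvd_refl (q ^ k - 1))).zpow (-b) hgE'
    rwa [one_zpow] at this
  obtain ⟨⟨y, hy, hy'⟩, -⟩ := hgb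
  have hposb : ∀ b : ℤ, (toPointed q ((g ^ E) ^ b)).pos = m * b := by
    have h1 : ∀ j : ℕ, (toPointed q ((g ^ E) ^ j)).pos = m * j := by
      intro j
      induction j with
      | zero => simp
      | succ j ih =>
        rw [pow_succ, map_mul, PointedNum.mul_pos, ih, hm1]
        push_cast
        ring
    intro b
    obtain ⟨j, rfl | rfl⟩ := Int.eq_nat_or_neg b
    · rw [zpow_natCast, h1]
    · rw [zpow_neg, zpow_natCast, map_inv, PointedNum.inv_pos, h1]
      ring
  simp only [map_one, PointedNum.one_num, PointedNum.one_pos, sub_zero] at hz' hb hy'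
  have h1 : h * (g ^ E) ^ (-b) ∈ H := by
    refine (memPred_iff (H : Set (BaumslagSolitar 1 q)) _).1 ?_
    rw [map_mul, PointedNum.mul_num, PointedNum.mul_pos, hposb, hb, hz', hy']
    have := hlev (z + (q : ℚ) ^ ((m : ℤ) * b) * y)
      (add_mem hz (mul_mem (PointedNum.zpow_mem _ _) hy))
    convert mem_levelSubgroup.1 this using 1 <;> ring
  have h2 := H.mul_mem h1 (H.zpow_mem (H.pow_mem hg E) b)
  simpa using h2

/-- Finite index puts some `a ^ n` and `t ^ m` with `n, m > 0` into the subgroup: the latter needs a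
generator that moves the cursor, and the two do not commute because `q ^ m n ≠ n`. Conversely, the
commutator of two noncommuting generators has cursor `0` and a nonzero number. -/
theorem finiteIndex_closure_iff (S : Set (BaumslagSolitar 1 q)) :
    (Subgroup.closure S).FiniteIndex ↔
      (∃ g ∈ S, (toPointed q g).pos ≠ 0) ∧ ∃ g ∈ S, ∃ g' ∈ S, g * g' ≠ g' * g := by
  have hq2 := PointedNum.two_le q
  constructor
  · intro hfin
    obtain ⟨n, hn, -, han⟩ := Subgroup.exists_pow_mem_of_index_ne_zero hfin.index_ne_zero (a q)
    obtain ⟨m, hm, -, htm⟩ := Subgroup.exists_pow_mem_of_index_ne_zero hfin.index_ne_zero (t q)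
    have h1 := toPointed_a_zpow (q := q) n
    have h2 := toPointed_t_zpow (q := q) m
    rw [zpow_natCast] at h1 h2
    constructor
    · by_contra! hcon
      have : ∀ g ∈ Subgroup.closure S, (toPointed q g).pos = 0 := by
        intro g hg
        induction hg using Subgroup.closure_induction with
        | mem x hx => exact hcon x hx
        | one => simp
        | mul x y _ _ hx hy => simp [hx, hy]
        | inv x _ hx => simp [hx]
      have := this _ htm
      rw [h2.2] at this
      omega
    · by_contra! hcon
      have hcomm := Subgroup.isMulCommutative_closure hcon
      have h3 := congrArg (fun g => (toPointed q g).num) (setLike_mul_comm han htm)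
      simp only [map_mul, PointedNum.mul_num, h1, h2] at h3
      have h4 : (n : ℚ) = q ^ m * n := by simpa using h3
      have h5 : n = q ^ m * n := by exact_mod_cast h4
      have h6 := Nat.one_lt_pow (show m ≠ 0 by omega) (show 1 < q by omega)
      have h7 : 1 * n < q ^ m * n := Nat.mul_lt_mul_of_pos_right h6 (by omega)
      omega
  · rintro ⟨⟨g, hg, hpos⟩, x, hx, y, hy, hxy⟩
    have mx := Subgroup.subset_closure hx
    have my := Subgroup.subset_closure hy
    have hpos0 : (toPointed q (x * y * x⁻¹ * y⁻¹)).pos = 0 := by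
      simp
    refine finiteIndex_of_pos_ne_zero (Subgroup.subset_closure hg) hpos
      (mul_mem (mul_mem (mul_mem mx my) (inv_mem mx)) (inv_mem my)) hpos0 fun h0 => hxy ?_
    have h1 : toPointed q (x * y * x⁻¹ * y⁻¹) = toPointed q 1 := by
      rw [map_one]
      exact PointedNum.ext h0 hpos0
    have h2 := (toPointed_bijective q).1 h1
    rwa [mul_inv_eq_one, mul_inv_eq_iff_eq_mul] at h2

theorem ofWord_append {q : ℕ} (w w' : List BSLetter) : ofWord 1 q (w ++ w') = ofWord 1 q w * ofWord 1 q w' := rfl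

theorem ofWord_eq_iff (w w' : List BSLetter) : ofWord 1 q w = ofWord 1 q w' ↔
    ElemData.Congr q 0 0 (ElemData.ofWord q w) (ElemData.ofWord q w') := by
  rw [ElemData.congr_zero_iff, ← (ElemData.toPointed_ofWord w).1, ← (ElemData.toPointed_ofWord w).2,
    ← (ElemData.toPointed_ofWord w').1, ← (ElemData.toPointed_ofWord w').2]
  constructor
  · intro h
    rw [h]
    exact ⟨rfl, rfl⟩
  · exact fun h => (toPointed_bijective q).1 (PointedNum.ext h.1 h.2)

theorem primrecPred_finiteIndex (q : ℕ) [q.AtLeastTwo] :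
    PrimrecPred fun L : List (List BSLetter) => (subgroupOfWords q L).FiniteIndex := by
  refine PrimrecPred.of_eq (p := fun L : List (List BSLetter) =>
    (∃ w ∈ L, (ElemData.ofWord q w).2.2.2.1 ≠ (ElemData.ofWord q w).2.2.2.2) ∧
      ∃ w ∈ L, ∃ w' ∈ L, ¬ ElemData.Congr q 0 0 (ElemData.ofWord q (w ++ w'))
        (ElemData.ofWord q (w' ++ w))) ?_ fun L => ?_
  · refine PrimrecPred.and_fun (PrimrecPred.exists_mem (by fun_prop) (by fun_prop)) ?_
    refine PrimrecPred.exists_mem (by fun_prop) ?_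
    exact PrimrecPred.exists_mem (α := List (List BSLetter) × List BSLetter) (f := fun x => x.1)
      (by fun_prop) (by fun_prop)
  · unfold subgroupOfWords
    rw [finiteIndex_closure_iff]
    simp only [Set.exists_mem_image, Set.mem_ofPred_eq, ← ofWord_append, ne_eq, ofWord_eq_iff,
      (ElemData.toPointed_ofWord _).2, ElemData.pos, sub_eq_zero, Nat.cast_inj]

end BaumslagSolitar

/-- For `q ≥ 2`, it is decidable whether a given PE-regular subset of `BS(1,q)` is recognizable,
whether a given rational subset of `BS(1,q)` is recognizable, and whether a given finitely generated
subgroup of `BS(1,q)` has finite index. -/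
theorem mainTheorem4 (q : ℕ) [q.AtLeastTwo] :
    (ComputablePred fun A : FinAutomaton (PELetter q) =>
      IsRecognizable (BaumslagSolitar.peSubset q A)) ∧
    (ComputablePred fun A : FinAutomaton BSLetter =>
      IsRecognizable (BaumslagSolitar.rationalSubset q A)) ∧
    (ComputablePred fun L : List (List BSLetter) =>
      (BaumslagSolitar.subgroupOfWords q L).FiniteIndex) :=
  ⟨(BaumslagSolitar.primrecPred_isRecognizable_peSubset q).computablePred,
    BaumslagSolitar.computablePred_isRecognizable_rationalSubset q,
    (BaumslagSolitar.primrecPred_finiteIndex q).computablePred⟩
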